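/- **Definitions.** A polygon is a nonempty finite union of nondegenerate closed triangles in $\mathbb R^2$ (this includes every simple polygon, possibly with holes). For a polygon $P$ let $d(P)$ be its diameter, and for $w>0$ let $P^+(w)$ be the set of points at distance at most $w$ from some interior point of $P$, and $P^-(w)$ the set of points at distance at least $w$ from every exterior point of $P$. Write $A(X)$ for the area of $X$. Given polygons $P_1,\dots,P_n$ and $0<\phi\le 1$, put $w_i=\phi\, d(P_i)$, let $N_i$ be the number of points with integer coordinates in $P_i^+(w_i/2)$, and let $N_{\max}=\max_i N_i$ and $N_{\min}=\min_i N_i$. For a nonempty $\mathcal Q\subseteq\{P_1,\dots,P_n\}$, a legal answer (in the fuzzy model with respect to $\phi$) for $\cup\mathcal Q$ is a measurable set $X'$ with $\bigcup_{P_i\in\mathcal Q}P_i^-(w_i)\subseteq X'\subseteq\bigcup_{P_i\in\mathcal Q}P_i^+(w_i)$, and a legal answer for $\cap\mathcal Q$ is a measurable set $X'$ with $\bigcap_{P_i\in\mathcal Q}P_i^-(w_i)\subseteq X'\subseteq\bigcap_{P_i\in\mathcal Q}P_i^+(w_i)$. An $(\varepsilon,\delta)$-estimate of $\cup\mathcal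 Q$ (of $\cap\mathcal Q$) is a random number $X$ such that, for some fixed legal answer $X'$ and $\mu=A(X')$, $\Pr[|X-\mu|>\varepsilon\mu]<\delta$. The model of computation is a randomized Word RAM with unit-cost instructions. A summary is a (random) list of words; a query is answered by a fixed program whose input is the summary and the list of the indices of the members of $\mathcal Q$, and whose output is a rational number, given as a quotient of two words. Probabilities and expectations are over the random choices of the summary and of the query program. **Theorem.** There are a program for union queries, a program for intersection queries, and absolute constants $c$ and $C$ such that the following holds. Let $n\ge 1$, let $P_1,\dots,P_n\subseteq[0,u]^2$ be polygons with $u\in\mathbb N$, let $0<\varepsilon<1$, $0<\delta<1$ and $0<\phi\le 1$, and let the word size $W$ satisfy $W\ge c\log_2\left(n+u+\frac1\varepsilon+\frac1\delta\right)$. If $\phi\cdot d(P_i)\ge\sqrt 8$ for all $i$, then there is a summary of at most $$C\cdot\frac{n}{\phi^2\delta^2\varepsilon}\cdot\frac{N_{\max}}{N_{\min}}$$ words such that, for every $k\ge 1$ and every $\mathcal Q\subseteq\{P_1,\dots,P_n\}$ consisting of $k$ polygons, from the summary and $\mathcal Q$ alone * the union program computes an $(\varepsilon,\delta)$-estimate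 of $\cup\mathcal Q$ in expected time at most $C\,k/(\delta\varepsilon^2)$, and * the intersection program computes an $(\varepsilon,\delta)$-estimate of $\cap\mathcal Q$ in expected time at most $C\,k/(\phi^2\delta\varepsilon^2)$. -/

import Mathlib

namespace FuzzyPolygons

/-! ### Geometry -/

/-- The Euclidean plane. -/
abbrev Plane := EuclideanSpace ℝ (Fin 2)

/-- Polygons (possibly with holes): nonempty finite unions of nondegenerate closed triangles. -/
def IsPolygon (P : Set Plane) : Prop :=
  ∃ (m : ℕ) (T : Fin m → Fin 3 → Plane), 0 < m ∧ (∀ i, AffineIndependent ℝ (T i)) ∧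
    P = ⋃ i, convexHull ℝ (Set.range (T i))

/-- The outer range: points at distance at most `w` from some point interior to `P`. -/
def outer (P : Set Plane) (w : ℝ) : Set Plane :=
  {z | ∃ y ∈ interior P, dist z y ≤ w}

/-- The inner range: points at distance at least `w` from every point exterior to `P`. -/
def inner (P : Set Plane) (w : ℝ) : Set Plane :=
  {z | ∀ y ∈ interior Pᶜ, w ≤ dist z y}

/-- The number of points with integer coordinates in `A`. -/
noncomputable def latticeCount (A : Set Plane) : ℕ :=
  Set.ncard {z : Fin 2 → ℤ | (WithLp.toLp 2 fun j => (z j : ℝ) : Plane) ∈ A}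

/-! ### A randomized Word RAM with words of `W` bits

All values are natural numbers below `2 ^ W`. Every instruction takes one time step. -/

/-- The arithmetic operations, computed modulo `2 ^ W`. -/
inductive BinOp
  | add | sub | mul | div | mod

def BinOp.eval (W : ℕ) : BinOp → ℕ → ℕ → ℕ
  | .add, x, y => (x + y) % 2 ^ W
  | .sub, x, y => (x + (2 ^ W - y)) % 2 ^ W
  | .mul, x, y => (x * y) % 2 ^ W
  | .div, x, y => (x / y) % 2 ^ W
  | .mod, x, y => (x % y) % 2 ^ W

/-- Instructions; `d`, `a`, `b` name registers and `l` is a position in the program. -/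
inductive Instr
  /-- `r[d] := v` -/
  | const (d v : ℕ)
  /-- `r[d] := r[a] o r[b]` -/
  | op (o : BinOp) (d a b : ℕ)
  /-- `r[d] := mem[r[a]]` -/
  | load (d a : ℕ)
  /-- `mem[r[a]] := r[b]` -/
  | store (a b : ℕ)
  /-- `r[d] :=` a fresh uniformly random element of `{0, …, r[a] - 1}` -/
  | rand (d a : ℕ)
  /-- `goto l` -/
  | jump (l : ℕ)
  /-- `if r[a] < r[b] then goto l` -/
  | jumpLt (a b l : ℕ)

structure Config where
  pc : ℕ
  reg : ℕ → ℕ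
  mem : ℕ → ℕ

/-- The uniform distribution on `{0, …, b - 1}` (and the constant `0` if `b = 0`). -/
noncomputable def randBelow (b : ℕ) : PMF ℕ :=
  if h : 0 < b then PMF.uniformOfFinset (Finset.range b) ⟨0, Finset.mem_range.2 h⟩
  else PMF.pure 0

/-- Write `v` to register `d` and go to the next instruction. -/
def Config.setReg (c : Config) (d v : ℕ) : Config :=
  ⟨c.pc + 1, Function.update c.reg d v, c.mem⟩

noncomputable def Instr.exec (W : ℕ) (c : Config) : Instr → PMF Config
  | .const d v => PMF.pure (c.setReg d (v % 2 ^ W))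
  | .op o d a b => PMF.pure (c.setReg d (o.eval W (c.reg a) (c.reg b)))
  | .load d a => PMF.pure (c.setReg d (c.mem (c.reg a)))
  | .store a b => PMF.pure ⟨c.pc + 1, c.reg, Function.update c.mem (c.reg a) (c.reg b)⟩
  | .rand d a => (randBelow (c.reg a)).map (c.setReg d)
  | .jump l => PMF.pure ⟨l, c.reg, c.mem⟩
  | .jumpLt a b l => PMF.pure ⟨if c.reg a < c.reg b then l else c.pc + 1, c.reg, c.mem⟩

/-- The machine has halted when the program counter has left the program. -/
def Halted (prog : List Instr) (c : Config) : Prop := prog.length ≤ c.pc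

/-- One step; a halted machine does not move any more. -/
noncomputable def step (W : ℕ) (prog : List Instr) (c : Config) : PMF Config :=
  match prog[c.pc]? with
  | some i => i.exec W c
  | none => PMF.pure c

/-- The distribution of the configuration after `t` steps. -/
noncomputable def run (W : ℕ) (prog : List Instr) : ℕ → Config → PMF Config
  | 0, c => PMF.pure c
  | t + 1, c => (step W prog c).bind (run W prog t)

/-- The answer of a halted machine is the rational number `r[0] / r[1]`. -/
noncomputable def Config.output (c : Config) : ℝ := (c.reg 0 : ℝ) / (c.reg 1 : ℝ)

/-! ### Answering queries from a summary

A summary is a list `s` of words. A query is a duplicate-free list `q` of indices of polygons. -/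

/-- At the start of a query the memory holds the summary, followed by the query, followed by zeros.
Register `0` holds the length of the query, register `1` that of the summary. -/
def start (W : ℕ) {n : ℕ} (s : List ℕ) (q : List (Fin n)) : Config where
  pc := 0
  reg := fun i => if i = 0 then q.length % 2 ^ W else if i = 1 then s.length % 2 ^ W else 0
  mem := fun a => (s ++ q.map (Fin.val : Fin n → ℕ)).getD a 0

/-- The distribution of the configuration after `t` steps of the query program `prog` on the
query `q`, when the summary is drawn from `S`. -/
noncomputable def execution (W : ℕ) (prog : List Instr) (S : PMF (List ℕ)) {n : ℕ}
    (q : List (Fin n)) (t : ℕ) : PMF Config :=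
  S.bind fun s => run W prog t (start W s q)

/-- The expected running time `𝔼[τ] = ∑ₜ ℙ[τ > t]`, over the randomness of summary and query. -/
noncomputable def expectedTime (W : ℕ) (prog : List Instr) (S : PMF (List ℕ)) {n : ℕ}
    (q : List (Fin n)) : ENNReal :=
  ∑' t : ℕ, (execution W prog S q t).toOuterMeasure {c | ¬ Halted prog c}

/-- The query program computes an `(ε, δ)`-estimate of `μ`: the probability that it does not halt,
or halts with an answer `X` such that `|X - μ| > ε μ`, is less than `δ`. -/
def IsEstimator (W : ℕ) (prog : List Instr) (S : PMF (List ℕ)) {n : ℕ} (q : List (Fin n))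
    (ε δ μ : ℝ) : Prop :=
  ENNReal.ofReal (1 - δ) <
    ⨆ t : ℕ, (execution W prog S q t).toOuterMeasure
      {c | Halted prog c ∧ |c.output - μ| ≤ ε * μ}

/-- `X'` is a legal answer in the fuzzy model if it lies between the inner and the outer set; the
quantity to be estimated is the area of a legal answer. -/
def IsFuzzyEstimator (W : ℕ) (prog : List Instr) (S : PMF (List ℕ)) {n : ℕ} (q : List (Fin n))
    (ε δ : ℝ) (innerSet outerSet : Set Plane) : Prop :=
  ∃ X' : Set Plane, MeasurableSet X' ∧ innerSet ⊆ X' ∧ X' ⊆ outerSet ∧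
    IsEstimator W prog S q ε δ (MeasureTheory.volume X').toReal

end FuzzyPolygons

/-! Write `w = φ d` for the fuzziness of a polygon of diameter `d`. Choose a power of two `s` with
`w / (2√2) ≤ s ≤ w / √2`, and replace the polygon by the region `R` formed by the cells of the grid
of side `s` that meet its interior. A point of the inner set is an interior point, so it lies in
`R`; a point of `R` shares a cell of diagonal at most `w` with an interior point, so it lies in the
outer set. Hence unions and intersections of these regions are legal answers. Their area is a number
of unit squares, because all sides are integers. In each direction the interior meets at most `4 /
φ` cells, so a bit table and a list of the occupied cells take `O(1 / φ²)` words per polygon. The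
summary is deterministic and smaller than required: the factors `1 / (δ² ε)` and `N_max / N_min` are
at least 1.

Union: this is the coverage algorithm of Karp, Luby and Madras. Let `M` be the largest area of a
region in the query and `U` the union. An attempt draws a place `i < k` and a number `m < M`; it
fails if `m` is not the number of a unit square of region `i`. Otherwise places are drawn until one
is found whose region contains that square, and the attempt succeeds if this place is `i`. A square
lying in `cover` regions can be drawn through each of them and succeeds each time with probability
`1 / cover`, so an attempt succeeds with probability `p = |U| / (k M)`. Attempts go on until there
are `K ≈ 4 / (ε² δ)` successes; after `N` attempts the answer is `K k M / N`. The mean of `N` is `K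
/ p` and its variance `K (1 - p) / p²`, so Chebyshev's inequality bounds the error. As `M ≤ |U|`, `1
/ p ≤ k`; the expected number of trials in an attempt is `k p`. So the expected time is `O(K k)`.

Intersection: grids with power-of-two sides are nested, so each cell of the finest grid in the query
lies inside or outside every region. Testing one unit square of each cell against all regions gives
the exact area.

The probabilistic analysis of the programs rests on `cost`, bounded by potentials that decrease on
average (`union_loop_cost`). Unit cost per step gives the expected time; zero cost per step and cost
1 for a wrong answer give the error probability. The geometry is in `exists_cells`,
`inner_subset_region` and `region_subset_outer`. -/

namespace FuzzyPolygons
open MeasureTheory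
open scoped ENNReal

/-! ### Expectations over discrete distributions -/

/-- Expected value of `g` under `p`. -/
noncomputable def expect {α : Type*} (p : PMF α) (g : α → ℝ≥0∞) : ℝ≥0∞ := ∑' a, p a * g a

theorem expect_pure {α : Type*} (a : α) (g : α → ℝ≥0∞) : expect (PMF.pure a) g = g a := by
  classical
  unfold expect
  rw [tsum_eq_single a]
  · simp
  · intro b hb; simp [PMF.pure_apply, hb]

theorem expect_bind {α β : Type*} (p : PMF α) (f : α → PMF β) (g : β → ℝ≥0∞) :
    expect (p.bind f) g = expect p fun a => expect (f a) g := by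
  unfold expect
  simp only [PMF.bind_apply, ← ENNReal.tsum_mul_right, ← ENNReal.tsum_mul_left]
  rw [ENNReal.tsum_comm]
  simp only [mul_assoc]

theorem expect_map {α β : Type*} (p : PMF α) (f : α → β) (g : β → ℝ≥0∞) :
    expect (p.map f) g = expect p fun a => g (f a) := by
  rw [← PMF.bind_pure_comp, expect_bind]
  simp [expect_pure]

theorem expect_mono {α : Type*} (p : PMF α) {g h : α → ℝ≥0∞} (hgh : ∀ a, g a ≤ h a) :
    expect p g ≤ expect p h :=
  ENNReal.tsum_le_tsum fun a => by gcongr; exact hgh a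

theorem expect_add {α : Type*} (p : PMF α) (g h : α → ℝ≥0∞) :
    expect p (fun a => g a + h a) = expect p g + expect p h := by
  simp [expect, mul_add, ENNReal.tsum_add]

theorem expect_const {α : Type*} (p : PMF α) (x : ℝ≥0∞) : expect p (fun _ => x) = x := by
  simp [expect, ENNReal.tsum_mul_right, p.tsum_coe]

theorem expect_indicator {α : Type*} (p : PMF α) (s : Set α) :
    expect p (s.indicator 1) = p.toOuterMeasure s := by
  rw [PMF.toOuterMeasure_apply]
  refine tsum_congr fun a => ?_
  by_cases h : a ∈ s <;> simp [h]

theorem expect_randBelow {b : ℕ} (hb : 0 < b) (g : ℕ → ℝ≥0∞) :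
    expect (randBelow b) g = ∑ v ∈ Finset.range b, (b : ℝ≥0∞)⁻¹ * g v := by
  have : randBelow b = PMF.uniformOfFinset (Finset.range b) (Finset.nonempty_range_iff.2 hb.ne') :=
    dif_pos hb
  unfold expect
  rw [this, tsum_eq_sum (s := Finset.range b)]
  · refine Finset.sum_congr rfl fun v hv => ?_
    rw [PMF.uniformOfFinset_apply_of_mem _ hv, Finset.card_range]
  · intro v hv
    rw [PMF.uniformOfFinset_apply_of_notMem _ hv, zero_mul]

/-! ### Costs of a computation -/

open Classical in
/-- The expected cost of `t - 1` steps, where each step costs `τ` and halting in `c` costs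
`f c`. -/
noncomputable def cost (W : ℕ) (prog : List Instr) (τ : ℝ≥0∞) (f : Config → ℝ≥0∞) :
    ℕ → Config → ℝ≥0∞
  | 0, _ => 0
  | t + 1, c => if Halted prog c then f c else τ + expect (step W prog c) (cost W prog τ f t)

section
variable {W : ℕ} {prog : List Instr} {τ : ℝ≥0∞} {f : Config → ℝ≥0∞}

theorem cost_halted {t : ℕ} {c : Config} (h : Halted prog c) :
    cost W prog τ f (t + 1) c = f c := by rw [cost, if_pos h]

theorem cost_succ {t : ℕ} {c : Config} (h : ¬ Halted prog c) :
    cost W prog τ f (t + 1) c = τ + expect (step W prog c) (cost W prog τ f t) := by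
  rw [cost, if_neg h]

/-- Running out of fuel costs nothing, so further fuel can only add cost. Bounds uniform in `t`
therefore control the whole run. -/
theorem cost_mono_succ (t : ℕ) (c : Config) :
    cost W prog τ f t c ≤ cost W prog τ f (t + 1) c := by
  induction t generalizing c with
  | zero => exact zero_le
  | succ t ih =>
    by_cases h : Halted prog c
    · rw [cost_halted h, cost_halted h]
    · rw [cost_succ h, cost_succ h]
      gcongr
      exact expect_mono _ ih

theorem cost_mono (c : Config) : Monotone fun t => cost W prog τ f t c :=
  monotone_nat_of_le_succ fun t => cost_mono_succ t c

theorem step_halted {c : Config} (h : Halted prog c) : step W prog c = PMF.pure c := by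
  unfold step
  rw [List.getElem?_eq_none h]

theorem run_halted {c : Config} (h : Halted prog c) (t : ℕ) : run W prog t c = PMF.pure c := by
  induction t with
  | zero => rfl
  | succ t ih => rw [run, step_halted h, PMF.pure_bind, ih]

/-- The expected number of the first `t` steps before which the machine has not halted. -/
theorem sum_not_halted_eq_cost (t : ℕ) (c : Config) :
    ∑ i ∈ Finset.range t, (run W prog i c).toOuterMeasure {c | ¬ Halted prog c} =
      cost W prog 1 (fun _ => 0) t c := by
  induction t generalizing c with
  | zero => rfl
  | succ t ih =>
    by_cases h : Halted prog c
    · rw [cost_halted h]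
      refine Finset.sum_eq_zero fun i _ => ?_
      rw [run_halted h]
      simp [h]
    · rw [cost_succ h, Finset.sum_range_succ', add_comm]
      congr 1
      · simp [run, h]
      · simp only [← expect_indicator, run, expect_bind]
        have : cost W prog 1 (fun _ => 0) t = fun a => ∑ i ∈ Finset.range t,
            expect (run W prog i a) (({c | ¬ Halted prog c} : Set Config).indicator 1) := by
          funext a
          rw [← ih a]
          simp only [expect_indicator]
        rw [this]
        clear this ih
        induction t with
        | zero => simp [expect]
        | succ t ih => simp only [Finset.sum_range_succ, expect_add, ih]

/-- With free steps, `cost` only counts bad halts. Noticing a halt uses one unit of fuel, hence `t +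
1`. -/
theorem halted_bad_le_cost (bad : Set Config) (t : ℕ) (c : Config) :
    (run W prog t c).toOuterMeasure {c | Halted prog c ∧ c ∈ bad} ≤
      cost W prog 0 (bad.indicator 1) (t + 1) c := by
  induction t generalizing c with
  | zero =>
    by_cases h : Halted prog c
    · rw [cost_halted h]
      simp only [run, PMF.toOuterMeasure_pure_apply]
      by_cases hb : c ∈ bad <;> simp [h, hb]
    · simp [run, h]
  | succ t ih =>
    by_cases h : Halted prog c
    · rw [cost_halted h, run_halted h]
      by_cases hb : c ∈ bad <;> simp [h, hb]
    · rw [cost_succ h, zero_add, run, ← expect_indicator, expect_bind]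
      refine expect_mono _ fun a => ?_
      rw [expect_indicator]
      exact ih a

theorem tsum_not_halted_le {c : Config} {v : ℝ≥0∞}
    (h : ∀ t, cost W prog 1 (fun _ => 0) t c ≤ v) :
    ∑' t : ℕ, (run W prog t c).toOuterMeasure {c | ¬ Halted prog c} ≤ v := by
  refine ENNReal.tsum_le_of_sum_range_le fun t => ?_
  rw [sum_not_halted_eq_cost]
  exact h t

/-- If the expected time is finite and a bad halt has probability at most `v`, then the machine
halts in a good configuration with probability at least `1 - v`. -/
theorem one_le_good_add {c : Config} {v w : ℝ≥0∞} (hw : w ≠ ∞) (good : Set Config)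
    (htime : ∀ t, cost W prog 1 (fun _ => 0) t c ≤ w)
    (hbad : ∀ t, cost W prog 0 (goodᶜ.indicator 1) t c ≤ v) :
    1 ≤ (⨆ t, (run W prog t c).toOuterMeasure {c | Halted prog c ∧ c ∈ good}) + v := by
  -- A finite expected time is a convergent series of survival probabilities, so its terms tend to
  -- 0: the machine halts almost surely.
  have hlim : Filter.Tendsto
      (fun t => (run W prog t c).toOuterMeasure {c | ¬ Halted prog c}) Filter.atTop
      (nhds 0) :=
    ENNReal.tendsto_atTop_zero_of_tsum_ne_top
      (ne_top_of_le_ne_top hw (tsum_not_halted_le htime))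
  -- At every time the machine is running, has halted well or has halted badly. The first
  -- probability vanishes in the limit.
  have hle : ∀ t, 1 ≤ (run W prog t c).toOuterMeasure {c | ¬ Halted prog c} +
      ((⨆ t, (run W prog t c).toOuterMeasure {c | Halted prog c ∧ c ∈ good}) + v) := by
    intro t
    have h1 : (1 : ℝ≥0∞) = (run W prog t c).toOuterMeasure Set.univ := by
      rw [← expect_indicator, Set.indicator_univ]
      exact (expect_const _ 1).symm
    have h2 : (Set.univ : Set Config) ⊆ {c | ¬ Halted prog c} ∪
        ({c | Halted prog c ∧ c ∈ good} ∪ {c | Halted prog c ∧ c ∈ goodᶜ}) := by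
      intro a _
      by_cases h : Halted prog a <;> by_cases h' : a ∈ good <;> simp [h, h']
    rw [h1]
    refine (MeasureTheory.measure_mono h2).trans ((MeasureTheory.measure_union_le _ _).trans ?_)
    gcongr
    refine (MeasureTheory.measure_union_le _ _).trans ?_
    gcongr
    · exact le_iSup (fun t => (run W prog t c).toOuterMeasure {c | Halted prog c ∧ c ∈ good}) t
    · exact (halted_bad_le_cost _ t c).trans (hbad _)
  have := hlim.add_const
    ((⨆ t, (run W prog t c).toOuterMeasure {c | Halted prog c ∧ c ∈ good}) + v)
  rw [zero_add] at this
  exact ge_of_tendsto' this hle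

theorem not_halted_of_getElem? {c : Config} {i : Instr} (h : prog[c.pc]? = some i) :
    ¬ Halted prog c := by
  intro h'
  rw [List.getElem?_eq_none h'] at h
  cases h

/-- The only randomness is a uniform draw, so real-valued potentials after the draw just have to
average to the potential before it. -/
theorem cost_rand_le {t : ℕ} {c : Config} {d a b : ℕ} {τ v : ℝ} {g : ℕ → ℝ}
    (h : prog[c.pc]? = some (.rand d a)) (ha : c.reg a = b) (hb : 0 < b) (hτ : 0 ≤ τ)
    (hg0 : ∀ v < b, 0 ≤ g v)
    (hg : ∀ v < b,
      cost W prog (ENNReal.ofReal τ) f t (c.setReg d v) ≤ ENNReal.ofReal (g v))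
    (hv : τ + (∑ v ∈ Finset.range b, g v) / b ≤ v) :
    cost W prog (ENNReal.ofReal τ) f (t + 1) c ≤ ENNReal.ofReal v := by
  rw [cost_succ (not_halted_of_getElem? h)]
  have : step W prog c = (randBelow b).map (c.setReg d) := by
    unfold step; rw [h, ← ha]; rfl
  rw [this, expect_map, expect_randBelow hb, ← Finset.mul_sum]
  have hS : 0 ≤ ∑ v ∈ Finset.range b, g v :=
    Finset.sum_nonneg fun v hv => hg0 v (Finset.mem_range.1 hv)
  refine le_trans ?_ (ENNReal.ofReal_le_ofReal hv)
  rw [ENNReal.ofReal_add hτ (by positivity), ENNReal.ofReal_div_of_pos (by positivity),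
    ENNReal.ofReal_natCast, ENNReal.div_eq_inv_mul, ENNReal.ofReal_sum_of_nonneg
      fun v hv => hg0 v (Finset.mem_range.1 hv)]
  gcongr with i hi
  exact hg i (Finset.mem_range.1 hi)

/-! ### Deterministic segments -/

/-- The machine gets from `c` to `c'` in `m` deterministic steps. -/
inductive Steps (W : ℕ) (prog : List Instr) : ℕ → Config → Config → Prop
  | refl (c : Config) : Steps W prog 0 c c
  | head {m : ℕ} {c c₁ c₂ : Config} {i : Instr} (h : prog[c.pc]? = some i)
      (he : i.exec W c = PMF.pure c₁) (hs : Steps W prog m c₁ c₂) : Steps W prog (m + 1) c c₂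

theorem Steps.trans {m m' : ℕ} {c c₁ c₂ : Config} (h : Steps W prog m c c₁)
    (h' : Steps W prog m' c₁ c₂) : Steps W prog (m + m') c c₂ := by
  induction h with
  | refl => simpa using h'
  | head h he _ ih => rw [Nat.add_right_comm]; exact .head h he (ih h')

theorem Steps.cost_eq {m : ℕ} {c c' : Config} (h : Steps W prog m c c') (t : ℕ) :
    cost W prog τ f (t + m) c = m * τ + cost W prog τ f t c' := by
  induction h with
  | refl => simp
  | @head m c c₁ c₂ i h he _ ih =>
    rw [← Nat.add_assoc, cost_succ (not_halted_of_getElem? h)]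
    have : step W prog c = PMF.pure c₁ := by unfold step; rw [h, ← he]
    rw [this, expect_pure, ih]
    push_cast
    ring

theorem Steps.cost_le {m m' t : ℕ} {c c' : Config} (h : Steps W prog m c c') {τ v v' : ℝ}
    (hm : m ≤ m') (hτ : 0 ≤ τ) (hv0 : 0 ≤ v)
    (hv : cost W prog (ENNReal.ofReal τ) f t c' ≤ ENNReal.ofReal v)
    (hv' : m' * τ + v ≤ v') :
    cost W prog (ENNReal.ofReal τ) f (t + m) c ≤ ENNReal.ofReal v' := by
  rw [h.cost_eq]
  refine le_trans ?_ (ENNReal.ofReal_le_ofReal hv')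
  rw [ENNReal.ofReal_add (by positivity) hv0, ENNReal.ofReal_mul (by positivity),
    ENNReal.ofReal_natCast]
  gcongr

/-- From `c` the machine gets in at most `m` deterministic steps to a configuration which satisfies
`post`. -/
def Reaches (W : ℕ) (prog : List Instr) (post : Config → Prop) (m : ℕ) (c : Config) : Prop :=
  ∃ m' c', m' ≤ m ∧ Steps W prog m' c c' ∧ post c'

variable {m : ℕ} {c : Config} {post : Config → Prop} {d a b v l : ℕ}

theorem Reaches.refl (h : post c) : Reaches W prog post m c :=
  ⟨0, c, m.zero_le, .refl c, h⟩

theorem Reaches.bind {post' : Config → Prop} {m' : ℕ} (h : Reaches W prog post m c)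
    (h' : ∀ c', post c' → Reaches W prog post' m' c') : Reaches W prog post' (m + m') c := by
  obtain ⟨m₁, c₁, hm₁, hs₁, hp₁⟩ := h
  obtain ⟨m₂, c₂, hm₂, hs₂, hp₂⟩ := h' c₁ hp₁
  exact ⟨m₁ + m₂, c₂, by omega, hs₁.trans hs₂, hp₂⟩

theorem Reaches.mono {post' : Config → Prop} {m' : ℕ} (h : Reaches W prog post m c) (hm : m ≤ m')
    (h' : ∀ c', post c' → post' c') : Reaches W prog post' m' c := by
  obtain ⟨m₁, c₁, hm₁, hs₁, hp₁⟩ := h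
  exact ⟨m₁, c₁, by omega, hs₁, h' _ hp₁⟩

theorem Reaches.head {i : Instr} {c₁ : Config} (h : prog[c.pc]? = some i)
    (he : i.exec W c = PMF.pure c₁) (hs : Reaches W prog post m c₁) :
    Reaches W prog post (m + 1) c := by
  obtain ⟨m₁, c₂, hm₁, hs₁, hp₁⟩ := hs
  exact ⟨m₁ + 1, c₂, by omega, .head h he hs₁, hp₁⟩

theorem Reaches.const (h : prog[c.pc]? = some (.const d v)) (hv : v < 2 ^ W)
    (hs : Reaches W prog post m (c.setReg d v)) : Reaches W prog post (m + 1) c :=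
  .head h (by rw [Instr.exec, Nat.mod_eq_of_lt hv]) hs

theorem Reaches.op {o : BinOp} (v : ℕ) (h : prog[c.pc]? = some (.op o d a b))
    (hv : o.eval W (c.reg a) (c.reg b) = v)
    (hs : Reaches W prog post m (c.setReg d v)) : Reaches W prog post (m + 1) c :=
  .head h (by rw [Instr.exec, hv]) hs

theorem Reaches.load (v : ℕ) (h : prog[c.pc]? = some (.load d a)) (hv : c.mem (c.reg a) = v)
    (hs : Reaches W prog post m (c.setReg d v)) : Reaches W prog post (m + 1) c :=
  .head h (by rw [Instr.exec, hv]) hs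

theorem Reaches.jump (h : prog[c.pc]? = some (.jump l))
    (hs : Reaches W prog post m ⟨l, c.reg, c.mem⟩) : Reaches W prog post (m + 1) c :=
  .head h rfl hs

theorem Reaches.jumpLt_true (h : prog[c.pc]? = some (.jumpLt a b l)) (hlt : c.reg a < c.reg b)
    (hs : Reaches W prog post m ⟨l, c.reg, c.mem⟩) : Reaches W prog post (m + 1) c :=
  .head h (by rw [Instr.exec, if_pos hlt]) hs

theorem Reaches.jumpLt_false (h : prog[c.pc]? = some (.jumpLt a b l))
    (hlt : ¬ c.reg a < c.reg b)
    (hs : Reaches W prog post m ⟨c.pc + 1, c.reg, c.mem⟩) : Reaches W prog post (m + 1) c :=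
  .head h (by rw [Instr.exec, if_neg hlt]) hs

/-- By monotonicity in the fuel, the same `t` can stand on both sides. An induction on fuel thus
passes through deterministic code without accounting for its exact length. -/
theorem Reaches.cost_le {t : ℕ} {τ v v' : ℝ} (h : Reaches W prog post m c)
    (hτ : 0 ≤ τ) (hv0 : 0 ≤ v)
    (hv : ∀ c', post c' →
      cost W prog (ENNReal.ofReal τ) f t c' ≤ ENNReal.ofReal v)
    (hv' : m * τ + v ≤ v') :
    cost W prog (ENNReal.ofReal τ) f t c ≤ ENNReal.ofReal v' := by
  obtain ⟨m₁, c₁, hm₁, hs₁, hp₁⟩ := h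
  exact (cost_mono c (by omega : t ≤ t + m₁)).trans
    (hs₁.cost_le hm₁ hτ hv0 (hv _ hp₁) hv')

theorem eval_add {x y : ℕ} (h : x + y < 2 ^ W) : BinOp.add.eval W x y = x + y :=
  Nat.mod_eq_of_lt h

theorem eval_mul {x y : ℕ} (h : x * y < 2 ^ W) : BinOp.mul.eval W x y = x * y :=
  Nat.mod_eq_of_lt h

theorem eval_div {x y : ℕ} (h : x < 2 ^ W) : BinOp.div.eval W x y = x / y :=
  Nat.mod_eq_of_lt ((Nat.div_le_self _ _).trans_lt h)

theorem eval_mod {x y : ℕ} (h : x < 2 ^ W) : BinOp.mod.eval W x y = x % y :=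
  Nat.mod_eq_of_lt ((Nat.mod_le _ _).trans_lt h)

theorem eval_sub_of_le {x y : ℕ} (hx : x < 2 ^ W) (h : y ≤ x) :
    BinOp.sub.eval W x y = x - y := by
  have : x + (2 ^ W - y) = x - y + 2 ^ W := by omega
  rw [BinOp.eval, this, Nat.add_mod_right, Nat.mod_eq_of_lt (by omega)]

theorem eval_sub_of_lt {x y : ℕ} (hy : y < 2 ^ W) (h : x < y) :
    BinOp.sub.eval W x y = 2 ^ W - (y - x) := by
  rw [BinOp.eval, Nat.mod_eq_of_lt (by omega)]
  omega

end

/-! ### Regions made of grid cells and the counting of their unit squares -/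

/-- For each of `n` regions a box of `B × B` square cells of side `side i`, whose lower left cell
has the coordinates `(ax i, ay i)`, and the set of the codes `a * B + b` of those cells `(a, b)` of
the box which form the region. `K` and `κ` are parameters of the query programs. -/
structure GridData (n : ℕ) where
  B : ℕ
  K : ℕ
  κ : ℕ
  side : Fin n → ℕ
  ax : Fin n → ℕ
  ay : Fin n → ℕ
  cells : Fin n → Finset ℕ

namespace GridData

variable {n : ℕ} (D : GridData n) (i : Fin n)

/-- The unit square number `o` in the cell with code `e`. -/
def square (e o : ℕ) : ℕ × ℕ :=
  ((D.ax i + e / D.B) * D.side i + o / D.side i, (D.ay i + e % D.B) * D.side i + o % D.side i)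

/-- The unit square `z` belongs to region `i`. -/
def Contains (z : ℕ × ℕ) : Prop :=
  (D.ax i ≤ z.1 / D.side i ∧ z.1 / D.side i - D.ax i < D.B) ∧
  (D.ay i ≤ z.2 / D.side i ∧ z.2 / D.side i - D.ay i < D.B) ∧
    (z.1 / D.side i - D.ax i) * D.B + (z.2 / D.side i - D.ay i) ∈ D.cells i

/-- The unit squares of region `i`. -/
def squares : Finset (ℕ × ℕ) :=
  (D.cells i ×ˢ Finset.range (D.side i * D.side i)).image fun p => D.square i p.1 p.2

/-- The number of unit squares of region `i`. -/
def area : ℕ := (D.cells i).card * (D.side i * D.side i)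

/-- An enumeration of the cells of region `i`. -/
noncomputable def cellAt (c : ℕ) : ℕ := (D.cells i).toList.getD c 0

variable {D i}

theorem square_div {e o : ℕ} (ho : o < D.side i * D.side i) :
    (D.square i e o).1 / D.side i = D.ax i + e / D.B ∧
      (D.square i e o).2 / D.side i = D.ay i + e % D.B := by
  have hs : 0 < D.side i := Nat.pos_of_mul_pos_right (by omega : 0 < D.side i * D.side i)
  have h1 : o / D.side i < D.side i := Nat.div_lt_of_lt_mul ho
  have h2 : o % D.side i < D.side i := Nat.mod_lt _ hs
  constructor
  · show (_ * _ + _) / _ = _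
    rw [mul_comm, Nat.mul_add_div hs, Nat.div_eq_of_lt h1, add_zero]
  · show (_ * _ + _) / _ = _
    rw [mul_comm, Nat.mul_add_div hs, Nat.div_eq_of_lt h2, add_zero]

theorem square_mod {e o : ℕ} (ho : o < D.side i * D.side i) :
    (D.square i e o).1 % D.side i = o / D.side i ∧
      (D.square i e o).2 % D.side i = o % D.side i := by
  have hs : 0 < D.side i := Nat.pos_of_mul_pos_right (by omega : 0 < D.side i * D.side i)
  have h1 : o / D.side i < D.side i := Nat.div_lt_of_lt_mul ho
  constructor
  · show (_ * _ + _) % _ = _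
    rw [mul_comm, Nat.mul_add_mod, Nat.mod_eq_of_lt h1]
  · show (_ * _ + _) % _ = _
    rw [mul_comm, Nat.mul_add_mod, Nat.mod_mod]

theorem contains_square {e o : ℕ} (he : e < D.B * D.B) (ho : o < D.side i * D.side i) :
    D.Contains i (D.square i e o) ↔ e ∈ D.cells i := by
  have hB : 0 < D.B := Nat.pos_of_mul_pos_right (by omega : 0 < D.B * D.B)
  unfold Contains
  rw [(square_div ho).1, (square_div ho).2, Nat.add_sub_cancel_left, Nat.add_sub_cancel_left,
    mul_comm, Nat.div_add_mod]
  have h1 : e / D.B < D.B := Nat.div_lt_of_lt_mul he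
  have h2 : e % D.B < D.B := Nat.mod_lt _ hB
  simp [h1, h2]

theorem square_injective {e o e' o' : ℕ} (ho : o < D.side i * D.side i)
    (ho' : o' < D.side i * D.side i) (h : D.square i e o = D.square i e' o') :
    e = e' ∧ o = o' := by
  have h1 := (square_div (e := e) ho)
  have h2 := (square_mod (e := e) ho)
  rw [h] at h1 h2
  rw [(square_div ho').1, (square_div ho').2] at h1
  rw [(square_mod ho').1, (square_mod ho').2] at h2
  constructor
  · have h3 : e / D.B = e' / D.B := by omega
    have h4 : e % D.B = e' % D.B := by omega
    rw [← Nat.div_add_mod e D.B, ← Nat.div_add_mod e' D.B, h3, h4]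
  · rw [← Nat.div_add_mod o (D.side i), ← Nat.div_add_mod o' (D.side i), h2.1, h2.2]

/-- Division with remainder inverts `square`. This links the enumeration from which squares are
sampled to the arithmetic test that the machine can execute. -/
theorem mem_squares (hs : 0 < D.side i) (hc : ∀ e ∈ D.cells i, e < D.B * D.B) {z : ℕ × ℕ} :
    z ∈ D.squares i ↔ D.Contains i z := by
  constructor
  · intro h
    obtain ⟨⟨e, o⟩, hp, rfl⟩ := Finset.mem_image.1 h
    rw [Finset.mem_product, Finset.mem_range] at hp
    exact (contains_square (hc _ hp.1) hp.2).2 hp.1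
  · rintro ⟨⟨h1, h2⟩, ⟨h3, h4⟩, h5⟩
    refine Finset.mem_image.2 ⟨((z.1 / D.side i - D.ax i) * D.B + (z.2 / D.side i - D.ay i),
      z.1 % D.side i * D.side i + z.2 % D.side i), Finset.mem_product.2 ⟨h5, ?_⟩, ?_⟩
    · have a1 := Nat.mod_lt z.1 hs
      have a2 := Nat.mod_lt z.2 hs
      rw [Finset.mem_range]
      nlinarith
    · have hB : 0 < D.B := by omega
      have e1 : ((z.1 / D.side i - D.ax i) * D.B + (z.2 / D.side i - D.ay i)) / D.B =
          z.1 / D.side i - D.ax i := by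
        rw [mul_comm, Nat.mul_add_div hB, Nat.div_eq_of_lt h4, add_zero]
      have e2 : ((z.1 / D.side i - D.ax i) * D.B + (z.2 / D.side i - D.ay i)) % D.B =
          z.2 / D.side i - D.ay i := by
        rw [mul_comm, Nat.mul_add_mod, Nat.mod_eq_of_lt h4]
      have e3 : (z.1 % D.side i * D.side i + z.2 % D.side i) / D.side i = z.1 % D.side i := by
        rw [mul_comm, Nat.mul_add_div hs, Nat.div_eq_of_lt (Nat.mod_lt _ hs), add_zero]
      have e4 : (z.1 % D.side i * D.side i + z.2 % D.side i) % D.side i = z.2 % D.side i := by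
        rw [mul_comm, Nat.mul_add_mod, Nat.mod_mod]
      unfold square
      dsimp only
      rw [e1, e2, e3, e4, Nat.add_sub_cancel' h1, Nat.add_sub_cancel' h3, Nat.div_add_mod',
        Nat.div_add_mod']

theorem sum_squares (g : ℕ × ℕ → ℝ) :
    ∑ z ∈ D.squares i, g z =
      ∑ e ∈ D.cells i, ∑ o ∈ Finset.range (D.side i * D.side i), g (D.square i e o) := by
  unfold squares
  rw [Finset.sum_image, Finset.sum_product]
  rintro ⟨e, o⟩ hp ⟨e', o'⟩ hp' h
  have ho : o < _ := Finset.mem_range.1 (Finset.mem_product.1 hp).2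
  have ho' : o' < _ := Finset.mem_range.1 (Finset.mem_product.1 hp').2
  exact Prod.ext (square_injective ho ho' h).1 (square_injective ho ho' h).2

theorem card_squares : (D.squares i).card = D.area i := by
  have := sum_squares (D := D) (i := i) fun _ => 1
  simp only [Finset.sum_const, Finset.card_range, nsmul_eq_mul, mul_one] at this
  exact_mod_cast this

theorem cellAt_mem {c : ℕ} (hc : c < (D.cells i).card) : D.cellAt i c ∈ D.cells i := by
  have hc' : c < (D.cells i).toList.length := by rwa [Finset.length_toList]
  unfold cellAt
  rw [List.getD_eq_getElem _ _ hc', ← Finset.mem_toList]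
  exact List.getElem_mem hc'

theorem sum_cellAt (h : ℕ → ℝ) :
    ∑ c ∈ Finset.range (D.cells i).card, h (D.cellAt i c) = ∑ e ∈ D.cells i, h e := by
  rw [← Finset.sum_map_toList (D.cells i) h, ← Finset.length_toList, Finset.sum_range,
    ← Fin.sum_univ_fun_getElem]
  refine Finset.sum_congr rfl fun c _ => ?_
  unfold cellAt
  rw [List.getD_eq_getElem _ _ c.2]

end GridData

theorem sum_range_mul_div_mod (a b : ℕ) (h : ℕ → ℕ → ℝ) :
    ∑ m ∈ Finset.range (a * b), h (m / b) (m % b) =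
      ∑ c ∈ Finset.range a, ∑ o ∈ Finset.range b, h c o := by
  rw [Finset.sum_range, ← finProdFinEquiv.sum_comp, Fintype.sum_prod_type, Finset.sum_range]
  refine Finset.sum_congr rfl fun c _ => ?_
  rw [Finset.sum_range]
  refine Finset.sum_congr rfl fun o _ => ?_
  have hb : 0 < b := o.pos
  simp only [finProdFinEquiv_apply_val]
  rw [Nat.add_mul_div_left _ _ hb, Nat.div_eq_of_lt o.2, Nat.add_mul_mod_self_left,
    Nat.mod_eq_of_lt o.2, zero_add]

namespace GridData
variable {n : ℕ} {D : GridData n} {i : Fin n}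

/-- Unit square number `m` of region `i`. -/
noncomputable def squareAt (D : GridData n) (i : Fin n) (m : ℕ) : ℕ × ℕ :=
  D.square i (D.cellAt i (m / (D.side i * D.side i))) (m % (D.side i * D.side i))

/-- Quotient and remainder of `m` by the cell area choose the cell and the square in it, so a
uniform `m` gives a uniform unit square of the region. -/
theorem sum_squareAt (g : ℕ × ℕ → ℝ) :
    ∑ m ∈ Finset.range (D.area i), g (D.squareAt i m) = ∑ z ∈ D.squares i, g z := by
  rw [sum_squares, ← sum_cellAt, ← sum_range_mul_div_mod]
  rfl

theorem squareAt_mem {m : ℕ} (hm : m < D.area i) : D.squareAt i m ∈ D.squares i := by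
  unfold area at hm
  have hs : 0 < D.side i * D.side i := by
    refine Nat.pos_of_ne_zero fun h => ?_
    rw [h, mul_zero] at hm
    omega
  exact Finset.mem_image.2 ⟨(D.cellAt i (m / (D.side i * D.side i)),
    m % (D.side i * D.side i)), Finset.mem_product.2 ⟨cellAt_mem (Nat.div_lt_of_lt_mul
    (by rwa [mul_comm])), Finset.mem_range.2 (Nat.mod_lt _ hs)⟩, rfl⟩

/-- The number of the regions `Q 0, …, Q (k - 1)` which contain the unit square `z`. -/
def cover (D : GridData n) (Q : ℕ → Fin n) (k : ℕ) (z : ℕ × ℕ) : ℕ :=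
  ((Finset.range k).filter fun j => z ∈ D.squares (Q j)).card

/-- The unit squares of the union of the regions `Q 0, …, Q (k - 1)`. -/
def unionSquares (D : GridData n) (Q : ℕ → Fin n) (k : ℕ) : Finset (ℕ × ℕ) :=
  (Finset.range k).biUnion fun j => D.squares (Q j)

theorem cover_pos {Q : ℕ → Fin n} {k j : ℕ} {z : ℕ × ℕ} (hj : j < k) (hz : z ∈ D.squares (Q j)) :
    0 < D.cover Q k z :=
  Finset.card_pos.2 ⟨j, Finset.mem_filter.2 ⟨Finset.mem_range.2 hj, hz⟩⟩

/-- Every unit square of the union is counted once if it is divided by its cover. -/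
theorem sum_div_cover (Q : ℕ → Fin n) (k : ℕ) (g : ℕ × ℕ → ℝ) :
    ∑ j ∈ Finset.range k, ∑ z ∈ D.squares (Q j), g z / D.cover Q k z =
      ∑ z ∈ D.unionSquares Q k, g z := by
  have h1 : ∀ j ∈ Finset.range k, ∑ z ∈ D.squares (Q j), g z / D.cover Q k z =
      ∑ z ∈ D.unionSquares Q k, if z ∈ D.squares (Q j) then g z / D.cover Q k z else 0 := by
    intro j hj
    rw [← Finset.sum_filter]
    refine Finset.sum_congr ?_ fun _ _ => rfl
    ext z
    rw [Finset.mem_filter]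
    exact ⟨fun h => ⟨Finset.mem_biUnion.2 ⟨j, hj, h⟩, h⟩, fun h => h.2⟩
  -- After the exchange of sums, a square `z` contributes `cover` equal terms `g z / cover`.
  rw [Finset.sum_congr rfl h1, Finset.sum_comm]
  refine Finset.sum_congr rfl fun z hz => ?_
  obtain ⟨j, hj, hz⟩ := Finset.mem_biUnion.1 hz
  have := cover_pos (Finset.mem_range.1 hj) hz
  rw [← Finset.sum_filter, Finset.sum_const, nsmul_eq_mul]
  exact mul_div_cancel₀ _ (by exact_mod_cast this.ne')

/-- For a region of largest area this yields `1 ≤ k p`, which bounds the expected number of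
attempts. -/
theorem area_le_card_unionSquares {Q : ℕ → Fin n} {k j : ℕ} (hj : j < k) :
    D.area (Q j) ≤ (D.unionSquares Q k).card := by
  rw [← card_squares]
  exact Finset.card_le_card (Finset.subset_biUnion_of_mem (fun j => D.squares (Q j))
    (Finset.mem_range.2 hj))

end GridData

/-! ### Memory layout, maximum search and membership test -/

/-- The data `D` can be handled with words of `W` bits. -/
structure GridData.Fits (W : ℕ) {n : ℕ} (D : GridData n) : Prop where
  B_pos : 0 < D.B
  K_pos : 0 < D.K
  side_pos : ∀ i, 0 < D.side i
  side_lt : ∀ i, D.side i < D.κ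
  cells_lt : ∀ i, ∀ e ∈ D.cells i, e < D.B * D.B
  cells_nonempty : ∀ i, (D.cells i).Nonempty
  κ_lt : D.κ < 2 ^ W
  length_lt : (n + 1) * (5 + 2 * (D.B * D.B)) + n < 2 ^ W
  x_lt : ∀ i, (D.ax i + D.B) * D.side i < 2 ^ W
  y_lt : ∀ i, (D.ay i + D.B) * D.side i < 2 ^ W
  area_lt : ∀ i, 2 * (D.K * n * (D.B * D.B * (D.side i * D.side i))) < 2 ^ W

/-- The memory `mem` holds the data `D`, in blocks of `5 + 2 * B ^ 2` words, and from address `L`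
on the query `Q 0, …, Q (k - 1)`. -/
structure Layout (W : ℕ) {n : ℕ} (D : GridData n) (k L : ℕ) (Q : ℕ → Fin n) (mem : ℕ → ℕ) : Prop
    extends D.Fits W where
  k_pos : 0 < k
  k_le : k ≤ n
  L_eq : L = (n + 1) * (5 + 2 * (D.B * D.B))
  mem_S : mem 0 = 5 + 2 * (D.B * D.B)
  mem_K : mem 1 = D.K
  mem_B : mem 2 = D.B
  mem_side : ∀ i : Fin n, mem ((i + 1) * (5 + 2 * (D.B * D.B))) = D.side i
  mem_ax : ∀ i : Fin n, mem ((i + 1) * (5 + 2 * (D.B * D.B)) + 1) = D.ax i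
  mem_ay : ∀ i : Fin n, mem ((i + 1) * (5 + 2 * (D.B * D.B)) + 2) = D.ay i
  mem_area : ∀ i : Fin n, mem ((i + 1) * (5 + 2 * (D.B * D.B)) + 3) = D.area i
  mem_key : ∀ i : Fin n, mem ((i + 1) * (5 + 2 * (D.B * D.B)) + 4) = D.κ - D.side i
  mem_bit : ∀ i : Fin n, ∀ e < D.B * D.B,
    mem ((i + 1) * (5 + 2 * (D.B * D.B)) + (5 + e)) = if e ∈ D.cells i then 1 else 0
  mem_cell : ∀ i : Fin n, ∀ c < (D.cells i).card,
    mem ((i + 1) * (5 + 2 * (D.B * D.B)) + (5 + D.B * D.B + c)) = D.cellAt i c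
  mem_query : ∀ j < k, mem (L + j) = Q j

open Instr BinOp in
/-- The first part of both query programs. Positions 0 to 20 load the constants, search the query
for a region with the largest value in field `f` and go to `main`. Positions 21 to 44 test whether
the region at place `r[15]` of the query contains the unit square `(r[16], r[17])`: if so they go to
position 45, and else to `miss`. -/
def commonProg (f main miss : ℕ) : List Instr :=
  [load 2 2, const 3 1, load 4 3, op add 10 3 3, load 5 10, const 11 f, const 12 5,
   jumpLt 6 0 9, jump main, op add 13 1 6, load 13 13, op mul 13 13 2, op add 13 13 2,
   op add 14 13 11, load 14 14, op add 6 6 3, jumpLt 8 14 18, jump 7, op add 8 14 9,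
   op add 7 13 9, jump 7,
   op add 13 1 15, load 13 13, op mul 13 13 2, op add 13 13 2, load 14 13,
   op add 18 13 3, load 18 18, op div 19 16 14, op sub 19 19 18, jumpLt 19 5 32, jump miss,
   op add 18 13 10, load 18 18, op div 20 17 14, op sub 20 20 18, jumpLt 20 5 38, jump miss,
   op mul 19 19 5, op add 19 19 20, op add 19 19 12, op add 19 19 13, load 19 19,
   jumpLt 9 19 45, jump miss]

theorem Config.setReg_reg (c : Config) (d v r : ℕ) :
    (c.setReg d v).reg r = if r = d then v else c.reg r := by
  simp [Config.setReg, Function.update_apply]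

theorem Config.setReg_mem (c : Config) (d v : ℕ) : (c.setReg d v).mem = c.mem := rfl

theorem Config.setReg_pc (c : Config) (d v : ℕ) : (c.setReg d v).pc = c.pc + 1 := rfl

section
variable {W n k L : ℕ} {D : GridData n} {Q : ℕ → Fin n} {mem : ℕ → ℕ}

theorem Layout.L_add_lt (h : Layout W D k L Q mem) : L + n < 2 ^ W := by
  rw [h.L_eq]
  exact h.length_lt

theorem Layout.addr_lt (h : Layout W D k L Q mem) (i : Fin n) {t : ℕ}
    (ht : t < 5 + 2 * (D.B * D.B)) : (i + 1) * (5 + 2 * (D.B * D.B)) + t < 2 ^ W := by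
  have h1 := h.L_add_lt
  rw [h.L_eq] at h1
  have h2 : (i + 1 + 1) * (5 + 2 * (D.B * D.B)) ≤ (n + 1) * (5 + 2 * (D.B * D.B)) :=
    Nat.mul_le_mul_right _ (by omega)
  rw [Nat.add_mul] at h2
  omega

theorem Layout.ax_add_lt (h : Layout W D k L Q mem) (i : Fin n) : D.ax i + D.B < 2 ^ W :=
  (Nat.le_mul_of_pos_right _ (h.side_pos i)).trans_lt (h.x_lt i)

theorem Layout.ay_add_lt (h : Layout W D k L Q mem) (i : Fin n) : D.ay i + D.B < 2 ^ W :=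
  (Nat.le_mul_of_pos_right _ (h.side_pos i)).trans_lt (h.y_lt i)

theorem Layout.area_pos (h : Layout W D k L Q mem) (i : Fin n) : 0 < D.area i :=
  Nat.mul_pos (Finset.card_pos.2 (h.cells_nonempty i))
    (Nat.mul_pos (h.side_pos i) (h.side_pos i))

theorem Layout.card_le (h : Layout W D k L Q mem) (i : Fin n) :
    (D.cells i).card ≤ D.B * D.B := by
  have := Finset.card_le_card (fun e he => Finset.mem_range.2 (h.cells_lt i e he))
  rwa [Finset.card_range] at this

theorem Layout.mul_area_lt (h : Layout W D k L Q mem) (i : Fin n) :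
    2 * (D.K * k * D.area i) < 2 ^ W := by
  refine lt_of_le_of_lt ?_ (h.area_lt i)
  gcongr
  · exact h.k_le
  · exact Nat.mul_le_mul_right _ (h.card_le i)

theorem Layout.box_lt (h : Layout W D k L Q mem) : D.B * D.B < 2 ^ W := by
  have := h.addr_lt (Q 0) (t := D.B * D.B) (by omega)
  omega

/-- After the first part of the program, the registers hold the parameters and `7` and `8` the
address of a region and its value in field `f`. -/
structure Ctx (W : ℕ) (D : GridData n) (k L : ℕ) (Q : ℕ → Fin n) (f b M : ℕ) (c : Config) :
    Prop where
  layout : Layout W D k L Q c.mem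
  r0 : c.reg 0 = k
  r1 : c.reg 1 = L
  r2 : c.reg 2 = 5 + 2 * (D.B * D.B)
  r3 : c.reg 3 = 1
  r4 : c.reg 4 = D.K
  r5 : c.reg 5 = D.B
  r7 : c.reg 7 = b
  r8 : c.reg 8 = M
  r9 : c.reg 9 = 0
  r10 : c.reg 10 = 2
  r11 : c.reg 11 = f
  r12 : c.reg 12 = 5

/-- `c'` differs from `c` only in auxiliary registers and in the program counter. -/
def Same (c c' : Config) : Prop :=
  c'.mem = c.mem ∧ ∀ r, r ∉ [13, 14, 18, 19, 20] → c'.reg r = c.reg r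

theorem Ctx.same {f b M : ℕ} {c c' : Config} (h : Ctx W D k L Q f b M c) (hs : Same c c') :
    Ctx W D k L Q f b M c' where
  layout := hs.1 ▸ h.layout
  r0 := (hs.2 _ (by decide)).trans h.r0
  r1 := (hs.2 _ (by decide)).trans h.r1
  r2 := (hs.2 _ (by decide)).trans h.r2
  r3 := (hs.2 _ (by decide)).trans h.r3
  r4 := (hs.2 _ (by decide)).trans h.r4
  r5 := (hs.2 _ (by decide)).trans h.r5
  r7 := (hs.2 _ (by decide)).trans h.r7
  r8 := (hs.2 _ (by decide)).trans h.r8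
  r9 := (hs.2 _ (by decide)).trans h.r9
  r10 := (hs.2 _ (by decide)).trans h.r10
  r11 := (hs.2 _ (by decide)).trans h.r11
  r12 := (hs.2 _ (by decide)).trans h.r12

theorem Ctx.setReg {f b M : ℕ} {c : Config} (h : Ctx W D k L Q f b M c) {d : ℕ} (v : ℕ)
    (hd : d ∉ [0, 1, 2, 3, 4, 5, 7, 8, 9, 10, 11, 12]) :
    Ctx W D k L Q f b M (c.setReg d v) := by
  have key : ∀ r ∈ [0, 1, 2, 3, 4, 5, 7, 8, 9, 10, 11, 12], (c.setReg d v).reg r = c.reg r := by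
    intro r hr
    rw [Config.setReg_reg, if_neg]
    rintro rfl
    exact hd hr
  exact
  { layout := h.layout
    r0 := (key _ (by decide)).trans h.r0
    r1 := (key _ (by decide)).trans h.r1
    r2 := (key _ (by decide)).trans h.r2
    r3 := (key _ (by decide)).trans h.r3
    r4 := (key _ (by decide)).trans h.r4
    r5 := (key _ (by decide)).trans h.r5
    r7 := (key _ (by decide)).trans h.r7
    r8 := (key _ (by decide)).trans h.r8
    r9 := (key _ (by decide)).trans h.r9
    r10 := (key _ (by decide)).trans h.r10
    r11 := (key _ (by decide)).trans h.r11
    r12 := (key _ (by decide)).trans h.r12 }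

theorem Ctx.pc {f b M : ℕ} {c : Config} (h : Ctx W D k L Q f b M c) (l : ℕ) :
    Ctx W D k L Q f b M ⟨l, c.reg, c.mem⟩ :=
  ⟨h.1, h.2, h.3, h.4, h.5, h.6, h.7, h.8, h.9, h.10, h.11, h.12, h.13⟩

/-- The subtraction of the machine decides whether a coordinate lies in the box. -/
theorem eval_sub_lt_iff {a B v : ℕ} (hv : v < 2 ^ W) (ha : a + B < 2 ^ W) :
    BinOp.sub.eval W v a < B ↔ a ≤ v ∧ v - a < B := by
  by_cases h : a ≤ v
  · rw [eval_sub_of_le hv h]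
    simp [h]
  · rw [eval_sub_of_lt (by omega) (by omega)]
    omega

variable {f main miss b M : ℕ} {tail : List Instr}

/-- The address of a block. -/
theorem Layout.block_lt (h : Layout W D k L Q mem) (i : Fin n) :
    (i : ℕ) * (5 + 2 * (D.B * D.B)) + (5 + 2 * (D.B * D.B)) < 2 ^ W := by
  have := h.addr_lt i (t := 0) (by omega)
  rwa [add_zero, Nat.add_mul, one_mul] at this

theorem Layout.query_lt (h : Layout W D k L Q mem) {j : ℕ} (hj : j < k) : L + j < 2 ^ W := by
  have := h.L_add_lt
  have := h.k_le
  omega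

theorem Layout.L_pos (h : Layout W D k L Q mem) : 0 < L := by
  rw [h.L_eq]
  positivity

open Classical in
/-- The membership test. -/
theorem test_steps {c : Config} {j x y : ℕ} (hc : Ctx W D k L Q f b M c) (hpc : c.pc = 21)
    (hj : j < k) (h15 : c.reg 15 = j) (h16 : c.reg 16 = x) (h17 : c.reg 17 = y)
    (hx : x < 2 ^ W) (hy : y < 2 ^ W) :
    Reaches W (commonProg f main miss ++ tail) (fun c' => Same c c' ∧
      c'.pc = if D.Contains (Q j) (x, y) then 45 else miss) 24 c := by
  obtain ⟨pc, reg, mem⟩ := c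
  dsimp only at hpc h15 h16 h17
  subst hpc
  have hl := hc.layout
  obtain ⟨-, r0, r1, r2, r3, r4, r5, r7, r8, r9, r10, r11, r12⟩ := hc
  dsimp only at hl r0 r1 r2 r3 r4 r5 r7 r8 r9 r10 r11 r12
  have hblock := hl.block_lt (Q j)
  have a0 := hl.mem_side (Q j)
  have a1 := hl.mem_ax (Q j)
  have a2 := hl.mem_ay (Q j)
  have a5 := hl.mem_bit (Q j)
  have b1 := hl.addr_lt (Q j) (t := 1) (by omega)
  have b2 := hl.addr_lt (Q j) (t := 2) (by omega)
  have b5 : ∀ e < D.B * D.B, _ := fun e he => hl.addr_lt (Q j) (t := 5 + e) (by omega)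
  have hd := hl.box_lt
  rw [Nat.add_mul, one_mul] at a0 a1 a2 b1 b2
  simp only [Nat.add_mul, one_mul] at a5 b5
  set S := 5 + 2 * (D.B * D.B) with hS
  have hdx : x / D.side (Q j) < 2 ^ W := (Nat.div_le_self _ _).trans_lt hx
  have hdy : y / D.side (Q j) < 2 ^ W := (Nat.div_le_self _ _).trans_lt hy
  refine .op (L + j) rfl ?_ ?_
  · simp only [r1, h15]; exact eval_add (hl.query_lt hj)
  refine .load (Q j) rfl ?_ ?_
  · simp [Config.setReg_reg, Config.setReg_mem, hl.mem_query j hj]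
  refine .op (Q j * S) rfl ?_ ?_
  · simp only [Config.setReg_reg]; simp [r2]; exact eval_mul (by omega)
  refine .op (Q j * S + S) rfl ?_ ?_
  · simp [Config.setReg_reg, r2]; exact eval_add hblock
  refine .load _ rfl (by simp [Config.setReg_reg, Config.setReg_mem, a0]; rfl) ?_
  refine .op _ rfl (by simp [Config.setReg_reg, r3]; exact eval_add b1) ?_
  refine .load _ rfl (by simp [Config.setReg_reg, Config.setReg_mem, a1]; rfl) ?_
  refine .op _ rfl (by simp [Config.setReg_reg, h16]; exact eval_div hx) ?_
  refine .op (BinOp.sub.eval W (x / D.side (Q j)) (D.ax (Q j))) rfl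
    (by simp [Config.setReg_reg]) ?_
  by_cases hX : D.ax (Q j) ≤ x / D.side (Q j) ∧ x / D.side (Q j) - D.ax (Q j) < D.B
  swap
  · refine .jumpLt_false rfl ?_ (.jump rfl (.refl ⟨?_, ?_⟩))
    · simp only [Config.setReg_reg]
      simpa [r5, eval_sub_lt_iff hdx (hl.ax_add_lt _)] using hX
    · exact ⟨rfl, fun r hr => by simp at hr; simp [Config.setReg_reg, hr]⟩
    · exact (if_neg fun h => hX h.1).symm
  refine .jumpLt_true rfl ?_ ?_
  · simp only [Config.setReg_reg]
    simpa [r5, eval_sub_lt_iff hdx (hl.ax_add_lt _)] using hX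
  rw [eval_sub_of_le hdx hX.1]
  refine .op _ rfl (by simp [Config.setReg_reg, r10]; exact eval_add b2) ?_
  refine .load _ rfl (by simp [Config.setReg_reg, Config.setReg_mem, a2]; rfl) ?_
  refine .op _ rfl (by simp [Config.setReg_reg, h17]; exact eval_div hy) ?_
  refine .op (BinOp.sub.eval W (y / D.side (Q j)) (D.ay (Q j))) rfl
    (by simp [Config.setReg_reg]) ?_
  by_cases hY : D.ay (Q j) ≤ y / D.side (Q j) ∧ y / D.side (Q j) - D.ay (Q j) < D.B
  swap
  · refine .jumpLt_false rfl ?_ (.jump rfl (.refl ⟨?_, ?_⟩))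
    · simp only [Config.setReg_reg]
      simpa [r5, eval_sub_lt_iff hdy (hl.ay_add_lt _)] using hY
    · exact ⟨rfl, fun r hr => by simp at hr; simp [Config.setReg_reg, hr]⟩
    · exact (if_neg fun h => hY h.2.1).symm
  refine .jumpLt_true rfl ?_ ?_
  · simp only [Config.setReg_reg]
    simpa [r5, eval_sub_lt_iff hdy (hl.ay_add_lt _)] using hY
  rw [eval_sub_of_le hdy hY.1]
  set a := x / D.side (Q j) - D.ax (Q j)
  set b' := y / D.side (Q j) - D.ay (Q j)
  have he : a * D.B + b' < D.B * D.B := by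
    have h1 : (a + 1) * D.B ≤ D.B * D.B := Nat.mul_le_mul_right _ hX.2
    have h2 := hY.2
    rw [Nat.add_mul] at h1
    omega
  have hb5 := b5 _ he
  refine .op _ rfl (by simp [Config.setReg_reg, r5]; exact eval_mul (by omega)) ?_
  refine .op _ rfl (by simp [Config.setReg_reg]; exact eval_add (by omega)) ?_
  refine .op _ rfl (by simp [Config.setReg_reg, r12]; exact eval_add (by omega)) ?_
  refine .op (Q j * S + S + (5 + (a * D.B + b'))) rfl
    (by simp [Config.setReg_reg]; rw [eval_add (by omega)]; omega) ?_
  refine .load _ rfl (by simp [Config.setReg_reg, Config.setReg_mem, a5 _ he]; rfl) ?_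
  by_cases hZ : a * D.B + b' ∈ D.cells (Q j)
  · refine .jumpLt_true rfl (by simp [Config.setReg_reg, r9, hZ]) (.refl ⟨?_, ?_⟩)
    · exact ⟨rfl, fun r hr => by simp at hr; simp [Config.setReg_reg, hr]⟩
    · exact (if_pos ⟨hX, hY, hZ⟩).symm
  · refine .jumpLt_false rfl (by simp [Config.setReg_reg, r9, hZ]) (.jump rfl (.refl ⟨?_, ?_⟩))
    · exact ⟨rfl, fun r hr => by simp at hr; simp [Config.setReg_reg, hr]⟩
    · exact (if_neg fun h => hZ h.2.2).symm

/-- The start of a query: registers and memory. -/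
structure Start (W : ℕ) (D : GridData n) (k L : ℕ) (Q : ℕ → Fin n) (c : Config) : Prop where
  layout : Layout W D k L Q c.mem
  pc : c.pc = 0
  r0 : c.reg 0 = k
  r1 : c.reg 1 = L
  zero : ∀ r, 2 ≤ r → c.reg r = 0

/-- The search for the largest value, after `j` regions. -/
structure Search (W : ℕ) (D : GridData n) (k L : ℕ) (Q : ℕ → Fin n) (f : ℕ) (val : Fin n → ℕ)
    (j : ℕ) (c : Config) : Prop where
  ctx : Ctx W D k L Q f (c.reg 7) (c.reg 8) c
  pc : c.pc = 7
  r6 : c.reg 6 = j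
  zero : ∀ r, 15 ≤ r → c.reg r = 0
  le : ∀ j' < j, val (Q j') ≤ c.reg 8
  eq : (j = 0 ∧ c.reg 8 = 0) ∨
    ∃ j' < j, c.reg 8 = val (Q j') ∧ c.reg 7 = (Q j' + 1) * (5 + 2 * (D.B * D.B))

variable {val : Fin n → ℕ}

theorem init_steps {c : Config} (hc : Start W D k L Q c) (hf : f < 5) (val : Fin n → ℕ) :
    Reaches W (commonProg f main miss ++ tail)
      (fun c' => Search W D k L Q f val 0 c' ∧ c'.mem = c.mem) 7 c := by
  obtain ⟨pc, reg, mem⟩ := c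
  obtain ⟨hl, hpc, r0, r1, hz⟩ := hc
  dsimp only at hl hpc r0 r1 hz
  subst hpc
  have h5 : 5 < 2 ^ W := by have := hl.block_lt (Q 0); omega
  refine .load _ rfl (by simp [hz, hl.mem_S]; rfl) ?_
  refine .const rfl (by omega) ?_
  refine .load _ rfl (by simp [Config.setReg_reg, Config.setReg_mem, hl.mem_K]; rfl) ?_
  refine .op 2 rfl (by simp [Config.setReg_reg]; exact eval_add (by omega)) ?_
  refine .load _ rfl (by simp [Config.setReg_reg, Config.setReg_mem, hl.mem_B]; rfl) ?_
  refine .const rfl (by omega) ?_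
  refine .const rfl h5 (.refl ⟨?_, rfl⟩)
  constructor
  · constructor <;> simp [Config.setReg_reg, Config.setReg_mem, hl, r0, r1, hz]
  · rfl
  · simp [Config.setReg_reg, hz]
  · intro r hr
    rw [Config.setReg_reg, if_neg (by omega), Config.setReg_reg, if_neg (by omega),
      Config.setReg_reg, if_neg (by omega), Config.setReg_reg, if_neg (by omega),
      Config.setReg_reg, if_neg (by omega), Config.setReg_reg, if_neg (by omega),
      Config.setReg_reg, if_neg (by omega)]
    exact hz r (by omega)
  · intro j hj; omega
  · left; simp [Config.setReg_reg, hz]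

theorem search_step {c : Config} {j : ℕ} (hc : Search W D k L Q f val j c) (hj : j < k)
    (hf : f < 5) (hval : ∀ (i : Fin n), c.mem ((i + 1) * (5 + 2 * (D.B * D.B)) + f) = val i)
    (hpos : ∀ i, 0 < val i) (hvlt : ∀ i, val i < 2 ^ W) :
    Reaches W (commonProg f main miss ++ tail)
      (fun c' => Search W D k L Q f val (j + 1) c' ∧ c'.mem = c.mem) 13 c := by
  obtain ⟨pc, reg, mem⟩ := c
  obtain ⟨hctx, hpc, r6, hz, hle, heq⟩ := hc
  obtain ⟨hl, r0, r1, r2, r3, r4, r5, -, -, r9, r10, r11, r12⟩ := hctx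
  dsimp only at hl r0 r1 r2 r3 r4 r5 r9 r10 r11 r12 hpc r6 hz hle heq hval
  subst hpc
  have hblock := hl.block_lt (Q j)
  have a := hval (Q j)
  have b := hl.addr_lt (Q j) (t := f) (by omega)
  have hLj := hl.query_lt hj
  have hL0 := hl.L_pos
  rw [Nat.add_mul, one_mul] at a b
  simp only [Nat.add_mul, one_mul] at heq
  set S := 5 + 2 * (D.B * D.B) with hS
  refine .jumpLt_true rfl (by simp [r6, r0, hj]) ?_
  refine .op _ rfl (by simp [r1, r6]; exact eval_add hLj) ?_
  refine .load (Q j) rfl (by simp [Config.setReg_reg, Config.setReg_mem, hl.mem_query j hj]) ?_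
  refine .op _ rfl (by simp [Config.setReg_reg, r2]; exact eval_mul (by omega)) ?_
  refine .op _ rfl (by simp [Config.setReg_reg, r2]; exact eval_add hblock) ?_
  refine .op _ rfl (by simp [Config.setReg_reg, r11]; exact eval_add b) ?_
  refine .load _ rfl (by simp [Config.setReg_reg, Config.setReg_mem, a]; rfl) ?_
  refine .op _ rfl (by simp [Config.setReg_reg, r6, r3]; exact eval_add (by omega)) ?_
  by_cases h : reg 8 < val (Q j)
  · refine .jumpLt_true rfl (by simp [Config.setReg_reg, h]) ?_
    refine .op (val (Q j)) rfl (by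
      simp [Config.setReg_reg, r9]
      exact eval_add (hvlt _)) ?_
    refine .op (Q j * S + S) rfl (by
      simp only [Config.setReg_reg]
      simp [r9]; exact eval_add hblock) ?_
    refine .jump rfl (.refl ⟨?_, rfl⟩)
    constructor
    · constructor <;> simp [Config.setReg_reg, Config.setReg_mem, hl, r0, r1, r2, r3, r4, r5, r9,
        r10, r11, r12, hS]
    · rfl
    · simp [Config.setReg_reg]
    · intro r hr
      simp (disch := omega) only [Config.setReg_reg, if_neg]
      exact hz r hr
    · intro j' hj'
      simp [Config.setReg_reg]
      rcases Nat.lt_succ_iff_lt_or_eq.1 hj' with h' | rfl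
      · exact (hle j' h').trans h.le
      · exact le_rfl
    · right
      refine ⟨j, by omega, ?_, ?_⟩ <;> simp [Config.setReg_reg, Nat.add_mul, hS]
  · refine .jumpLt_false rfl (by simpa [Config.setReg_reg] using h) ?_
    refine .jump rfl (.refl ⟨?_, rfl⟩)
    constructor
    · constructor <;> simp [Config.setReg_reg, Config.setReg_mem, hl, r0, r1, r2, r3, r4, r5, r9,
        r10, r11, r12, hS]
    · rfl
    · simp [Config.setReg_reg]
    · intro r hr
      simp (disch := omega) only [Config.setReg_reg, if_neg]
      exact hz r hr
    · intro j' hj'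
      simp [Config.setReg_reg]
      rcases Nat.lt_succ_iff_lt_or_eq.1 hj' with h' | rfl
      · exact hle j' h'
      · exact not_lt.1 h
    · right
      -- The initial maximum 0 cannot survive a region, since all values are positive.
      rcases heq with ⟨-, h0⟩ | ⟨j', hj', h1, h2⟩
      · have := hpos (Q j); omega
      · refine ⟨j', by omega, ?_, ?_⟩
        · simpa [Config.setReg_reg] using h1
        · simpa [Config.setReg_reg, Nat.add_mul] using h2

/-- What the first part of the program achieves. -/
theorem search_steps {c : Config} (hc : Start W D k L Q c) (hf : f < 5)
    (hval : ∀ (i : Fin n), c.mem ((i + 1) * (5 + 2 * (D.B * D.B)) + f) = val i)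
    (hpos : ∀ i, 0 < val i) (hvlt : ∀ i, val i < 2 ^ W) :
    Reaches W (commonProg f main miss ++ tail) (fun c' =>
      (∃ j < k, (∀ j' < k, val (Q j') ≤ val (Q j)) ∧
        Ctx W D k L Q f ((Q j + 1) * (5 + 2 * (D.B * D.B))) (val (Q j)) c') ∧
      c'.pc = main ∧ ∀ r, 15 ≤ r → c'.reg r = 0) (7 + 13 * k + 2) c := by
  have main_loop : ∀ j ≤ k, Reaches W (commonProg f main miss ++ tail)
      (fun c' => Search W D k L Q f val j c' ∧
        ∀ (i : Fin n), c'.mem ((i + 1) * (5 + 2 * (D.B * D.B)) + f) = val i) (7 + 13 * j) c := by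
    intro j
    induction j with
    | zero =>
      intro _
      refine (init_steps hc hf val).mono (by omega) fun c' hc' => ⟨hc'.1, ?_⟩
      rw [hc'.2]
      exact hval
    | succ j ih =>
      intro hj
      refine ((ih (by omega)).bind fun c₁ h₁ =>
        (search_step h₁.1 (by omega) hf h₁.2 hpos hvlt).mono le_rfl fun c₂ h₂ =>
          ⟨h₂.1, h₂.2 ▸ h₁.2⟩).mono (by ring_nf; exact le_rfl) fun _ h => h
  have hk := hc.layout.k_pos
  refine ((main_loop k le_rfl).bind fun c₁ h₁ => ?_)
  obtain ⟨hs, -⟩ := h₁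
  obtain ⟨pc, reg, mem⟩ := c₁
  obtain ⟨hctx, hpc, r6, hz, hle, heq⟩ := hs
  dsimp only at hpc r6 hz hle heq
  subst hpc
  refine .jumpLt_false rfl (by simp [r6, show reg 0 = k from hctx.r0]) (.jump rfl (.refl ⟨?_, rfl, hz⟩))
  rcases heq with ⟨h0, -⟩ | ⟨j, hj, h1, h2⟩
  · omega
  · dsimp only at hctx
    rw [h1] at hle
    rw [h1, h2] at hctx
    exact ⟨j, hj, hle, hctx.pc main⟩

end

/-! ### The union program, segment by segment -/

open Instr BinOp in
/-- The second part of the program for union queries. From position 48 on a region `r[22]` and a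
number `r[25]` below the largest area are drawn; if there is a unit square of that number in the
region, then from position 84 on regions are drawn until one, `r[15]`, contains that square. It
counts as a success if `r[15] = r[22]`. `r[23]` counts the successes and `r[24]` the attempts. -/
def unionTail : List Instr :=
  [jumpLt 15 22 48, jumpLt 22 15 48, op add 23 23 3,
   jumpLt 23 4 50, jump 86, op add 24 24 3, rand 22 0, rand 25 8,
   op add 13 1 22, load 13 13, op mul 13 13 2, op add 13 13 2, load 14 13,
   op add 18 13 11, load 18 18, jumpLt 25 18 62, jump 48,
   op mul 18 14 14, op div 19 25 18, op mod 25 25 18,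
   op mul 20 5 5, op add 20 20 12, op add 20 20 19, op add 20 20 13, load 20 20,
   op div 16 20 5, op mod 17 20 5,
   op add 18 13 3, load 18 18, op add 16 18 16, op mul 16 16 14, op div 19 25 14,
   op add 16 16 19,
   op add 18 13 10, load 18 18, op add 17 18 17, op mul 17 17 14, op mod 19 25 14,
   op add 17 17 19,
   rand 15 0, jump 21,
   op mul 0 0 4, op mul 0 0 8, op add 1 24 9]

/-- The program for union queries. -/
def unionQuery : List Instr := commonProg 3 48 84 ++ unionTail

section
variable {W n k L : ℕ} {D : GridData n} {Q : ℕ → Fin n} {b M : ℕ}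

/-- `s` successes in `N` attempts; the counter of the attempts may have overflowed. -/
structure Counts (W : ℕ) (D : GridData n) (k L : ℕ) (Q : ℕ → Fin n) (b M s N : ℕ) (c : Config) :
    Prop where
  ctx : Ctx W D k L Q 3 b M c
  r23 : c.reg 23 = s
  r24 : c.reg 24 = N % 2 ^ W

theorem Counts.setReg {s N : ℕ} {c : Config} (h : Counts W D k L Q b M s N c) {d : ℕ} (v : ℕ)
    (hd : d ∉ [0, 1, 2, 3, 4, 5, 7, 8, 9, 10, 11, 12]) (h23 : d ≠ 23) (h24 : d ≠ 24) :
    Counts W D k L Q b M s N (c.setReg d v) :=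
  ⟨h.ctx.setReg v hd, by rw [Config.setReg_reg, if_neg h23.symm, h.r23],
    by rw [Config.setReg_reg, if_neg h24.symm, h.r24]⟩

theorem Counts.pc {s N : ℕ} {c : Config} (h : Counts W D k L Q b M s N c) (l : ℕ) :
    Counts W D k L Q b M s N ⟨l, c.reg, c.mem⟩ := ⟨h.1.pc l, h.2, h.3⟩

theorem Counts.same {s N : ℕ} {c c' : Config} (h : Counts W D k L Q b M s N c)
    (hs : Same c c') : Counts W D k L Q b M s N c' :=
  ⟨h.1.same hs, (hs.2 _ (by decide)).trans h.2, (hs.2 _ (by decide)).trans h.3⟩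

/-- A unit square `z` of region `Q i` has been drawn. -/
structure Drawn (W : ℕ) (D : GridData n) (k L : ℕ) (Q : ℕ → Fin n) (b M i : ℕ) (z : ℕ × ℕ)
    (s N : ℕ) (c : Config) : Prop where
  counts : Counts W D k L Q b M s N c
  r16 : c.reg 16 = z.1
  r17 : c.reg 17 = z.2
  r22 : c.reg 22 = i

theorem Layout.square_lt {mem : ℕ → ℕ} (h : Layout W D k L Q mem) {i : Fin n} {z : ℕ × ℕ}
    (hz : z ∈ D.squares i) : z.1 < 2 ^ W ∧ z.2 < 2 ^ W := by
  obtain ⟨⟨h1, h2⟩, ⟨h3, h4⟩, -⟩ := (GridData.mem_squares (h.side_pos i) (h.cells_lt i)).1 hz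
  constructor
  · refine lt_trans ?_ (h.x_lt i)
    exact (Nat.div_lt_iff_lt_mul (h.side_pos i)).1 (by omega)
  · refine lt_trans ?_ (h.y_lt i)
    exact (Nat.div_lt_iff_lt_mul (h.side_pos i)).1 (by omega)

/-- The frequency `K / N` estimates `p = |U| / (k M)`, so the answer for `|U|` is `K k M / N`. -/
theorem finish_steps {c : Config} {N : ℕ} (hc : Counts W D k L Q b M D.K N c)
    (hpc : c.pc = 48) (hM : D.K * k * M < 2 ^ W) (hM0 : 0 < M) :
    Reaches W unionQuery (fun c' => c'.pc = 89 ∧ c'.reg 0 = D.K * k * M ∧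
      c'.reg 1 = N % 2 ^ W) 5 c := by
  obtain ⟨pc, reg, mem⟩ := c
  obtain ⟨⟨hl, r0, r1, r2, r3, r4, r5, r7, r8, r9, r10, r11, r12⟩, r23, r24⟩ := hc
  dsimp only at hl r0 r1 r2 r3 r4 r5 r7 r8 r9 r10 r11 r12 r23 r24 hpc
  subst hpc
  have h1 : D.K * k ≤ D.K * k * M := Nat.le_mul_of_pos_right _ hM0
  have h2 : N % 2 ^ W < 2 ^ W := Nat.mod_lt _ (by positivity)
  refine .jumpLt_false rfl (by simp [r23, r4]) (.jump rfl ?_)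
  refine .op (D.K * k) rfl (by simp [r0, r4]; rw [eval_mul] <;> rw [mul_comm]; omega) ?_
  refine .op _ rfl (by simp [Config.setReg_reg, r8]; exact eval_mul hM) ?_
  refine .op (N % 2 ^ W) rfl (by simp [Config.setReg_reg, r24, r9]; exact eval_add h2) ?_
  exact .refl ⟨rfl, by simp [Config.setReg_reg], by simp [Config.setReg_reg]⟩

theorem attempt_steps {c : Config} {s N : ℕ} (hc : Counts W D k L Q b M s N c)
    (hpc : c.pc = 48) (hs : s < D.K) :
    Reaches W unionQuery (fun c' => Counts W D k L Q b M s (N + 1) c' ∧ c'.pc = 51) 2 c := by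
  obtain ⟨pc, reg, mem⟩ := c
  have hc' := hc.ctx
  obtain ⟨⟨hl, r0, r1, r2, r3, r4, r5, r7, r8, r9, r10, r11, r12⟩, r23, r24⟩ := hc
  dsimp only at hl r0 r1 r2 r3 r4 r5 r7 r8 r9 r10 r11 r12 r23 r24 hpc
  subst hpc
  refine .jumpLt_true rfl (by simp [r23, r4, hs]) ?_
  refine .op ((N + 1) % 2 ^ W) rfl (by simp [r24, r3, BinOp.eval]) (.refl ⟨⟨?_, ?_, ?_⟩, rfl⟩)
  · exact (hc'.pc 50).setReg _ (by decide)
  · simp [Config.setReg_reg, r23]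
  · simp [Config.setReg_reg]

/-- Rejection sampling: each pair of a place and a unit square of its region is drawn with the same
probability `1 / (k M)`, without summing the areas. A number `m` that is too large makes a failed
attempt. -/
theorem draw_steps {c : Config} {s N i m : ℕ} (hc : Counts W D k L Q b M s N c)
    (hpc : c.pc = 53) (hi : i < k) (h22 : c.reg 22 = i) (h25 : c.reg 25 = m) (hm : m < 2 ^ W) :
    Reaches W unionQuery (fun c' =>
      if m < D.area (Q i) then Drawn W D k L Q b M i (D.squareAt (Q i) m) s N c' ∧ c'.pc = 84
      else Counts W D k L Q b M s N c' ∧ c'.pc = 48) 30 c := by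
  obtain ⟨pc, reg, mem⟩ := c
  have hc' := hc
  obtain ⟨⟨hl, r0, r1, r2, r3, r4, r5, r7, r8, r9, r10, r11, r12⟩, r23, r24⟩ := hc
  dsimp only at hl r0 r1 r2 r3 r4 r5 r7 r8 r9 r10 r11 r12 r23 r24 hpc h22 h25
  subst hpc
  have hblock := hl.block_lt (Q i)
  have a0 := hl.mem_side (Q i)
  have a1 := hl.mem_ax (Q i)
  have a2 := hl.mem_ay (Q i)
  have a3 := hl.mem_area (Q i)
  have a5 := hl.mem_cell (Q i)
  have b1 := hl.addr_lt (Q i) (t := 1) (by omega)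
  have b2 := hl.addr_lt (Q i) (t := 2) (by omega)
  have b3 := hl.addr_lt (Q i) (t := 3) (by omega)
  have hcard := hl.card_le (Q i)
  have b5 : ∀ e < (D.cells (Q i)).card, _ := fun e he =>
    hl.addr_lt (Q i) (t := 5 + D.B * D.B + e) (by omega)
  have hd := hl.box_lt
  rw [Nat.add_mul, one_mul] at a0 a1 a2 a3 b1 b2 b3
  simp only [Nat.add_mul, one_mul] at a5 b5
  set S := 5 + 2 * (D.B * D.B) with hS
  refine .op _ rfl (by simp [r1, h22]; exact eval_add (hl.query_lt hi)) ?_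
  refine .load (Q i) rfl (by simp [Config.setReg_reg, Config.setReg_mem, hl.mem_query i hi]) ?_
  refine .op _ rfl (by simp [Config.setReg_reg, r2]; exact eval_mul (by omega)) ?_
  refine .op _ rfl (by simp [Config.setReg_reg, r2]; exact eval_add hblock) ?_
  refine .load _ rfl (by simp [Config.setReg_reg, Config.setReg_mem, a0]; rfl) ?_
  refine .op _ rfl (by simp [Config.setReg_reg, r11]; exact eval_add b3) ?_
  refine .load _ rfl (by simp [Config.setReg_reg, Config.setReg_mem, a3]; rfl) ?_
  by_cases hma : m < D.area (Q i)
  swap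
  · refine .jumpLt_false rfl (by simpa [Config.setReg_reg, h25] using hma) (.jump rfl (.refl ?_))
    rw [if_neg hma]
    refine ⟨⟨?_, by simp [Config.setReg_reg, r23], by simp [Config.setReg_reg, r24]⟩, rfl⟩
    constructor <;> simp [Config.setReg_reg, Config.setReg_mem, *]
  refine .jumpLt_true rfl (by simpa [Config.setReg_reg, h25] using hma) ?_
  have hsq := D.squareAt_mem hma
  have hlt := hl.square_lt hsq
  set s' := D.side (Q i) with hs'
  have hs0 : 0 < s' := hl.side_pos _
  have hss : s' * s' < 2 ^ W := by
    have h1 := hl.mul_area_lt (Q i)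
    have h2 : s' * s' ≤ D.area (Q i) :=
      Nat.le_mul_of_pos_left _ (Finset.card_pos.2 (hl.cells_nonempty _))
    have h3 : D.area (Q i) ≤ D.K * k * D.area (Q i) :=
      Nat.le_mul_of_pos_left _ (Nat.mul_pos hl.K_pos hl.k_pos)
    omega
  have hcl : m / (s' * s') < (D.cells (Q i)).card :=
    Nat.div_lt_of_lt_mul (by rw [mul_comm]; exact hma)
  have hbc := b5 _ hcl
  set e := D.cellAt (Q i) (m / (s' * s')) with he
  have heB : e < D.B * D.B := hl.cells_lt _ _ (D.cellAt_mem hcl)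
  have hos : m % (s' * s') < s' * s' := Nat.mod_lt _ (Nat.mul_pos hs0 hs0)
  set o := m % (s' * s') with ho
  have hz1 : (D.squareAt (Q i) m).1 = (D.ax (Q i) + e / D.B) * s' + o / s' := rfl
  have hz2 : (D.squareAt (Q i) m).2 = (D.ay (Q i) + e % D.B) * s' + o % s' := rfl
  rw [hz1, hz2] at hlt
  have hx1 : D.ax (Q i) + e / D.B ≤ (D.ax (Q i) + e / D.B) * s' := Nat.le_mul_of_pos_right _ hs0
  have hy1 : D.ay (Q i) + e % D.B ≤ (D.ay (Q i) + e % D.B) * s' := Nat.le_mul_of_pos_right _ hs0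
  have hx2 : (D.ax (Q i) + e / D.B) * s' < 2 ^ W := (Nat.le_add_right _ _).trans_lt hlt.1
  have hy2 : (D.ay (Q i) + e % D.B) * s' < 2 ^ W := (Nat.le_add_right _ _).trans_lt hlt.2
  refine .op _ rfl (by simp [Config.setReg_reg]; exact eval_mul hss) ?_
  refine .op _ rfl (by simp [Config.setReg_reg, h25]; exact eval_div hm) ?_
  refine .op _ rfl (by simp [Config.setReg_reg, h25]; exact eval_mod hm) ?_
  refine .op _ rfl (by simp [Config.setReg_reg, r5]; exact eval_mul hd) ?_
  refine .op _ rfl (by simp [Config.setReg_reg, r12]; exact eval_add (by omega)) ?_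
  refine .op _ rfl (by simp [Config.setReg_reg]; exact eval_add (by omega)) ?_
  refine .op (Q i * S + S + (5 + D.B * D.B + m / (s' * s'))) rfl
    (by simp [Config.setReg_reg]; rw [eval_add (by omega)]; omega) ?_
  refine .load _ rfl (by simp [Config.setReg_reg, Config.setReg_mem, a5 _ hcl]; rfl) ?_
  rw [← he, ← ho]
  refine .op _ rfl (by simp [Config.setReg_reg, r5]; exact eval_div (by omega)) ?_
  refine .op _ rfl (by simp [Config.setReg_reg, r5]; exact eval_mod (by omega)) ?_
  refine .op _ rfl (by simp [Config.setReg_reg, r3]; exact eval_add b1) ?_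
  refine .load _ rfl (by simp [Config.setReg_reg, Config.setReg_mem, a1]; rfl) ?_
  refine .op _ rfl (by simp [Config.setReg_reg]; exact eval_add (by omega)) ?_
  refine .op _ rfl (by simp [Config.setReg_reg]; exact eval_mul (by omega)) ?_
  refine .op _ rfl (by simp [Config.setReg_reg]; exact eval_div (by omega)) ?_
  refine .op _ rfl (by simp [Config.setReg_reg]; exact eval_add hlt.1) ?_
  refine .op _ rfl (by simp [Config.setReg_reg, r10]; exact eval_add b2) ?_
  refine .load _ rfl (by simp [Config.setReg_reg, Config.setReg_mem, a2]; rfl) ?_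
  refine .op _ rfl (by simp [Config.setReg_reg]; exact eval_add (by omega)) ?_
  refine .op _ rfl (by simp [Config.setReg_reg]; exact eval_mul (by omega)) ?_
  refine .op _ rfl (by simp [Config.setReg_reg]; exact eval_mod (by omega)) ?_
  refine .op _ rfl (by simp [Config.setReg_reg]; exact eval_add hlt.2) (.refl ?_)
  rw [if_pos hma]
  refine ⟨⟨⟨?_, ?_, ?_⟩, ?_, ?_, ?_⟩, rfl⟩
  · constructor <;>
      simp only [Config.setReg_reg, Config.setReg_mem, hl, r0, r1, r2, r3, r4, r5, r7, r8, r9, r10,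
        r11, r12, hS] <;> rfl
  · simp [Config.setReg_reg, r23]
  · simp [Config.setReg_reg, r24]
  · simp [Config.setReg_reg, hz1]
  · simp [Config.setReg_reg, hz2]
  · simp [Config.setReg_reg, h22]

/-- Equality of `j` and `i` is decided by two strict comparisons, hence the three cases. With the
draw of `j` before it, a trial takes at most 29 steps. -/
theorem trial_steps {c : Config} {s N i j : ℕ} {z : ℕ × ℕ} (hc : Drawn W D k L Q b M i z s N c)
    (hpc : c.pc = 85) (hz : z ∈ D.squares (Q i)) (hj : j < k) (h15 : c.reg 15 = j)
    (hs : s < D.K) (hK : D.K < 2 ^ W) :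
    Reaches W unionQuery (fun c' =>
      if z ∈ D.squares (Q j) then
        Counts W D k L Q b M (if j = i then s + 1 else s) N c' ∧ c'.pc = 48
      else Drawn W D k L Q b M i z s N c' ∧ c'.pc = 84) (1 + (24 + 3)) c := by
  obtain ⟨pc, reg, mem⟩ := c
  have hl := hc.counts.ctx.layout
  dsimp only at hpc hl h15
  subst hpc
  obtain ⟨hx, hy⟩ := hl.square_lt hz
  rw [Nat.add_comm 1]
  have hc1 : Counts W D k L Q b M s N ⟨21, reg, mem⟩ := hc.counts.pc 21
  refine .jump rfl ((test_steps (j := j) (x := z.1) (y := z.2) hc1.ctx rfl hj h15 hc.r16 hc.r17 hx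
    hy).bind ?_)
  rintro c' ⟨hsame, hpc'⟩
  have hc2 := hc1.same hsame
  have e15 : c'.reg 15 = j := (hsame.2 _ (by decide)).trans h15
  have e16 := (hsame.2 16 (by decide)).trans hc.r16
  have e17 := (hsame.2 17 (by decide)).trans hc.r17
  have e22 := (hsame.2 22 (by decide)).trans hc.r22
  rw [← GridData.mem_squares (hl.side_pos _) (hl.cells_lt _)] at hpc'
  obtain ⟨pc', reg', mem'⟩ := c'
  dsimp only at hpc' e15 e16 e17 e22
  by_cases hzj : z ∈ D.squares (Q j)
  · rw [if_pos hzj] at hpc'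
    subst hpc'
    simp only [if_pos hzj]
    rcases lt_trichotomy j i with h | h | h
    · refine .jumpLt_true rfl (by simp [e15, e22, h]) (.refl ⟨?_, rfl⟩)
      rw [if_neg h.ne]
      exact hc2.pc 48
    · refine .jumpLt_false rfl (by simp [e15, e22, h]) ?_
      refine .jumpLt_false rfl (by simp [e15, e22, h]) ?_
      refine .op (s + 1) rfl ?_ (.refl ⟨?_, rfl⟩)
      · have h23 : reg' 23 = s := hc2.r23
        have h3 : reg' 3 = 1 := hc2.ctx.r3
        simp only [h23, h3]
        exact eval_add (by omega)
      · rw [if_pos h]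
        refine ⟨(hc2.ctx.pc _).setReg _ (by decide), by simp [Config.setReg_reg], ?_⟩
        rw [Config.setReg_reg, if_neg (by decide)]
        exact hc2.r24
    · refine .jumpLt_false rfl (by simp [e15, e22, h.le]) ?_
      refine .jumpLt_true rfl (by simp [e15, e22, h]) (.refl ⟨?_, rfl⟩)
      rw [if_neg h.ne']
      exact hc2.pc 48
  · rw [if_neg hzj] at hpc'
    subst hpc'
    simp only [if_neg hzj]
    exact .refl ⟨⟨hc2, e16, e17, e22⟩, rfl⟩

end

/-! ### Expected time and error of the union program -/

section
variable {W n k L : ℕ} {D : GridData n} {Q : ℕ → Fin n} {b M : ℕ}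

theorem union_length : unionQuery.length = 89 := rfl

/-- The potential of a drawn unit square `z`. -/
noncomputable def drawnPotential (D : GridData n) (Q : ℕ → Fin n) (k : ℕ) (τ : ℝ)
    (V : ℕ → ℕ → ℝ) (z : ℕ × ℕ) (s N : ℕ) : ℝ :=
  -- The expected number of trials is `k / cover`, at 29 steps each. The region found is uniform
  -- among the `cover` many that contain `z`, so with probability `1 / cover` the next state has one
  -- more success.
  V s N + (29 * τ * k - V s N + V (s + 1) N) / D.cover Q k z

theorem drawnPotential_nonneg {τ : ℝ} {V : ℕ → ℕ → ℝ} {z : ℕ × ℕ} {s N : ℕ}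
    (hτ : 0 ≤ τ) (hV : ∀ s N, 0 ≤ V s N) (hz : 0 < D.cover Q k z) :
    0 ≤ drawnPotential D Q k τ V z s N := by
  have hc : (1 : ℝ) ≤ D.cover Q k z := by exact_mod_cast hz
  have h0 : (0 : ℝ) < D.cover Q k z := by linarith
  have : drawnPotential D Q k τ V z s N =
      ((D.cover Q k z - 1) * V s N + 29 * τ * k + V (s + 1) N) / D.cover Q k z := by
    unfold drawnPotential
    field_simp
    ring
  rw [this]
  have h1 := mul_nonneg (sub_nonneg.2 hc) (hV s N)
  have h2 := hV (s + 1) N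
  positivity

/-- The average of the potential over a trial. -/
theorem sum_trial {τ : ℝ} {V : ℕ → ℕ → ℝ} {z : ℕ × ℕ} {s N i : ℕ} (hi : i < k)
    (hz : z ∈ D.squares (Q i)) :
    ∑ j ∈ Finset.range k, (28 * τ + if z ∈ D.squares (Q j) then
        V (if j = i then s + 1 else s) N else drawnPotential D Q k τ V z s N) =
      k * (drawnPotential D Q k τ V z s N - τ) := by
  have h1 : ∀ j ∈ Finset.range k, (28 * τ + if z ∈ D.squares (Q j) then
      V (if j = i then s + 1 else s) N else drawnPotential D Q k τ V z s N) =
      (28 * τ + drawnPotential D Q k τ V z s N) +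
      (if z ∈ D.squares (Q j) then V s N - drawnPotential D Q k τ V z s N else 0) +
      (if j = i then V (s + 1) N - V s N else 0) := by
    intro j _
    by_cases hji : j = i
    · subst hji
      simp [hz]
    · by_cases hzj : z ∈ D.squares (Q j) <;> simp [hji, hzj]
  have hc : (0 : ℝ) < D.cover Q k z := by exact_mod_cast D.cover_pos hi hz
  -- This is the linear equation whose solution is the potential: one trial reproduces it on
  -- average, up to the step `τ` of the draw itself.
  have h2 : (D.cover Q k z : ℝ) * (V s N - drawnPotential D Q k τ V z s N) =
      -(29 * τ * k - V s N + V (s + 1) N) := by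
    unfold drawnPotential
    field_simp
    ring
  rw [Finset.sum_congr rfl h1, Finset.sum_add_distrib, Finset.sum_add_distrib, Finset.sum_const,
    Finset.card_range, nsmul_eq_mul, ← Finset.sum_filter, Finset.sum_const, nsmul_eq_mul,
    Finset.sum_ite_eq' (Finset.range k) i, if_pos (Finset.mem_range.2 hi)]
  have h3 : (((Finset.range k).filter fun j => z ∈ D.squares (Q j)).card : ℝ) =
    D.cover Q k z := rfl
  rw [h3, h2]
  ring

/-- The average of the potential over an attempt. -/
theorem sum_attempt {τ : ℝ} {V : ℕ → ℕ → ℝ} {s N : ℕ} (hM : ∀ j < k, D.area (Q j) ≤ M) :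
    ∑ i ∈ Finset.range k, ∑ m ∈ Finset.range M, (30 * τ + if m < D.area (Q i) then
        drawnPotential D Q k τ V (D.squareAt (Q i) m) s N else V s N) =
      k * (M * (30 * τ + V s N)) +
        (D.unionSquares Q k).card * (29 * τ * k - V s N + V (s + 1) N) := by
  have h1 : ∀ i ∈ Finset.range k, ∑ m ∈ Finset.range M, (30 * τ + if m < D.area (Q i) then
        drawnPotential D Q k τ V (D.squareAt (Q i) m) s N else V s N) =
      M * (30 * τ + V s N) +
        ∑ z ∈ D.squares (Q i), (29 * τ * k - V s N + V (s + 1) N) / D.cover Q k z := by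
    intro i hi
    have h2 : ∀ m ∈ Finset.range M, (30 * τ + if m < D.area (Q i) then
        drawnPotential D Q k τ V (D.squareAt (Q i) m) s N else V s N) =
        (30 * τ + V s N) + if m < D.area (Q i) then
          (29 * τ * k - V s N + V (s + 1) N) / D.cover Q k (D.squareAt (Q i) m) else 0 := by
      intro m _
      by_cases h : m < D.area (Q i) <;> simp [h, drawnPotential]
      ring
    rw [Finset.sum_congr rfl h2, Finset.sum_add_distrib, Finset.sum_const, Finset.card_range,
      nsmul_eq_mul, ← Finset.sum_filter]
    congr 1
    have h3 : (Finset.range M).filter (fun m => m < D.area (Q i)) =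
        Finset.range (D.area (Q i)) := by
      ext m
      have := hM i (Finset.mem_range.1 hi)
      simp only [Finset.mem_filter, Finset.mem_range]
      omega
    rw [h3]
    exact GridData.sum_squareAt fun z =>
      (29 * τ * k - V s N + V (s + 1) N) / D.cover Q k z
  rw [Finset.sum_congr rfl h1, Finset.sum_add_distrib, Finset.sum_const, Finset.card_range,
    nsmul_eq_mul, D.sum_div_cover Q k fun _ => 29 * τ * k - V s N + V (s + 1) N,
    Finset.sum_const, nsmul_eq_mul]

variable {f : Config → ENNReal}

theorem GridData.card_unionSquares_le (D : GridData n) {Q : ℕ → Fin n}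
    (hM : ∀ j < k, D.area (Q j) ≤ M) : (D.unionSquares Q k).card ≤ k * M := by
  refine (Finset.card_biUnion_le_card_mul _ _ M fun j hj => ?_).trans (by rw [Finset.card_range])
  rw [card_squares]
  exact hM j (Finset.mem_range.1 hj)

/-- The cost of the main loop, for any potential that decreases on average. -/
theorem union_loop_cost {τ p : ℝ} {V : ℕ → ℕ → ℝ} {e : ℕ → ℝ} (hτ : 0 ≤ τ)
    (hV : ∀ s N, 0 ≤ V s N) (he : ∀ N, 0 ≤ e N)
    (hK : D.K < 2 ^ W) (hM : ∀ j < k, D.area (Q j) ≤ M) (hM0 : 0 < M)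
    (hMlt : 2 * (D.K * k * M) < 2 ^ W) (hK0 : 0 < D.K)
    (hp : p = (D.unionSquares Q k).card / (k * M))
    (hstep : ∀ s < D.K, ∀ N, 34 * τ + 29 * τ * k * p + (1 - p) * V s (N + 1) +
      p * V (s + 1) (N + 1) ≤ V s N)
    (hend : ∀ N, 5 * τ + e N ≤ V D.K N)
    (hf : ∀ N c, c.pc = 89 → c.reg 0 = D.K * k * M → c.reg 1 = N % 2 ^ W →
      f c ≤ ENNReal.ofReal (e N)) (t : ℕ) :
    (∀ s ≤ D.K, ∀ N c, Counts W D k L Q b M s N c → c.pc = 48 →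
      cost W unionQuery (ENNReal.ofReal τ) f t c ≤ ENNReal.ofReal (V s N)) ∧
    (∀ s < D.K, ∀ N c z, ∀ i < k, z ∈ D.squares (Q i) → Drawn W D k L Q b M i z s N c →
      c.pc = 84 → cost W unionQuery (ENNReal.ofReal τ) f t c ≤
        ENNReal.ofReal (drawnPotential D Q k τ V z s N)) := by
  -- The loop head and the state with a drawn square are treated together, since each leads to the
  -- other. Fuel is spent at the random draws.
  induction t with
  | zero => exact ⟨fun _ _ _ _ _ _ => zero_le, fun _ _ _ _ _ _ _ _ _ _ => zero_le⟩
  | succ t ih =>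
    obtain ⟨ihA, ihB⟩ := ih
    constructor
    · intro s hs N c hc hpc
      have hk : 0 < k := hc.ctx.layout.k_pos
      have hMW : M < 2 ^ W := by
        have : M ≤ D.K * k * M := Nat.le_mul_of_pos_left _ (Nat.mul_pos hK0 hk)
        omega
      rcases hs.eq_or_lt with rfl | hs
      · refine (finish_steps hc hpc (by omega) hM0).cost_le hτ (he N) ?_
          (by exact_mod_cast hend N)
        rintro c' ⟨h89, h0, h1⟩
        rw [cost_halted (by rw [Halted, union_length, h89])]
        exact hf N c' h89 h0 h1
      have hkR : (0 : ℝ) < k := by exact_mod_cast hk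
      have hMR : (0 : ℝ) < M := by exact_mod_cast hM0
      have hg0 : ∀ i < k, ∀ m, 0 ≤ 30 * τ + if m < D.area (Q i) then
          drawnPotential D Q k τ V (D.squareAt (Q i) m) s (N + 1) else V s (N + 1) := by
        intro i hi m
        by_cases hm : m < D.area (Q i)
        · rw [if_pos hm]
          have := drawnPotential_nonneg (s := s) (N := N + 1) hτ hV
            (D.cover_pos hi (D.squareAt_mem hm))
          positivity
        · rw [if_neg hm]
          have := hV s (N + 1)
          positivity
      have hG0 : ∀ i < k, 0 ≤ τ + (∑ m ∈ Finset.range M, (30 * τ + if m < D.area (Q i) then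
          drawnPotential D Q k τ V (D.squareAt (Q i) m) s (N + 1) else V s (N + 1))) / M := by
        intro i hi
        have := Finset.sum_nonneg fun m (_ : m ∈ Finset.range M) => hg0 i hi m
        positivity
      refine (attempt_steps hc hpc hs).cost_le hτ (v := V s N - 2 * τ) ?_ ?_ (by simp)
      · have h1 := hV s (N + 1)
        have h2 := hV (s + 1) (N + 1)
        have h3 := hstep s hs N
        have hp0 : 0 ≤ p := by rw [hp]; positivity
        have hp1 : p ≤ 1 := by
          rw [hp, div_le_one (by positivity)]
          exact_mod_cast D.card_unionSquares_le hM
        have h4 := mul_nonneg (sub_nonneg.2 hp1) h1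
        have h5 : 0 ≤ 29 * τ * k * p := by positivity
        have h6 := mul_nonneg hp0 h2
        linarith
      rintro c₁ ⟨hc₁, hpc₁⟩
      refine cost_rand_le (d := 22) (a := 0) (b := k) (by rw [hpc₁]; rfl) hc₁.ctx.r0 hk hτ hG0
        ?_ ?_
      · intro i hi
        have hc₂ := hc₁.setReg (d := 22) i (by decide) (by decide) (by decide)
        have hpc₂ : (c₁.setReg 22 i).pc = 52 := by rw [Config.setReg_pc, hpc₁]
        -- Two draws follow each other; the fuel spent on the first is restored, so that the
        -- induction hypothesis applies after the second.
        refine (cost_mono_succ _ _).trans ?_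
        refine cost_rand_le (d := 25) (a := 8) (b := M) (by rw [hpc₂]; rfl) hc₂.ctx.r8 hM0 hτ
          (fun m _ => hg0 i hi m) ?_ le_rfl
        intro m hm
        have hc₃ := hc₂.setReg (d := 25) m (by decide) (by decide) (by decide)
        have hpc₃ : ((c₁.setReg 22 i).setReg 25 m).pc = 53 := by rw [Config.setReg_pc, hpc₂]
        refine (draw_steps hc₃ hpc₃ hi (by simp [Config.setReg_reg])
          (by simp [Config.setReg_reg]) (hm.trans hMW)).cost_le hτ (v := if m < D.area (Q i) then
          drawnPotential D Q k τ V (D.squareAt (Q i) m) s (N + 1) else V s (N + 1)) ?_ ?_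
          (by simp)
        · split_ifs with h
          · exact drawnPotential_nonneg hτ hV (D.cover_pos hi (D.squareAt_mem h))
          · exact hV _ _
        · intro c' hc'
          split_ifs at hc' ⊢ with h
          · exact ihB s hs _ _ _ i hi (D.squareAt_mem h) hc'.1 hc'.2
          · exact ihA s hs.le _ _ hc'.1 hc'.2
      · have h1 := sum_attempt (τ := τ) (V := V) (s := s) (N := N + 1) hM
        rw [Finset.sum_add_distrib, ← Finset.sum_div, h1, Finset.sum_const, Finset.card_range,
          nsmul_eq_mul]
        -- The 34 steps of an attempt outside the trials are 2 for counting it, 2 draws and 30 for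
        -- decoding the square; `29 τ k p` is the average cost of the trials.
        refine le_trans (le_of_eq ?_) (sub_le_sub_right (hstep s hs N) (2 * τ))
        rw [hp]
        field_simp
        ring
    · intro s hs N c z i hi hz hc hpc
      have hk : 0 < k := hc.counts.ctx.layout.k_pos
      have hkR : (0 : ℝ) < k := by exact_mod_cast hk
      have hd := drawnPotential_nonneg (s := s) (N := N) hτ hV (D.cover_pos hi hz)
      have hh0 : ∀ j, 0 ≤ if z ∈ D.squares (Q j) then
          V (if j = i then s + 1 else s) N else drawnPotential D Q k τ V z s N := by
        intro j
        split_ifs <;> first | exact hV _ _ | exact hd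
      refine cost_rand_le (d := 15) (a := 0) (b := k) (by rw [hpc]; rfl) hc.counts.ctx.r0 hk hτ
        (g := fun j => 28 * τ + if z ∈ D.squares (Q j) then
          V (if j = i then s + 1 else s) N else drawnPotential D Q k τ V z s N)
        (fun j _ => add_nonneg (by positivity) (hh0 j)) ?_ ?_
      · intro j hj
        have hc₁ : Drawn W D k L Q b M i z s N (c.setReg 15 j) :=
          ⟨hc.1.setReg _ (by decide) (by decide) (by decide),
            by simp [Config.setReg_reg, hc.r16], by simp [Config.setReg_reg, hc.r17],
            by simp [Config.setReg_reg, hc.r22]⟩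
        refine (trial_steps hc₁ (by rw [Config.setReg_pc, hpc]) hz hj
          (by simp [Config.setReg_reg]) hs hK).cost_le hτ (hh0 j) ?_ (by norm_num)
        intro c' hc'
        by_cases hzj : z ∈ D.squares (Q j)
        · rw [if_pos hzj] at hc' ⊢
          refine ihA _ ?_ _ _ hc'.1 hc'.2
          split_ifs <;> omega
        · rw [if_neg hzj] at hc' ⊢
          exact ihB s hs _ _ _ i hi hz hc'.1 hc'.2
      · rw [sum_trial hi hz, mul_div_cancel_left₀ _ hkR.ne']
        linarith

/-- The cost of a union query. -/
theorem union_cost {c : Config} (hc : Start W D k L Q c) {τ : ℝ} (hτ : 0 ≤ τ) :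
    ∃ j < k, (∀ j' < k, D.area (Q j') ≤ D.area (Q j)) ∧
      ∀ (V : ℕ → ℕ → ℝ) (p : ℝ) (e : ℕ → ℝ), (∀ N, 0 ≤ e N) → (∀ s N, 0 ≤ V s N) → p = (D.unionSquares Q k).card / (k * D.area (Q j)) →
      (∀ s < D.K, ∀ N, 34 * τ + 29 * τ * k * p + (1 - p) * V s (N + 1) +
        p * V (s + 1) (N + 1) ≤ V s N) →
      (∀ N, 5 * τ + e N ≤ V D.K N) →
      (∀ N c, c.pc = 89 → c.reg 0 = D.K * k * D.area (Q j) → c.reg 1 = N % 2 ^ W →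
        f c ≤ ENNReal.ofReal (e N)) → ∀ t,
      cost W unionQuery (ENNReal.ofReal τ) f t c ≤
        ENNReal.ofReal ((9 + 13 * k) * τ + V 0 0) := by
  have hl := hc.layout
  have hK : ∀ i, D.K < 2 ^ W := fun i => by
    have h1 := hl.mul_area_lt i
    have h2 : D.K ≤ D.K * k * D.area i := by
      rw [mul_assoc]
      exact Nat.le_mul_of_pos_right _ (Nat.mul_pos hl.k_pos (hl.area_pos i))
    omega
  have hlt : ∀ i, D.area i < 2 ^ W := fun i => by
    have h1 := hl.mul_area_lt i
    have h2 : D.area i ≤ D.K * k * D.area i :=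
      Nat.le_mul_of_pos_left _ (Nat.mul_pos hl.K_pos hl.k_pos)
    omega
  have hr := search_steps (main := 48) (miss := 84) (tail := unionTail) hc (by norm_num)
    hl.mem_area hl.area_pos hlt
  obtain ⟨m, c', hm, hs, ⟨j, hj, hmax, hctx⟩, hpc, hz⟩ := hr
  refine ⟨j, hj, hmax, fun V p e he hV hp hstep hend hf t => ?_⟩
  have hcounts : Counts W D k L Q ((Q j + 1) * (5 + 2 * (D.B * D.B))) (D.area (Q j)) 0 0 c' :=
    ⟨hctx, hz 23 (by norm_num), by simpa using hz 24 (by norm_num)⟩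
  refine (cost_mono c (by omega : t ≤ t + m)).trans (hs.cost_le hm hτ (hV 0 0)
    ((union_loop_cost hτ hV he (hK (Q j)) hmax (hl.area_pos _) (hl.mul_area_lt _) hl.K_pos hp
      hstep hend hf t).1 0 (Nat.zero_le _) 0 c' hcounts hpc) (le_of_eq ?_))
  push_cast
  ring

/-- An attempt costs `34 + 29 k p` on average and succeeds with probability `p`, so a success costs
`34 / p + 29 k ≤ 63 k` because `1 ≤ k p`. This is the slope of the linear potential; the final 5
pays for the output, and the search adds `9 + 13 k`. -/
theorem union_time {c : Config} (hc : Start W D k L Q c) (t : ℕ) :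
    cost W unionQuery 1 (fun _ => 0) t c ≤ ENNReal.ofReal (90 * D.K * k) := by
  have hl := hc.layout
  obtain ⟨j, hj, hmax, h⟩ := union_cost (f := fun _ => 0) hc zero_le_one
  have hk : (1 : ℝ) ≤ k := by exact_mod_cast hl.k_pos
  have hK : (1 : ℝ) ≤ D.K := by exact_mod_cast hl.K_pos
  have hA : (0 : ℝ) < D.area (Q j) := by exact_mod_cast hl.area_pos _
  have h1 := h (fun s _ => ((D.K - s : ℕ) : ℝ) * (63 * k) + 5) _ (fun _ => 0)
    (fun _ => le_rfl) (fun s _ => by positivity) rfl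
    ?_ (fun N => by simp) (fun _ _ _ _ _ => zero_le) t
  · rw [ENNReal.ofReal_one] at h1
    refine h1.trans (ENNReal.ofReal_le_ofReal ?_)
    simp only [Nat.sub_zero, mul_one]
    nlinarith
  · intro s hs N
    set p : ℝ := (D.unionSquares Q k).card / (k * D.area (Q j)) with hp
    have hkp : 1 ≤ k * p := by
      have h2 : (D.area (Q j) : ℝ) ≤ (D.unionSquares Q k).card := by
        exact_mod_cast D.area_le_card_unionSquares hj
      have h3 : k * p = (D.unionSquares Q k).card / D.area (Q j) := by
        rw [hp]; field_simp
      rw [h3]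
      exact (one_le_div hA).2 h2
    have h4 : ((D.K - s : ℕ) : ℝ) = ((D.K - (s + 1) : ℕ) : ℝ) + 1 := by
      have : D.K - s = D.K - (s + 1) + 1 := by omega
      rw [this]; push_cast; ring
    rw [h4]
    nlinarith

/-- The error bound for the union, from the second moment of the number of attempts. -/
theorem union_bad {c : Config} (hc : Start W D k L Q c) {ε : ℝ} (hε0 : 0 < ε) (hε1 : ε < 1) :
    ∃ v : ℝ, v < 4 / (ε ^ 2 * D.K) ∧ ∀ t, cost W unionQuery 0
      ({c : Config | |c.output - (D.unionSquares Q k).card| ≤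
        ε * (D.unionSquares Q k).card}ᶜ.indicator 1) t c ≤ ENNReal.ofReal v := by
  have hl := hc.layout
  set μ : ℝ := ((D.unionSquares Q k).card : ℝ) with hμ
  set good : Set Config := {c | |c.output - μ| ≤ ε * μ} with hgood
  obtain ⟨j, hj, hmax, h⟩ := union_cost (f := goodᶜ.indicator 1) hc (le_refl (0 : ℝ))
  have hk : (0 : ℝ) < k := by exact_mod_cast hl.k_pos
  have hK : (0 : ℝ) < D.K := by exact_mod_cast hl.K_pos
  have hA : (1 : ℝ) ≤ D.area (Q j) := by exact_mod_cast hl.area_pos _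
  have hμA : (D.area (Q j) : ℝ) ≤ μ := by
    rw [hμ]
    exact_mod_cast D.area_le_card_unionSquares hj
  have hμ0 : 0 < μ := by linarith
  set p : ℝ := μ / (k * D.area (Q j)) with hp
  have hp0 : 0 < p := by positivity
  have hp1 : p ≤ 1 := by
    rw [hp, div_le_one (by positivity), hμ]
    exact_mod_cast D.card_unionSquares_le hmax
  have hpμ : p * (k * D.area (Q j)) = μ := by rw [hp]; field_simp
  have hkp : 1 ≤ k * p := by
    have h3 : k * p = μ / D.area (Q j) := by rw [hp]; field_simp
    rw [h3]
    exact (one_le_div (by linarith)).2 hμA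
  -- The tolerated deviation of `N` from its mean `K / p`. The factor `1 / 2` makes up for dividing
  -- by `N`, which may be as small as half the mean.
  set θ : ℝ := ε / 2 * (D.K / p) with hθ
  have hθ0 : 0 < θ := by positivity
  have h1p : 0 ≤ 1 - p := sub_nonneg.2 hp1
  -- The variance `K (1 - p) / p²` divided by `θ²`. The factor `1 - p < 1` makes the bound strict.
  refine ⟨4 * (1 - p) / (ε ^ 2 * D.K), ?_, fun t => ?_⟩
  · apply div_lt_div_of_pos_right _ (by positivity)
    linarith
  -- The potential is the conditional second moment of the final deviation from `K / p`, over `θ²`: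
  -- squared present bias plus the variance of the `K - s` outstanding geometric waiting times. It
  -- is a martingale, so the step condition below is an equality.
  have h1 := h (fun s N => ((N - s / p) ^ 2 + ((D.K - s : ℕ) : ℝ) * ((1 - p) / p ^ 2)) / θ ^ 2) p
    (fun N => (N - D.K / p) ^ 2 / θ ^ 2) (fun N => by positivity)
    (fun s N => by positivity) rfl ?_ (fun N => by simp) ?_ t
  · rw [ENNReal.ofReal_zero] at h1
    refine h1.trans (ENNReal.ofReal_le_ofReal (le_of_eq ?_))
    simp only [hθ]
    push_cast
    field_simp
    simp
    ring
  · intro s hs N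
    have h4 : ((D.K - s : ℕ) : ℝ) = ((D.K - (s + 1) : ℕ) : ℝ) + 1 := by
      have : D.K - s = D.K - (s + 1) + 1 := by omega
      rw [this]; push_cast; ring
    rw [h4]
    apply le_of_eq
    push_cast
    field_simp
    ring
  · intro N c' _ h0' h1'
    by_cases hg : c' ∈ good
    · simp [hg]
    rw [Set.indicator_of_mem hg, Pi.one_apply, ← ENNReal.ofReal_one]
    apply ENNReal.ofReal_le_ofReal
    -- Chebyshev: a wrong answer must have a squared deviation of at least `θ²`, so that the
    -- terminal potential is at least 1.
    rw [one_le_div (by positivity)]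
    by_contra hlt
    apply hg
    set a : ℝ := D.K / p with ha
    have ha0 : 0 < a := by positivity
    have habs : |(N : ℝ) - a| < ε / 2 * a := by
      have := sq_lt_sq.1 (not_le.1 hlt)
      rwa [abs_of_pos hθ0] at this
    have hNa := abs_lt.1 habs
    -- An overflow of the counter is harmless: for `N` close to the mean `a ≤ K k` there is none,
    -- and other runs already count as bad. The factor 2 in `Fits.area_lt` gives the room, since `N
    -- < 2 a`.
    have hN2 : (N : ℝ) < 2 ^ W := by
      have e1 : (2 * (D.K * k * D.area (Q j)) : ℝ) < 2 ^ W := by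
        exact_mod_cast hl.mul_area_lt (Q j)
      have e2 : a ≤ D.K * k := by
        rw [ha, div_le_iff₀ hp0, mul_assoc]
        nlinarith
      have e3 : (D.K * k : ℝ) ≤ D.K * k * D.area (Q j) :=
        le_mul_of_one_le_right (by positivity) hA
      nlinarith
    have hN3 : N % 2 ^ W = N := Nat.mod_eq_of_lt (by exact_mod_cast hN2)
    have hN0 : a / 2 < N := by nlinarith
    have hN4 : (0 : ℝ) < N := by linarith
    show |c'.output - μ| ≤ ε * μ
    rw [Config.output, h0', h1', hN3]
    have e4 : ((D.K * k * D.area (Q j) : ℕ) : ℝ) = a * μ := by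
      rw [← hpμ, ha]
      push_cast
      field_simp
    have e5 : a * μ / N - μ = μ / N * -(N - a) := by field_simp; ring
    rw [e4, e5, abs_mul, abs_neg, abs_of_pos (by positivity)]
    calc μ / N * |(N : ℝ) - a| ≤ μ / N * (ε / 2 * a) := by gcongr
      _ = ε * μ * (a / 2 / N) := by ring
      _ ≤ ε * μ * 1 := by
          gcongr
          exact ((div_lt_one hN4).2 hN0).le
      _ = ε * μ := mul_one _

end

/-! ### The intersection program -/

open Instr BinOp in
/-- The second part of the program for intersection queries. It starts at position 63. For each
cell code `r[22]` of a region with the smallest cells, it is tested whether all regions contain the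
lower left unit square of that cell; `r[23]` counts the cells which pass. -/
def interTail : List Instr :=
  [op add 15 15 3, jumpLt 15 0 21, op add 23 23 3,
   op add 22 22 3, jumpLt 22 24 51, jump 66,
   op div 16 22 5, op mod 17 22 5,
   op add 18 7 3, load 18 18, op add 16 18 16, op mul 16 16 25,
   op add 18 7 10, load 18 18, op add 17 18 17, op mul 17 17 25,
   const 15 0, jump 21,
   op mul 24 5 5, load 25 7, jump 49,
   op mul 0 23 25, op mul 0 0 25, const 1 1]

/-- The program for intersection queries. -/
def interQuery : List Instr := commonProg 4 63 48 ++ interTail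

section
variable {W n k L : ℕ} {D : GridData n} {Q : ℕ → Fin n} {b M : ℕ}

/-- All regions of the query contain the lower left unit square of the cell `e` of region `i`. -/
def AllContain (D : GridData n) (Q : ℕ → Fin n) (k : ℕ) (i : Fin n) (e : ℕ) : Prop :=
  ∀ j < k, D.Contains (Q j) (D.square i e 0)

/-- The state before cell `e` is considered; `v` cells have been counted. -/
structure Cells (W : ℕ) (D : GridData n) (k L : ℕ) (Q : ℕ → Fin n) (M : ℕ) (i : Fin n)
    (e v : ℕ) (c : Config) : Prop where
  ctx : Ctx W D k L Q 4 ((i + 1) * (5 + 2 * (D.B * D.B))) M c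
  r22 : c.reg 22 = e
  r23 : c.reg 23 = v
  r24 : c.reg 24 = D.B * D.B
  r25 : c.reg 25 = D.side i

theorem Cells.same {i : Fin n} {e v : ℕ} {c c' : Config} (h : Cells W D k L Q M i e v c)
    (hs : Same c c') : Cells W D k L Q M i e v c' :=
  ⟨h.1.same hs, (hs.2 _ (by decide)).trans h.2, (hs.2 _ (by decide)).trans h.3,
    (hs.2 _ (by decide)).trans h.4, (hs.2 _ (by decide)).trans h.5⟩

theorem Cells.setReg {i : Fin n} {e v : ℕ} {c : Config} (h : Cells W D k L Q M i e v c) {d : ℕ}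
    (x : ℕ) (hd : d ∉ [0, 1, 2, 3, 4, 5, 7, 8, 9, 10, 11, 12, 22, 23, 24, 25]) :
    Cells W D k L Q M i e v (c.setReg d x) := by
  simp only [List.mem_cons, List.not_mem_nil, or_false, not_or] at hd
  refine ⟨h.1.setReg x (by simp; omega), ?_, ?_, ?_, ?_⟩ <;> rw [Config.setReg_reg, if_neg (by omega)]
  exacts [h.2, h.3, h.4, h.5]

theorem Cells.pc {i : Fin n} {e v : ℕ} {c : Config} (h : Cells W D k L Q M i e v c) (l : ℕ) :
    Cells W D k L Q M i e v ⟨l, c.reg, c.mem⟩ := ⟨h.1.pc l, h.2, h.3, h.4, h.5⟩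

-- Induction on the number `d + 1` of regions still to be tested. Each takes 24 steps for the test
-- and 2 for the loop. A failed test jumps to position 48, just past the instruction that counts the
-- cell.
open Classical in
theorem scan_steps {i : Fin n} {e v : ℕ} {z : ℕ × ℕ} (hv : v + 1 < 2 ^ W) (hz1 : z.1 < 2 ^ W)
    (hz2 : z.2 < 2 ^ W) (d : ℕ) : ∀ {c : Config} {j : ℕ}, Cells W D k L Q M i e v c →
      c.pc = 21 → c.reg 15 = j → c.reg 16 = z.1 → c.reg 17 = z.2 → j + (d + 1) = k →
      Reaches W interQuery (fun c' => Cells W D k L Q M i e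
        (if ∀ j' < k, j ≤ j' → D.Contains (Q j') z then v + 1 else v) c' ∧ c'.pc = 48)
        (26 * (d + 1) + 1) c := by
  induction d with
  | zero =>
    intro c j hc hpc h15 h16 h17 hj
    refine Reaches.mono (m := 24 + 3) ((test_steps (x := z.1) (y := z.2) hc.ctx hpc
      (by omega : j < k) h15 h16 h17 hz1 hz2).bind ?_) (by norm_num) fun _ h => h
    rintro ⟨pc', reg', mem'⟩ ⟨hsame, hpc'⟩
    have hc2 := hc.same hsame
    have e15 : reg' 15 = j := (hsame.2 _ (by decide)).trans h15
    have e3 : reg' 3 = 1 := hc2.ctx.r3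
    have e0 : reg' 0 = k := hc2.ctx.r0
    have e23 : reg' 23 = v := hc2.r23
    have hkl := hc.ctx.layout.query_lt (by omega : j < k)
    have hL := hc.ctx.layout.L_pos
    have hiff : (∀ j' < k, j ≤ j' → D.Contains (Q j') z) ↔ D.Contains (Q j) z := by
      constructor
      · intro h; exact h j (by omega) le_rfl
      · intro h j' h1 h2
        rwa [(by omega : j' = j)]
    simp only [hiff]
    by_cases h : D.Contains (Q j) (z.1, z.2)
    · rw [if_pos h] at hpc'
      dsimp only at hpc'
      subst hpc'
      rw [if_pos (show D.Contains (Q j) z from h)]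
      refine .op (j + 1) rfl (by simp only [e15, e3]; exact eval_add (by omega)) ?_
      refine .jumpLt_false rfl (by simp [Config.setReg_reg, e0]; omega) ?_
      refine .op (v + 1) rfl
        (by simp [Config.setReg_reg, e23, e3]; exact eval_add hv) (.refl ⟨?_, rfl⟩)
      have hc3 := (hc2.setReg (d := 15) (j + 1) (by decide))
      refine ⟨(hc3.ctx.pc _).setReg _ (by decide), ?_, ?_, ?_, ?_⟩ <;> rw [Config.setReg_reg]
      · exact hc3.r22
      · rfl
      · exact hc3.r24
      · exact hc3.r25
    · rw [if_neg h] at hpc'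
      dsimp only at hpc'
      subst hpc'
      rw [if_neg (show ¬ D.Contains (Q j) z from h)]
      exact .refl ⟨hc2, rfl⟩
  | succ d ih =>
    intro c j hc hpc h15 h16 h17 hj
    refine Reaches.mono (m := 24 + (2 + (26 * (d + 1) + 1))) ((test_steps (x := z.1) (y := z.2)
      hc.ctx hpc (by omega : j < k) h15 h16 h17 hz1 hz2).bind ?_) (by omega) fun _ h => h
    rintro ⟨pc', reg', mem'⟩ ⟨hsame, hpc'⟩
    have hc2 := hc.same hsame
    have e15 : reg' 15 = j := (hsame.2 _ (by decide)).trans h15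
    have e16 : reg' 16 = z.1 := (hsame.2 _ (by decide)).trans h16
    have e17 : reg' 17 = z.2 := (hsame.2 _ (by decide)).trans h17
    have e3 : reg' 3 = 1 := hc2.ctx.r3
    have e0 : reg' 0 = k := hc2.ctx.r0
    have hkl := hc.ctx.layout.query_lt (by omega : j < k)
    have hL := hc.ctx.layout.L_pos
    by_cases h : D.Contains (Q j) (z.1, z.2)
    · rw [if_pos h] at hpc'
      dsimp only at hpc'
      subst hpc'
      have hiff : (∀ j' < k, j ≤ j' → D.Contains (Q j') z) ↔
          (∀ j' < k, j + 1 ≤ j' → D.Contains (Q j') z) := by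
        constructor
        · intro h j' h1 h2; exact h j' h1 (by omega)
        · intro h' j' h1 h2
          rcases h2.eq_or_lt with rfl | h2
          · exact h
          · exact h' j' h1 h2
      simp only [hiff]
      rw [Nat.add_comm 2]
      refine .op (j + 1) rfl (by simp only [e15, e3]; exact eval_add (by omega)) ?_
      refine .jumpLt_true rfl (by simp [Config.setReg_reg, e0]; omega) ?_
      exact ih (((hc2.setReg (d := 15) (j + 1) (by decide))).pc _) rfl
        (by simp [Config.setReg_reg]) (by simp [Config.setReg_reg, e16])
        (by simp [Config.setReg_reg, e17]) (by omega)
    · rw [if_neg h] at hpc'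
      dsimp only at hpc'
      subst hpc'
      rw [if_neg fun h' => h (h' j (by omega) le_rfl)]
      exact .refl ⟨hc2, rfl⟩

-- One unit square per cell suffices as a probe by `GridData.card_interSquares`. The bound `v ≤ e`
-- keeps the counter from overflowing.
open Classical in
theorem cell_steps {i : Fin n} {e v : ℕ} {c : Config} (hc : Cells W D k L Q M i e v c)
    (hpc : c.pc = 49) (he : e < D.B * D.B) (hv : v ≤ e) :
    Reaches W interQuery (fun c' => Cells W D k L Q M i (e + 1)
        (if AllContain D Q k i e then v + 1 else v) c' ∧ c'.pc = 49) (26 * k + 15) c := by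
  have hk := hc.ctx.layout.k_pos
  obtain ⟨pc, reg, mem⟩ := c
  dsimp only at hpc
  subst hpc
  have hc' := hc
  obtain ⟨⟨hl, r0, r1, r2, r3, r4, r5, r7, r8, r9, r10, r11, r12⟩, r22, r23, r24, r25⟩ := hc
  dsimp only at hl r0 r1 r2 r3 r4 r5 r7 r8 r9 r10 r11 r12 r22 r23 r24 r25
  have a1 := hl.mem_ax i
  have a2 := hl.mem_ay i
  have b1 := hl.addr_lt i (t := 1) (by omega)
  have b2 := hl.addr_lt i (t := 2) (by omega)
  have hd := hl.box_lt
  have hd1 : D.B * D.B + 1 < 2 ^ W := by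
    have := hl.addr_lt i (t := D.B * D.B + 1) (by omega)
    omega
  have hs0 := hl.side_pos i
  have hBe : e / D.B < D.B := Nat.div_lt_of_lt_mul he
  have hBe' : e % D.B < D.B := Nat.mod_lt _ hl.B_pos
  have hx : (D.ax i + e / D.B) * D.side i < 2 ^ W :=
    (Nat.mul_le_mul_right _ (by omega)).trans_lt (hl.x_lt i)
  have hy : (D.ay i + e % D.B) * D.side i < 2 ^ W :=
    (Nat.mul_le_mul_right _ (by omega)).trans_lt (hl.y_lt i)
  have hx' := hl.ax_add_lt i
  have hy' := hl.ay_add_lt i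
  have hz : D.square i e 0 = ((D.ax i + e / D.B) * D.side i, (D.ay i + e % D.B) * D.side i) := by
    simp [GridData.square]
  set S := 5 + 2 * (D.B * D.B) with hS
  have : 26 * k + 15 = (26 * (k - 1 + 1) + 1 + 1) + 13 := by omega
  rw [this]
  refine .jumpLt_true rfl (by simp [r22, r24, he]) ?_
  refine .op _ rfl (by simp [r22, r5]; exact eval_div (by omega)) ?_
  refine .op _ rfl (by simp [Config.setReg_reg, r22, r5]; exact eval_mod (by omega)) ?_
  refine .op _ rfl (by simp [Config.setReg_reg, r7, r3]; exact eval_add b1) ?_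
  refine .load _ rfl (by simp [Config.setReg_reg, Config.setReg_mem, a1]; rfl) ?_
  refine .op _ rfl (by simp [Config.setReg_reg]; exact eval_add (by omega)) ?_
  refine .op _ rfl (by simp [Config.setReg_reg, r25]; exact eval_mul hx) ?_
  refine .op _ rfl (by simp [Config.setReg_reg, r7, r10]; exact eval_add b2) ?_
  refine .load _ rfl (by simp [Config.setReg_reg, Config.setReg_mem, a2]; rfl) ?_
  refine .op _ rfl (by simp [Config.setReg_reg]; exact eval_add (by omega)) ?_
  refine .op _ rfl (by simp [Config.setReg_reg, r25]; exact eval_mul hy) ?_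
  refine .const rfl (by omega) (.jump rfl ?_)
  refine Reaches.bind (m := 26 * (k - 1 + 1) + 1) (m' := 1) (scan_steps (D := D) (Q := Q) (L := L) (W := W) (k := k) (d := k - 1) (z := D.square i e 0) (j := 0) (i := i) (e := e) (v := v) (M := M) (by omega)
    (by rw [hz]; exact hx) (by rw [hz]; exact hy) ?_ rfl ?_ ?_ ?_ (by omega)) ?_
  · constructor
    · constructor <;>
      simp [Config.setReg_reg, Config.setReg_mem, hl, r0, r1, r2, r3, r4, r5, r7, r8, r9, r10,
        r11, r12, hS]
    all_goals simp [Config.setReg_reg, r22, r23, r24, r25]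
  · simp [Config.setReg_reg]
  · simp [Config.setReg_reg, hz]
  · simp [Config.setReg_reg, hz]
  · rintro ⟨pc', reg', mem'⟩ ⟨hc2, hpc'⟩
    dsimp only at hpc'
    subst hpc'
    have e22 : reg' 22 = e := hc2.r22
    have e3 : reg' 3 = 1 := hc2.ctx.r3
    have hiff : (∀ j' < k, 0 ≤ j' → D.Contains (Q j') (D.square i e 0)) ↔
      AllContain D Q k i e := by simp [AllContain]
    simp only [hiff] at hc2
    refine .op (e + 1) rfl (by simp only [e22, e3]; exact eval_add (by omega)) (.refl ⟨?_, rfl⟩)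
    refine ⟨hc2.ctx.setReg _ (by decide), ?_, ?_, ?_, ?_⟩ <;> rw [Config.setReg_reg]
    · rfl
    · exact hc2.r23
    · exact hc2.r24
    · exact hc2.r25

-- Field 4 holds `κ - side`, so the maximum search shared with the union program finds the finest
-- grid here. All codes of its box are scanned, at `26 k + 15` steps each.
open Classical in
theorem inter_steps {c : Config} (hc : Start W D k L Q c) :
    ∃ j < k, (∀ j' < k, D.side (Q j) ≤ D.side (Q j')) ∧
      Reaches W interQuery (fun c' => c'.pc = 69 ∧
        c'.reg 0 = ((Finset.range (D.B * D.B)).filter (AllContain D Q k (Q j))).card *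
          (D.side (Q j) * D.side (Q j)) ∧ c'.reg 1 = 1) (80 * (D.B * D.B) * k) c := by
  have hl := hc.layout
  have hkpos := hl.k_pos
  have hBpos := Nat.mul_pos hl.B_pos hl.B_pos
  have hr := search_steps (main := 63) (miss := 48) (tail := interTail) (f := 4)
    (val := fun i => D.κ - D.side i) hc (by norm_num) hl.mem_key
    (fun i => Nat.sub_pos_of_lt (hl.side_lt i)) (fun i => by have := hl.κ_lt; omega)
  obtain ⟨m, c₀, hm, hs, ⟨j, hj, hmax, hctx⟩, hpc, hz⟩ := hr
  refine ⟨j, hj, fun j' hj' => ?_, ?_⟩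
  · have h1 := hmax j' hj'
    have h2 := hl.side_lt (Q j')
    have h3 := hl.side_lt (Q j)
    omega
  set cnt : ℕ → ℕ := fun e =>
    ((Finset.range e).filter (AllContain D Q k (Q j))).card with hcnt
  set M := D.κ - D.side (Q j) with hM
  have hcount : ∀ e, cnt e ≤ e := fun e =>
    (Finset.card_filter_le _ _).trans (by rw [Finset.card_range])
  have h0 : Reaches W interQuery (fun c' => Cells W D k L Q M (Q j) 0 (cnt 0) c' ∧ c'.pc = 49) 3
      c₀ := by
    obtain ⟨pc, reg, mem⟩ := c₀
    dsimp only at hpc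
    subst hpc
    have e5 : reg 5 = D.B := hctx.r5
    have e7 : reg 7 = _ := hctx.r7
    have e25 : mem _ = _ := hctx.layout.mem_side (Q j)
    refine .op _ rfl (by simp [e5]; exact eval_mul hctx.layout.box_lt) ?_
    refine .load _ rfl
      (by simp [Config.setReg_reg, Config.setReg_mem, e7]; exact e25) (.jump rfl (.refl ⟨?_, rfl⟩))
    have h22 := hz 22 (by norm_num)
    have h23 := hz 23 (by norm_num)
    dsimp only at h22 h23
    refine ⟨((hctx.setReg _ (by decide)).setReg _ (by decide)).pc _, ?_, ?_, ?_, ?_⟩ <;>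
      simp [Config.setReg_reg, h22, h23, hcnt]
  have hloop : ∀ e ≤ D.B * D.B, Reaches W interQuery
      (fun c' => Cells W D k L Q M (Q j) e (cnt e) c' ∧ c'.pc = 49) (3 + (26 * k + 15) * e)
      c₀ := by
    intro e
    induction e with
    | zero => intro _; exact h0
    | succ e ih =>
      intro he
      refine ((ih (by omega)).bind fun c₁ h₁ => cell_steps h₁.1 h₁.2 (by omega)
        (hcount e)).mono (by ring_nf; exact le_rfl) fun c₂ h₂ => ⟨?_, h₂.2⟩
      convert h₂.1 using 1
      simp only [hcnt, Finset.range_add_one, Finset.filter_insert]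
      split_ifs with h
      · rw [Finset.card_insert_of_notMem (by simp)]
      · rfl
  have hfin := (hloop _ le_rfl).bind (m' := 5) (post' := fun c' => c'.pc = 69 ∧
      c'.reg 0 = cnt (D.B * D.B) * (D.side (Q j) * D.side (Q j)) ∧ c'.reg 1 = 1) (by
    rintro ⟨pc, reg, mem⟩ ⟨hc₁, hpc₁⟩
    dsimp only at hpc₁
    subst hpc₁
    have e22 : reg 22 = _ := hc₁.r22
    have e23 : reg 23 = _ := hc₁.r23
    have e24 : reg 24 = _ := hc₁.r24
    have e25 : reg 25 = _ := hc₁.r25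
    have hs0 := hl.side_pos (Q j)
    have hlt : cnt (D.B * D.B) * (D.side (Q j) * D.side (Q j)) < 2 ^ W := by
      have h1 := hl.area_lt (Q j)
      have h2 : cnt (D.B * D.B) * (D.side (Q j) * D.side (Q j)) ≤
        D.B * D.B * (D.side (Q j) * D.side (Q j)) := Nat.mul_le_mul_right _ (hcount _)
      have h3 : D.B * D.B * (D.side (Q j) * D.side (Q j)) ≤
          D.K * n * (D.B * D.B * (D.side (Q j) * D.side (Q j))) :=
        Nat.le_mul_of_pos_left _ (Nat.mul_pos hl.K_pos (by have := hl.k_le; omega))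
      omega
    have hlt' : cnt (D.B * D.B) * D.side (Q j) < 2 ^ W := by
      refine lt_of_le_of_lt ?_ hlt
      rw [← Nat.mul_assoc]
      exact Nat.le_mul_of_pos_right _ hs0
    rw [← Nat.mul_assoc] at hlt ⊢
    have h1W : 1 < 2 ^ W := by have := hl.block_lt (Q j); omega
    refine .jumpLt_false rfl (by simp [e22, e24]) (.jump rfl ?_)
    refine .op _ rfl (by simp [e23, e25]; exact eval_mul hlt') ?_
    refine .op _ rfl (by simp [Config.setReg_reg, e25]; exact eval_mul hlt) ?_
    refine .const rfl h1W (.refl ⟨rfl, ?_, ?_⟩) <;> simp [Config.setReg_reg])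
  have h := Reaches.bind (m := 7 + 13 * k + 2) (post := fun c' => c' = c₀)
    ⟨m, c₀, hm, hs, rfl⟩ (fun c' hc' => by rw [hc']; exact hfin)
  refine h.mono ?_ fun _ h => h
  nlinarith [Nat.mul_pos hBpos hkpos, Nat.mul_le_mul_right k (Nat.succ_le_of_lt hBpos),
    Nat.mul_le_mul_left (D.B * D.B) (Nat.succ_le_of_lt hkpos)]

end

/-! ### Exactness of the intersection count -/

section
variable {W n k L : ℕ} {D : GridData n} {Q : ℕ → Fin n}

/-- The unit squares of the intersection of the regions `Q 0, …, Q (k - 1)`. -/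
noncomputable def GridData.interSquares (D : GridData n) (Q : ℕ → Fin n) (k : ℕ) :
    Finset (ℕ × ℕ) :=
  (D.unionSquares Q k).filter fun z => ∀ j < k, z ∈ D.squares (Q j)

/-- Membership in a region is constant on smaller cells. -/
theorem GridData.contains_square_iff {i j : Fin n} {e o : ℕ} (ho : o < D.side i * D.side i)
    (hd : D.side i ∣ D.side j) :
    D.Contains j (D.square i e o) ↔ D.Contains j (D.square i e 0) := by
  obtain ⟨r, hr⟩ := hd
  have h1 := D.square_div (i := i) (e := e) ho
  have h2 := D.square_div (i := i) (e := e) (o := 0) (by omega)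
  unfold Contains
  -- Dividing by the coarse side factors through dividing by the fine one, which forgets the offset
  -- `o`.
  rw [hr, ← Nat.div_div_eq_div_mul, ← Nat.div_div_eq_div_mul, ← Nat.div_div_eq_div_mul,
    ← Nat.div_div_eq_div_mul, h1.1, h1.2, h2.1, h2.2]

-- Divisibility of the sides makes the grids nested, so the intersection is a disjoint union of
-- whole cells of the finest grid, and each is recognised by its lower left square.
open Classical in
theorem GridData.card_interSquares (hf : D.Fits W) {j : ℕ} (hj : j < k)
    (hmin : ∀ j' < k, D.side (Q j) ∣ D.side (Q j')) :
    (D.interSquares Q k).card =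
      ((Finset.range (D.B * D.B)).filter (AllContain D Q k (Q j))).card *
        (D.side (Q j) * D.side (Q j)) := by
  have hmem : ∀ i z, z ∈ D.squares i ↔ D.Contains i z := fun i z =>
    mem_squares (hf.side_pos i) (hf.cells_lt i)
  have hss := Nat.mul_pos (hf.side_pos (Q j)) (hf.side_pos (Q j))
  have h1 : D.interSquares Q k =
      (D.squares (Q j)).filter fun z => ∀ j' < k, D.Contains (Q j') z := by
    ext z
    simp only [interSquares, unionSquares, Finset.mem_filter, Finset.mem_biUnion,
      Finset.mem_range, hmem]
    exact ⟨fun h => ⟨h.2 j hj, h.2⟩, fun h => ⟨⟨j, hj, h.1⟩, h.2⟩⟩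
  -- Scanning empty cells of the box changes nothing: region `Q j` is itself among the tested ones.
  have h2 : (Finset.range (D.B * D.B)).filter (AllContain D Q k (Q j)) =
      (D.cells (Q j)).filter (AllContain D Q k (Q j)) := by
    ext e
    simp only [Finset.mem_filter, Finset.mem_range]
    constructor
    · rintro ⟨h, ha⟩
      exact ⟨(contains_square h hss).1 (ha j hj), ha⟩
    · rintro ⟨h, ha⟩
      exact ⟨hf.cells_lt _ _ h, ha⟩
  have h3 : ((D.interSquares Q k).card : ℝ) = ∑ z ∈ D.squares (Q j),
      if ∀ j' < k, D.Contains (Q j') z then 1 else 0 := by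
    rw [h1, Finset.sum_boole]
  rw [sum_squares] at h3
  have h4 : ∀ e ∈ D.cells (Q j), (∑ o ∈ Finset.range (D.side (Q j) * D.side (Q j)),
      if ∀ j' < k, D.Contains (Q j') (D.square (Q j) e o) then (1 : ℝ) else 0) =
      if AllContain D Q k (Q j) e then (D.side (Q j) * D.side (Q j) : ℝ) else 0 := by
    intro e _
    have h5 : ∀ o ∈ Finset.range (D.side (Q j) * D.side (Q j)),
        (if ∀ j' < k, D.Contains (Q j') (D.square (Q j) e o) then (1 : ℝ) else 0) =
        if AllContain D Q k (Q j) e then 1 else 0 := by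
      intro o ho
      refine if_congr ?_ rfl rfl
      exact forall₂_congr fun j' hj' =>
        contains_square_iff (Finset.mem_range.1 ho) (hmin j' hj')
    rw [Finset.sum_congr rfl h5, Finset.sum_const, Finset.card_range]
    split_ifs <;> simp
  rw [Finset.sum_congr rfl h4, ← Finset.sum_filter, Finset.sum_const, nsmul_eq_mul] at h3
  rw [h2]
  exact_mod_cast h3

/-- The program is deterministic and its answer exact, so any terminal cost vanishing at the correct
answer disappears. The time bound and error probability 0 are both instances. -/
theorem inter_cost {c : Config} (hc : Start W D k L Q c) {τ : ℝ} (hτ : 0 ≤ τ)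
    (hdvd : ∀ i j, D.side i ≤ D.side j → D.side i ∣ D.side j) {f : Config → ENNReal}
    (hf : ∀ c : Config, c.output = (D.interSquares Q k).card → f c = 0) (t : ℕ) :
    cost W interQuery (ENNReal.ofReal τ) f t c ≤
      ENNReal.ofReal (80 * (D.B * D.B) * k * τ) := by
  obtain ⟨j, hj, hmin, h⟩ := inter_steps hc
  refine h.cost_le hτ le_rfl ?_ (by push_cast; simp)
  rintro c' ⟨hpc, h0, h1⟩
  cases t with
  | zero => exact zero_le
  | succ t =>
    rw [cost_halted (by rw [Halted, hpc]; rfl), hf]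
    · exact zero_le
    · rw [Config.output, h0, h1, GridData.card_interSquares hc.layout.toFits hj
        fun j' hj' => hdvd _ _ (hmin j' hj')]
      simp

/-! ### The summary -/

/-- The word number `t` of the block of region `i`. -/
noncomputable def GridData.field (D : GridData n) (i : Fin n) (t : ℕ) : ℕ :=
  if t = 0 then D.side i else if t = 1 then D.ax i else if t = 2 then D.ay i
  else if t = 3 then D.area i else if t = 4 then D.κ - D.side i
  else if t < 5 + D.B * D.B then if t - 5 ∈ D.cells i then 1 else 0
  else D.cellAt i (t - (5 + D.B * D.B))

/-- The word number `a` of the summary. -/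
noncomputable def GridData.word (D : GridData n) (a : ℕ) : ℕ :=
  if a / (5 + 2 * (D.B * D.B)) = 0 then
    if a = 0 then 5 + 2 * (D.B * D.B) else if a = 1 then D.K else if a = 2 then D.B else 0
  else if h : a / (5 + 2 * (D.B * D.B)) - 1 < n then D.field ⟨_, h⟩ (a % (5 + 2 * (D.B * D.B)))
  else 0

/-- The summary. -/
noncomputable def GridData.summary (D : GridData n) : List ℕ :=
  (List.range ((n + 1) * (5 + 2 * (D.B * D.B)))).map D.word

theorem GridData.word_block (D : GridData n) (i : Fin n) {t : ℕ}
    (ht : t < 5 + 2 * (D.B * D.B)) :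
    D.word ((i + 1) * (5 + 2 * (D.B * D.B)) + t) = D.field i t := by
  have h1 : ((i + 1) * (5 + 2 * (D.B * D.B)) + t) / (5 + 2 * (D.B * D.B)) = i + 1 := by
    rw [mul_comm, Nat.mul_add_div (by omega), Nat.div_eq_of_lt ht, add_zero]
  have h2 : ((i + 1) * (5 + 2 * (D.B * D.B)) + t) % (5 + 2 * (D.B * D.B)) = t := by
    rw [mul_comm, Nat.mul_add_mod, Nat.mod_eq_of_lt ht]
  unfold word
  rw [h1, h2, if_neg (by omega), dif_pos (by simp)]
  rfl

theorem GridData.Fits.area_le (hf : D.Fits W) (i : Fin n) :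
    D.area i ≤ D.B * D.B * (D.side i * D.side i) := by
  have := Finset.card_le_card (fun e he => Finset.mem_range.2 (hf.cells_lt i e he))
  rw [Finset.card_range] at this
  exact Nat.mul_le_mul_right _ this

theorem GridData.Fits.mul_lt (hf : D.Fits W) (i : Fin n) :
    D.K < 2 ^ W ∧ D.B * D.B * (D.side i * D.side i) < 2 ^ W := by
  have h1 := hf.area_lt i
  have h2 : 0 < D.B * D.B * (D.side i * D.side i) :=
    Nat.mul_pos (Nat.mul_pos hf.B_pos hf.B_pos) (Nat.mul_pos (hf.side_pos i) (hf.side_pos i))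
  have hn : 0 < n := i.pos
  have h3 := Nat.le_mul_of_pos_left (D.B * D.B * (D.side i * D.side i)) (Nat.mul_pos hf.K_pos hn)
  have h4 : D.K ≤ D.K * n * (D.B * D.B * (D.side i * D.side i)) := by
    rw [mul_assoc]
    exact Nat.le_mul_of_pos_right _ (Nat.mul_pos hn h2)
  omega

theorem GridData.Fits.word_lt (hf : D.Fits W) (hn : 0 < n) (a : ℕ) : D.word a < 2 ^ W := by
  have hL := hf.length_lt
  have hS : 5 + 2 * (D.B * D.B) ≤ (n + 1) * (5 + 2 * (D.B * D.B)) :=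
    Nat.le_mul_of_pos_left _ (by omega)
  have hB : D.B ≤ D.B * D.B := Nat.le_mul_of_pos_left _ hf.B_pos
  have hK := (hf.mul_lt ⟨0, hn⟩).1
  unfold word
  split_ifs <;> try omega
  rename_i _ h
  generalize (⟨_, h⟩ : Fin n) = i
  have hx : D.ax i ≤ (D.ax i + D.B) * D.side i :=
    (Nat.le_add_right _ _).trans (Nat.le_mul_of_pos_right _ (hf.side_pos i))
  have hy : D.ay i ≤ (D.ay i + D.B) * D.side i :=
    (Nat.le_add_right _ _).trans (Nat.le_mul_of_pos_right _ (hf.side_pos i))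
  have h1 := hf.x_lt i
  have h2 := hf.y_lt i
  have h3 := hf.side_lt i
  have h4 := hf.κ_lt
  have h5 := hf.area_le i
  have h6 := (hf.mul_lt i).2
  have h7 : ∀ c, D.cellAt i c < 2 ^ W := by
    intro c
    by_cases hc : c < (D.cells i).card
    · have := hf.cells_lt _ _ (D.cellAt_mem hc)
      omega
    · unfold cellAt
      rw [List.getD_eq_default _ _ (by rw [Finset.length_toList]; omega)]
      positivity
  unfold field
  split_ifs <;> first | omega | exact h7 _

/-- A query without duplicates has at most `n` entries, which keeps all addresses and the product `K
k M` within a word. -/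
theorem GridData.Fits.isStart (hf : D.Fits W) (hn : 0 < n) {q : List (Fin n)} (hq : q ≠ [])
    (hnd : q.Nodup) :
    Start W D q.length ((n + 1) * (5 + 2 * (D.B * D.B))) (fun j => q.getD j ⟨0, hn⟩)
      (start W D.summary q) := by
  have hk : q.length ≤ n := by simpa using hnd.length_le_card
  have hL := hf.length_lt
  have hlen : D.summary.length = (n + 1) * (5 + 2 * (D.B * D.B)) := by simp [summary]
  have hmem : ∀ a < (n + 1) * (5 + 2 * (D.B * D.B)), (start W D.summary q).mem a = D.word a := by
    intro a ha
    show (D.summary ++ _).getD a 0 = _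
    rw [List.getD_append _ _ _ _ (by rw [hlen]; exact ha),
      List.getD_eq_getElem _ _ (by rw [hlen]; exact ha)]
    simp [summary]
  have hS : 5 + 2 * (D.B * D.B) ≤ (n + 1) * (5 + 2 * (D.B * D.B)) :=
    Nat.le_mul_of_pos_left _ (by omega)
  have hblock : ∀ (i : Fin n) t, t < 5 + 2 * (D.B * D.B) →
      (start W D.summary q).mem ((i + 1) * (5 + 2 * (D.B * D.B)) + t) = D.field i t := by
    intro i t ht
    rw [hmem _ ?_, D.word_block i ht]
    have : (i + 1 + 1) * (5 + 2 * (D.B * D.B)) ≤ (n + 1) * (5 + 2 * (D.B * D.B)) :=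
      Nat.mul_le_mul_right _ (by omega)
    rw [Nat.add_mul (i + 1) 1] at this
    omega
  have hdiv : ∀ t < 3, t / (5 + 2 * (D.B * D.B)) = 0 := fun t ht =>
    Nat.div_eq_of_lt (by omega)
  refine ⟨⟨hf, List.length_pos_iff.2 hq, hk, rfl, ?_, ?_, ?_, ?_, ?_, ?_, ?_, ?_, ?_, ?_, ?_⟩,
    rfl, ?_, ?_, ?_⟩
  · rw [hmem _ (by omega), word, if_pos (hdiv 0 (by norm_num))]; rfl
  · rw [hmem _ (by omega), word, if_pos (hdiv 1 (by norm_num))]; rfl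
  · rw [hmem _ (by omega), word, if_pos (hdiv 2 (by norm_num))]; rfl
  · intro i; exact hblock i 0 (by omega)
  · intro i; exact hblock i 1 (by omega)
  · intro i; exact hblock i 2 (by omega)
  · intro i; exact hblock i 3 (by omega)
  · intro i; exact hblock i 4 (by omega)
  · intro i e he
    rw [hblock i (5 + e) (by omega)]
    simp [field, he, show 5 + e ≠ 1 by omega, show 5 + e ≠ 2 by omega, show 5 + e ≠ 3 by omega,
      show 5 + e ≠ 4 by omega]
  · intro i c hc
    have hcard := Finset.card_le_card (fun e he => Finset.mem_range.2 (hf.cells_lt i e he))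
    rw [Finset.card_range] at hcard
    rw [hblock i (5 + D.B * D.B + c) (by omega), field, if_neg (by omega), if_neg (by omega),
      if_neg (by omega), if_neg (by omega), if_neg (by omega), if_neg (by omega),
      Nat.add_sub_cancel_left]
  · intro j hj
    show (D.summary ++ _).getD _ 0 = _
    rw [← hlen, List.getD_append_right _ _ _ _ (Nat.le_add_right _ _), Nat.add_sub_cancel_left,
      List.getD_eq_getElem _ _ (by simpa using hj), List.getD_eq_getElem _ _ hj]
    simp
  · exact Nat.mod_eq_of_lt (by omega)
  · show D.summary.length % 2 ^ W = _
    rw [hlen]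
    exact Nat.mod_eq_of_lt (by omega)
  · intro r hr
    show (if r = 0 then _ else if r = 1 then _ else 0) = 0
    rw [if_neg (by omega), if_neg (by omega)]

theorem expectedTime_pure_le {prog : List Instr} {s : List ℕ} {q : List (Fin n)} {v : ENNReal}
    (h : ∀ t, cost W prog 1 (fun _ => 0) t (start W s q) ≤ v) :
    expectedTime W prog (PMF.pure s) q ≤ v := by
  unfold expectedTime execution
  simp only [PMF.pure_bind]
  exact tsum_not_halted_le h

theorem isEstimator_pure {prog : List Instr} {s : List ℕ} {q : List (Fin n)} {w : ENNReal}
    {ε δ μ v : ℝ} (hδ0 : 0 < δ) (hδ1 : δ < 1) (hv : v < δ) (hw : w ≠ ⊤)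
    (htime : ∀ t, cost W prog 1 (fun _ => 0) t (start W s q) ≤ w)
    (hbad : ∀ t, cost W prog 0 ({c : Config | |c.output - μ| ≤ ε * μ}ᶜ.indicator 1) t
      (start W s q) ≤ ENNReal.ofReal v) :
    IsEstimator W prog (PMF.pure s) q ε δ μ := by
  unfold IsEstimator execution
  simp only [PMF.pure_bind]
  have h := one_le_good_add hw {c : Config | |c.output - μ| ≤ ε * μ} htime hbad
  by_contra hle
  -- `v` may be negative, whereas `ENNReal.ofReal` truncates at 0; the maximum is still below `δ`.
  have h2 : (1 : ENNReal) ≤ ENNReal.ofReal (1 - δ) + ENNReal.ofReal (max v 0) := by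
    refine h.trans (add_le_add (not_lt.1 hle) (ENNReal.ofReal_le_ofReal (le_max_left _ _)))
  rw [← ENNReal.ofReal_add (by linarith) (le_max_right _ _), ← ENNReal.ofReal_one] at h2
  have h3 : max v 0 < δ := max_lt hv hδ0
  have := (ENNReal.ofReal_le_ofReal_iff (by have := le_max_right v 0; linarith)).1 h2
  linarith

end

/-! ### Regions of unit squares -/

/-- The union of the half-open unit squares with lower left corners in `F`. -/
def region (F : Finset (ℕ × ℕ)) : Set Plane :=
  {z | 0 ≤ z 0 ∧ 0 ≤ z 1 ∧ (⌊z 0⌋₊, ⌊z 1⌋₊) ∈ F}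

/-- A half-open unit square. -/
def unitSquare (p : ℕ × ℕ) : Set Plane :=
  (MeasurableEquiv.toLp 2 (Fin 2 → ℝ)).symm ⁻¹'
    Set.pi Set.univ fun j => Set.Ico (![(p.1 : ℝ), p.2] j) (![(p.1 : ℝ), p.2] j + 1)

theorem mem_unitSquare {p : ℕ × ℕ} {z : Plane} :
    z ∈ unitSquare p ↔ 0 ≤ z 0 ∧ 0 ≤ z 1 ∧ (⌊z 0⌋₊, ⌊z 1⌋₊) = p := by
  have h : z ∈ unitSquare p ↔ ((p.1 : ℝ) ≤ z 0 ∧ z 0 < p.1 + 1) ∧ (p.2 : ℝ) ≤ z 1 ∧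
      z 1 < p.2 + 1 := by
    simp [unitSquare, Fin.forall_fin_two]
  rw [h, Prod.ext_iff]
  constructor
  · rintro ⟨⟨h1, h2⟩, h3, h4⟩
    have h5 : 0 ≤ z 0 := (Nat.cast_nonneg _).trans h1
    have h6 : 0 ≤ z 1 := (Nat.cast_nonneg _).trans h3
    exact ⟨h5, h6, (Nat.floor_eq_iff h5).2 ⟨h1, h2⟩, (Nat.floor_eq_iff h6).2 ⟨h3, h4⟩⟩
  · rintro ⟨h5, h6, h1, h2⟩
    exact ⟨(Nat.floor_eq_iff h5).1 h1, (Nat.floor_eq_iff h6).1 h2⟩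

theorem measurableSet_unitSquare (p : ℕ × ℕ) : MeasurableSet (unitSquare p) :=
  (MeasurableEquiv.measurable _) (MeasurableSet.univ_pi fun _ => measurableSet_Ico)

theorem volume_unitSquare (p : ℕ × ℕ) : volume (unitSquare p) = 1 := by
  unfold unitSquare
  rw [(EuclideanSpace.volume_preserving_symm_measurableEquiv_toLp (Fin 2)).measure_preimage
    (MeasurableSet.univ_pi fun _ => measurableSet_Ico).nullMeasurableSet, volume_pi_pi]
  simp

theorem region_eq (F : Finset (ℕ × ℕ)) : region F = ⋃ p ∈ F, unitSquare p := by
  ext z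
  simp only [Set.mem_iUnion, mem_unitSquare, region]
  constructor
  · rintro ⟨h1, h2, h3⟩
    exact ⟨_, h3, h1, h2, rfl⟩
  · rintro ⟨p, hp, h1, h2, rfl⟩
    exact ⟨h1, h2, hp⟩

theorem measurableSet_region (F : Finset (ℕ × ℕ)) : MeasurableSet (region F) := by
  rw [region_eq]
  exact F.measurableSet_biUnion fun p _ => measurableSet_unitSquare p

/-- Half-open squares with distinct corners are disjoint, so area is a count. -/
theorem volume_region (F : Finset (ℕ × ℕ)) : (volume (region F)).toReal = F.card := by
  rw [region_eq, measure_biUnion_finset]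
  · simp [volume_unitSquare]
  · intro p _ p' _ hne
    refine Set.disjoint_left.2 fun z hz hz' => hne ?_
    exact (mem_unitSquare.1 hz).2.2.symm.trans (mem_unitSquare.1 hz').2.2
  · exact fun p _ => measurableSet_unitSquare p

/-! ### Polygons -/

theorem IsPolygon.isCompact {P : Set Plane} (h : IsPolygon P) : IsCompact P := by
  obtain ⟨m, T, -, -, rfl⟩ := h
  exact isCompact_iUnion fun i => (Set.finite_range (T i)).isCompact_convexHull (𝕜 := ℝ)

theorem IsPolygon.interior_nonempty {P : Set Plane} (h : IsPolygon P) :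
    (interior P).Nonempty := by
  obtain ⟨m, T, hm, hT, rfl⟩ := h
  have h1 : affineSpan ℝ (Set.range (T ⟨0, hm⟩)) = ⊤ := by
    rw [(hT ⟨0, hm⟩).affineSpan_eq_top_iff_card_eq_finrank_add_one]
    simp
  have h2 := interior_convexHull_nonempty_iff_affineSpan_eq_top.2 h1
  exact h2.mono (interior_mono (Set.subset_iUnion (fun i => convexHull ℝ (Set.range (T i))) _))

/-- The open ball of radius `w` about the point meets no exterior point. As `P` is closed, its
exterior is its complement, and the ball lies in `P`. -/
theorem inner_subset_interior {P : Set Plane} (hP : IsClosed P) {w : ℝ} (hw : 0 < w) :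
    inner P w ⊆ interior P := by
  intro z hz
  rw [mem_interior]
  refine ⟨Metric.ball z w, fun y hy => ?_, Metric.isOpen_ball, Metric.mem_ball_self hw⟩
  by_contra hyP
  have := hz y (by rwa [hP.isOpen_compl.interior_eq])
  rw [Metric.mem_ball, dist_comm] at hy
  linarith

theorem dist_le_sqrt_two {z z' : Plane} {a : ℝ} (h0 : |z 0 - z' 0| ≤ a) (h1 : |z 1 - z' 1| ≤ a) :
    dist z z' ≤ √2 * a := by
  have ha : 0 ≤ a := (abs_nonneg _).trans h0
  rw [EuclideanSpace.dist_eq, Fin.sum_univ_two, Real.dist_eq, Real.dist_eq]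
  refine Real.sqrt_le_iff.2 ⟨by positivity, ?_⟩
  rw [mul_pow, Real.sq_sqrt (by norm_num)]
  have e0 := pow_le_pow_left₀ (abs_nonneg _) h0 2
  have e1 := pow_le_pow_left₀ (abs_nonneg _) h1 2
  linarith

theorem abs_sub_le_dist (z z' : Plane) (j : Fin 2) : |z j - z' j| ≤ dist z z' := by
  rw [← Real.dist_eq]
  exact PiLp.dist_apply_le z z' j

/-- Points with the same cell coordinates are close. -/
theorem abs_sub_le_of_floor_div {x y : ℝ} {s : ℕ} (hs : 0 < s) (hx : 0 ≤ x) (hy : 0 ≤ y)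
    (h : ⌊x⌋₊ / s = ⌊y⌋₊ / s) : |x - y| ≤ s := by
  rw [← Nat.floor_div_natCast, ← Nat.floor_div_natCast] at h
  have hs' : (0 : ℝ) < s := by exact_mod_cast hs
  have x1 := Nat.floor_le (div_nonneg hx hs'.le)
  have x2 := Nat.lt_floor_add_one (x / s)
  have y1 := Nat.floor_le (div_nonneg hy hs'.le)
  have y2 := Nat.lt_floor_add_one (y / s)
  rw [h] at x1 x2
  rw [le_div_iff₀ hs'] at x1 y1
  rw [div_lt_iff₀ hs'] at x2 y2
  rw [abs_le]
  constructor <;> nlinarith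

/-- The number of cells which a set of diameter `d` meets in one direction. -/
theorem floor_div_sub_lt {x y d : ℝ} {s : ℕ} (hs : 0 < s) (hx : 0 ≤ x)
    (h : |x - y| ≤ d) : ((⌊x⌋₊ / s : ℕ) : ℝ) - (⌊y⌋₊ / s : ℕ) < 1 + d / s := by
  rw [← Nat.floor_div_natCast, ← Nat.floor_div_natCast]
  have hs' : (0 : ℝ) < s := by exact_mod_cast hs
  have x1 := Nat.floor_le (div_nonneg hx hs'.le)
  have y2 := Nat.lt_floor_add_one (y / s)
  have h1 : x / s ≤ y / s + d / s := by
    rw [← add_div]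
    gcongr
    linarith [(abs_le.1 h).2]
  linarith

/-- A family of cells for a set `P`: those which meet its interior. -/
theorem exists_cells {P : Set Plane} (hP : IsPolygon P) {u s B : ℕ} (hs : 0 < s)
    (hu : ∀ x ∈ P, ∀ j, 0 ≤ x j ∧ x j ≤ u) (hB : 1 + Metric.diam P / s ≤ B) :
    ∃ (ax ay : ℕ) (cells : Finset ℕ), ax * s ≤ u ∧ ay * s ≤ u ∧ cells.Nonempty ∧
      (∀ e ∈ cells, e < B * B) ∧ ∀ x y : ℕ,
        (((ax ≤ x / s ∧ x / s - ax < B) ∧ (ay ≤ y / s ∧ y / s - ay < B) ∧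
          (x / s - ax) * B + (y / s - ay) ∈ cells) ↔
          ∃ z ∈ interior P, ⌊z 0⌋₊ / s = x / s ∧ ⌊z 1⌋₊ / s = y / s) := by
  classical
  -- The box starts at the smallest cell coordinate in each direction; the two may be attained at
  -- different points.
  have hmin : ∀ j : Fin 2, ∃ z ∈ interior P, ∀ z' ∈ interior P,
      ⌊z j⌋₊ / s ≤ ⌊z' j⌋₊ / s := by
    intro j
    have hne : ((fun z : Plane => ⌊z j⌋₊ / s) '' interior P).Nonempty :=
      hP.interior_nonempty.image _
    obtain ⟨z, hz, hz'⟩ := Nat.sInf_mem hne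
    exact ⟨z, hz, fun z' h => hz'.trans_le (Nat.sInf_le ⟨z', h, rfl⟩)⟩
  have hbox : ∀ j : Fin 2, ∀ z ∈ interior P, ∀ z' ∈ interior P,
      ⌊z' j⌋₊ / s - ⌊z j⌋₊ / s < B := by
    intro j z hz z' hz'
    have h1 := hu _ (interior_subset hz) j
    have h2 := hu _ (interior_subset hz') j
    have h3 := floor_div_sub_lt hs h2.1 ((abs_sub_le_dist z' z j).trans
      (Metric.dist_le_diam_of_mem hP.isCompact.isBounded (interior_subset hz')
        (interior_subset hz)))
    by_contra h4
    -- Truncated subtraction leaves the extra case `B = 0`, which `hB` excludes.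
    have h5 : B + ⌊z j⌋₊ / s ≤ ⌊z' j⌋₊ / s ∨ B = 0 := by omega
    have hBp : (0 : ℝ) < B := lt_of_lt_of_le (by positivity) hB
    rcases h5 with h5 | h5
    · have h6 : (B : ℝ) + (⌊z j⌋₊ / s : ℕ) ≤ (⌊z' j⌋₊ / s : ℕ) := by exact_mod_cast h5
      linarith
    · rw [h5] at hBp; norm_num at hBp
  have hle : ∀ j : Fin 2, ∀ z ∈ interior P, ⌊z j⌋₊ / s * s ≤ u := by
    intro j z hz
    refine (Nat.div_mul_le_self _ _).trans ?_
    exact Nat.floor_le_of_le (hu _ (interior_subset hz) j).2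
  obtain ⟨zx, hzx, hx⟩ := hmin 0
  obtain ⟨zy, hzy, hy⟩ := hmin 1
  set ax := ⌊zx 0⌋₊ / s
  set ay := ⌊zy 1⌋₊ / s
  have hcode : ∀ a b, a < B → b < B → (a * B + b) / B = a ∧ (a * B + b) % B = b := by
    intro a b ha hb
    constructor
    · rw [mul_comm, Nat.mul_add_div (by omega), Nat.div_eq_of_lt hb, add_zero]
    · rw [mul_comm, Nat.mul_add_mod, Nat.mod_eq_of_lt hb]
  have hcode_lt : ∀ a b, a < B → b < B → a * B + b < B * B := by
    intro a b ha hb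
    have h1 : (a + 1) * B ≤ B * B := Nat.mul_le_mul_right _ ha
    rw [Nat.add_mul] at h1
    omega
  set cells := (Finset.range (B * B)).filter fun e =>
    ∃ z ∈ interior P, ⌊z 0⌋₊ / s = ax + e / B ∧ ⌊z 1⌋₊ / s = ay + e % B with hcells
  have hmem : ∀ z ∈ interior P, (⌊z 0⌋₊ / s - ax) * B + (⌊z 1⌋₊ / s - ay) ∈ cells := by
    intro z hz
    have b0 := hbox 0 zx hzx z hz
    have b1 := hbox 1 zy hzy z hz
    refine Finset.mem_filter.2 ⟨Finset.mem_range.2 (hcode_lt _ _ b0 b1), z, hz, ?_⟩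
    rw [(hcode _ _ b0 b1).1, (hcode _ _ b0 b1).2]
    have := hx z hz
    have := hy z hz
    omega
  refine ⟨ax, ay, cells, hle 0 zx hzx, hle 1 zy hzy, ⟨_, hmem zx hzx⟩, ?_, ?_⟩
  · exact fun e he => Finset.mem_range.1 (Finset.mem_filter.1 he).1
  · intro x y
    constructor
    · rintro ⟨⟨h1, h2⟩, ⟨h3, h4⟩, h5⟩
      obtain ⟨z, hz, e1, e2⟩ := (Finset.mem_filter.1 h5).2
      rw [(hcode _ _ h2 h4).1] at e1
      rw [(hcode _ _ h2 h4).2] at e2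
      exact ⟨z, hz, by omega, by omega⟩
    · rintro ⟨z, hz, e1, e2⟩
      rw [← e1, ← e2]
      exact ⟨⟨hx z hz, hbox 0 zx hzx z hz⟩, ⟨hy z hz, hbox 1 zy hzy z hz⟩, hmem z hz⟩

/-- Rounding down an interior point moves it by at most `√2`. Finiteness has to be checked as well,
because `Set.ncard` of an infinite set is 0. -/
theorem latticeCount_pos {P : Set Plane} (hP : IsPolygon P) {w : ℝ} (hw : √2 ≤ w) :
    0 < latticeCount (outer P w) := by
  have hw0 : 0 ≤ w := (Real.sqrt_nonneg _).trans hw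
  obtain ⟨y, hy⟩ := hP.interior_nonempty
  unfold latticeCount
  refine (Set.ncard_pos ?_).2
    ⟨fun j => ⌊y j⌋, y, hy, (dist_le_sqrt_two (a := 1) ?_ ?_).trans (by linarith)⟩
  · obtain ⟨R, hR⟩ := hP.isCompact.isBounded.exists_norm_le
    have hfin : (Set.pi Set.univ fun _ : Fin 2 => Set.Icc (-⌈R + w⌉) ⌈R + w⌉).Finite :=
      Set.Finite.pi fun _ => Set.finite_Icc _ _
    refine hfin.subset fun z hz j _ => ?_
    obtain ⟨y, hy, hd⟩ := hz
    have h1 := abs_sub_le_dist (WithLp.toLp 2 fun j => (z j : ℝ)) y j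
    have h2 : |y j| ≤ R := (by
      have := PiLp.norm_apply_le y j
      exact this.trans (hR y (interior_subset hy)))
    simp only at h1
    have h3 := abs_le.1 (h1.trans hd)
    have h4 := abs_le.1 h2
    have h5 := Int.le_ceil (R + w)
    constructor
    · have : (-⌈R + w⌉ : ℝ) ≤ z j := by linarith
      exact_mod_cast this
    · have : (z j : ℝ) ≤ ⌈R + w⌉ := by linarith
      exact_mod_cast this

  all_goals
    simp only
    rw [abs_le]
    constructor <;> linarith [Int.floor_le (y 0), Int.lt_floor_add_one (y 0),
      Int.floor_le (y 1), Int.lt_floor_add_one (y 1)]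

/-- A point of the inner set is interior, so it witnesses that its own cell is occupied. -/
theorem inner_subset_region {P : Set Plane} (hP : IsPolygon P) {u s : ℕ} {w : ℝ} (hw : 0 < w)
    (hu : ∀ x ∈ P, ∀ j, 0 ≤ x j ∧ x j ≤ u) {F : Finset (ℕ × ℕ)}
    (hF : ∀ x y : ℕ, (x, y) ∈ F ↔ ∃ z ∈ interior P, ⌊z 0⌋₊ / s = x / s ∧ ⌊z 1⌋₊ / s = y / s) :
    inner P w ⊆ region F := by
  intro z hz
  have hz' := inner_subset_interior hP.isCompact.isClosed hw hz
  have := hu z (interior_subset hz')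
  exact ⟨(this 0).1, (this 1).1, (hF _ _).2 ⟨z, hz', rfl, rfl⟩⟩

/-- Each occupied cell contains an interior point, and its diagonal `√2 s` is at most `w`. -/
theorem region_subset_outer {P : Set Plane} {u s : ℕ} (hs : 0 < s) {w : ℝ}
    (hsw : √2 * s ≤ w) (hu : ∀ x ∈ P, ∀ j, 0 ≤ x j ∧ x j ≤ u) {F : Finset (ℕ × ℕ)}
    (hF : ∀ x y : ℕ, (x, y) ∈ F ↔ ∃ z ∈ interior P, ⌊z 0⌋₊ / s = x / s ∧ ⌊z 1⌋₊ / s = y / s) :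
    region F ⊆ outer P w := by
  rintro z ⟨h0, h1, hz⟩
  obtain ⟨z', hz', e0, e1⟩ := (hF _ _).1 hz
  have := hu z' (interior_subset hz')
  exact ⟨z', hz', (dist_le_sqrt_two (abs_sub_le_of_floor_div hs h0 (this 0).1 e0.symm)
    (abs_sub_le_of_floor_div hs h1 (this 1).1 e1.symm)).trans hsw⟩

section
variable {n : ℕ} {D : GridData n}

theorem region_unionSquares (hn : 0 < n) (q : List (Fin n)) :
    region (D.unionSquares (fun j => q.getD j ⟨0, hn⟩) q.length) =
      ⋃ i ∈ q, region (D.squares i) := by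
  ext z
  simp only [region, GridData.unionSquares, Finset.mem_biUnion, Finset.mem_range, Set.mem_iUnion]
  constructor
  · rintro ⟨h0, h1, j, hj, h⟩
    rw [List.getD_eq_getElem _ _ hj] at h
    exact ⟨_, List.getElem_mem hj, h0, h1, h⟩
  · rintro ⟨i, hi, h0, h1, h⟩
    obtain ⟨j, hj, rfl⟩ := List.getElem_of_mem hi
    refine ⟨h0, h1, j, hj, ?_⟩
    rwa [List.getD_eq_getElem _ _ hj]

theorem region_interSquares (hn : 0 < n) {q : List (Fin n)} (hq : q ≠ []) :
    region (D.interSquares (fun j => q.getD j ⟨0, hn⟩) q.length) =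
      ⋂ i ∈ q, region (D.squares i) := by
  ext z
  simp only [region, GridData.interSquares, GridData.unionSquares, Finset.mem_filter,
    Finset.mem_biUnion, Finset.mem_range, Set.mem_iInter]
  constructor
  · rintro ⟨h0, h1, -, h⟩ i hi
    obtain ⟨j, hj, rfl⟩ := List.getElem_of_mem hi
    have := h j hj
    rw [List.getD_eq_getElem _ _ hj] at this
    exact ⟨h0, h1, this⟩
  · intro h
    have hlen := List.length_pos_iff.2 hq
    have h' : ∀ j (hj : j < q.length), _ := fun j hj => h _ (List.getElem_mem hj)
    have h2 : ∀ j < q.length,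
        (⌊z 0⌋₊, ⌊z 1⌋₊) ∈ D.squares (q.getD j ⟨0, hn⟩) := by
      intro j hj
      rw [List.getD_eq_getElem _ _ hj]
      exact (h' j hj).2.2
    exact ⟨(h' 0 hlen).1, (h' 0 hlen).2.1, ⟨0, hlen, h2 0 hlen⟩, h2⟩

end

/-! ### Choice of the grids for a family of polygons -/

/-- The diameter of a subset of `[0, u] ^ 2`. -/
theorem diam_le_of_box {P : Set Plane} {u : ℕ} (hu : ∀ x ∈ P, ∀ j, 0 ≤ x j ∧ x j ≤ u) :
    Metric.diam P ≤ √2 * u := by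
  refine Metric.diam_le_of_forall_dist_le (by positivity) fun x hx y hy => ?_
  refine dist_le_sqrt_two ?_ ?_ <;> rw [abs_le] <;> constructor
  · linarith [(hu x hx 0).1, (hu y hy 0).2]
  · linarith [(hu x hx 0).2, (hu y hy 0).1]
  · linarith [(hu x hx 1).1, (hu y hy 1).2]
  · linarith [(hu x hx 1).2, (hu y hy 1).1]

theorem sqrt_eight : √8 = 2 * √2 := by
  rw [show (8 : ℝ) = 2 ^ 2 * 2 by norm_num, Real.sqrt_mul (by norm_num), Real.sqrt_sq (by norm_num)]

/-- A power of two that is a suitable side of the cells for the distance `w`. -/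
theorem exists_side {w : ℝ} (hw : √8 ≤ w) : ∃ l : ℕ, √2 * (2 ^ l : ℕ) ≤ w ∧
    w ≤ 2 * √2 * (2 ^ l : ℕ) := by
  have h2 : 0 < √2 := by positivity
  rw [sqrt_eight] at hw
  obtain ⟨l, h1, h3⟩ := exists_nat_pow_near (x := w / √2) (y := 2)
    (by rw [le_div_iff₀ h2]; linarith) (by norm_num)
  rw [le_div_iff₀ h2] at h1
  rw [div_lt_iff₀ h2, pow_succ] at h3
  refine ⟨l, ?_, ?_⟩ <;> push_cast <;> linarith

/-- The data for a family of polygons. -/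
theorem exists_gridData {n : ℕ} (P : Fin n → Set Plane) {φ : ℝ} {u B K : ℕ}
    (hP : ∀ i, IsPolygon (P i)) (hφ0 : 0 < φ) (hφ1 : φ ≤ 1)
    (hd : ∀ i, √8 ≤ φ * Metric.diam (P i)) (hu : ∀ i, ∀ x ∈ P i, ∀ j, 0 ≤ x j ∧ x j ≤ u)
    (hB : 4 / φ ≤ B) :
    ∃ D : GridData n, D.B = B ∧ D.K = K ∧ D.κ = u + 1 ∧
      (∀ i, 0 < D.side i) ∧ (∀ i, D.side i ≤ u) ∧
      (∀ i, D.ax i * D.side i ≤ u) ∧ (∀ i, D.ay i * D.side i ≤ u) ∧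
      (∀ i, (D.cells i).Nonempty) ∧ (∀ i, ∀ e ∈ D.cells i, e < D.B * D.B) ∧
      (∀ i j, D.side i ≤ D.side j → D.side i ∣ D.side j) ∧
      (∀ i, inner (P i) (φ * Metric.diam (P i)) ⊆ region (D.squares i)) ∧
      ∀ i, region (D.squares i) ⊆ outer (P i) (φ * Metric.diam (P i)) := by
  choose l hl1 hl2 using fun i => exists_side (hd i)
  have hs : ∀ i, 0 < 2 ^ l i := fun i => by positivity
  have h8 : 0 < √8 := by positivity
  have h2 : 0 < √2 := by positivity
  -- From `φ d ≤ 2√2 s` comes `d / s ≤ 2√2 / φ`, and `1 + 2√2 ≤ 4`. A single `B` therefore serves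
  -- all polygons, whatever their diameters.
  have hBi : ∀ i, 1 + Metric.diam (P i) / (2 ^ l i : ℕ) ≤ B := by
    intro i
    refine le_trans ?_ hB
    have hsR : (0 : ℝ) < (2 ^ l i : ℕ) := by exact_mod_cast hs i
    have h3 : Metric.diam (P i) / (2 ^ l i : ℕ) ≤ 2 * √2 / φ := by
      rw [div_le_div_iff₀ hsR hφ0]
      linarith [hl2 i]
    have h4 : 1 ≤ 1 / φ := by rw [le_div_iff₀ hφ0]; linarith
    have h5 : √2 ≤ 3 / 2 := by
      rw [Real.sqrt_le_left (by norm_num)]; norm_num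
    calc 1 + Metric.diam (P i) / (2 ^ l i : ℕ) ≤ 1 / φ + 2 * √2 / φ := add_le_add h4 h3
      _ = (1 + 2 * √2) / φ := by rw [add_div]
      _ ≤ 4 / φ := by gcongr; linarith
  choose ax ay cells hax hay hne hlt hmem using fun i => exists_cells (hP i) (hs i) (hu i) (hBi i)
  let D : GridData n := ⟨B, K, u + 1, fun i => 2 ^ l i, ax, ay, cells⟩
  have hF : ∀ i, ∀ x y : ℕ, (x, y) ∈ D.squares i ↔ ∃ z ∈ interior (P i),
      ⌊z 0⌋₊ / 2 ^ l i = x / 2 ^ l i ∧ ⌊z 1⌋₊ / 2 ^ l i = y / 2 ^ l i := fun i x y => by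
    rw [GridData.mem_squares (hs i) (hlt i), ← hmem i x y]
    rfl
  refine ⟨D, rfl, rfl, rfl, hs, fun i => ?_, hax, hay, hne, hlt, fun i j hij => ?_,
    fun i => inner_subset_region (hP i) (h8.trans_le (hd i)) (hu i) (hF i),
    fun i => region_subset_outer (hs i) (hl1 i) (hu i) (hF i)⟩
  · have h3 := diam_le_of_box (hu i)
    have h4 : φ * Metric.diam (P i) ≤ Metric.diam (P i) :=
      mul_le_of_le_one_left Metric.diam_nonneg hφ1
    have h5 : √2 * (2 ^ l i : ℕ) ≤ √2 * u := (hl1 i).trans (h4.trans h3)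
    exact_mod_cast le_of_mul_le_mul_left h5 h2
  · exact pow_dvd_pow 2 ((Nat.pow_le_pow_iff_right (by norm_num)).1 hij)

/-! ### Word sizes, estimators and the final bounds -/

/-- Bounds for the sizes of all words. -/
theorem GridData.fits_of_le {n W T u : ℕ} {D : GridData n} (hT : 5 ≤ T) (hn0 : 0 < n) (hn : n ≤ T)
    (huT : u ≤ T) (hB0 : 0 < D.B) (hB : D.B ≤ 3 * T) (hK0 : 0 < D.K) (hK : D.K ≤ 5 * T ^ 3)
    (hκ : D.κ = u + 1) (hs0 : ∀ i, 0 < D.side i) (hs : ∀ i, D.side i ≤ u)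
    (hx : ∀ i, D.ax i * D.side i ≤ u) (hy : ∀ i, D.ay i * D.side i ≤ u)
    (hne : ∀ i, (D.cells i).Nonempty) (hlt : ∀ i, ∀ e ∈ D.cells i, e < D.B * D.B)
    (hTW : T ^ 11 ≤ 2 ^ W) : D.Fits W := by
  have hpow : ∀ m ≤ 11, T ^ m ≤ 2 ^ W := fun m hm =>
    (Nat.pow_le_pow_right (by omega) hm).trans hTW
  have h1 : 5 * T ≤ T ^ 2 := by rw [pow_two]; exact Nat.mul_le_mul_right _ hT
  have h3 : 125 ≤ T ^ 3 := (Nat.pow_le_pow_left hT 3 : 5 ^ 3 ≤ T ^ 3)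
  have hBB : D.B * D.B ≤ 9 * T ^ 2 := (Nat.mul_le_mul hB hB).trans (by ring_nf; exact le_rfl)
  have hbox : ∀ a s, a * s ≤ u → s ≤ u → (a + D.B) * s < 2 ^ W := by
    intro a s h h'
    have e1 : D.B * s ≤ 3 * T * T := Nat.mul_le_mul hB (h'.trans huT)
    have e2 := hpow 3 (by norm_num)
    have e3 : 5 * T ^ 2 ≤ T ^ 3 := by rw [pow_succ' T 2]; exact Nat.mul_le_mul_right _ hT
    rw [Nat.add_mul]
    nlinarith
  refine ⟨hB0, hK0, hs0, fun i => ?_, hlt, hne, ?_, ?_, fun i => hbox _ _ (hx i) (hs i),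
    fun i => hbox _ _ (hy i) (hs i), fun i => ?_⟩
  · have := hs i
    omega
  · have := hpow 2 (by norm_num)
    omega
  · have e1 : (n + 1) * (5 + 2 * (D.B * D.B)) ≤ (2 * T) * (19 * T ^ 2) :=
      Nat.mul_le_mul (by omega) (by nlinarith)
    have e2 : (2 * T) * (19 * T ^ 2) = 38 * T ^ 3 := by ring
    have e3 : T ≤ T ^ 3 := Nat.le_self_pow (by norm_num) T
    have e4 : 125 * T ^ 3 ≤ T ^ 6 := by
      rw [show T ^ 6 = T ^ 3 * T ^ 3 by ring]
      exact Nat.mul_le_mul_right _ h3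
    have := hpow 6 (by norm_num)
    omega
  · have hsT := (hs i).trans huT
    -- The largest quantity, and the source of the exponent 11: twice `45 T ^ 8` is less than `125 T
    -- ^ 8 ≤ T ^ 11`.
    have e1 : D.K * n * (D.B * D.B * (D.side i * D.side i)) ≤
        5 * T ^ 3 * T * (9 * T ^ 2 * (T * T)) := by gcongr
    have e2 : 5 * T ^ 3 * T * (9 * T ^ 2 * (T * T)) = 45 * T ^ 8 := by ring
    have e3 : 125 * T ^ 8 ≤ T ^ 11 := by
      rw [show T ^ 11 = T ^ 3 * T ^ 8 by ring]
      exact Nat.mul_le_mul_right _ h3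
    have e4 : 0 < T ^ 8 := by positivity
    omega

/-- The choice of `K` makes the Chebyshev bound `4 / (ε² K)` at most `δ`; strictness is inherited
from `union_bad`. -/
theorem GridData.Fits.unionEstimator {n W : ℕ} {D : GridData n} (hf : D.Fits W) (hn : 0 < n)
    {q : List (Fin n)} (hq : q ≠ []) (hnd : q.Nodup) {ε δ : ℝ} (hε0 : 0 < ε) (hε1 : ε < 1)
    (hδ0 : 0 < δ) (hδ1 : δ < 1) (hK : 4 / (ε ^ 2 * δ) ≤ D.K) {I O : Fin n → Set Plane}
    (hI : ∀ i, I i ⊆ region (D.squares i)) (hO : ∀ i, region (D.squares i) ⊆ O i) :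
    IsFuzzyEstimator W unionQuery (PMF.pure D.summary) q ε δ (⋃ i ∈ q, I i) (⋃ i ∈ q, O i) ∧
      expectedTime W unionQuery (PMF.pure D.summary) q ≤
        ENNReal.ofReal (90 * D.K * q.length) := by
  have hst := hf.isStart hn hq hnd
  refine ⟨⟨region (D.unionSquares (fun j => q.getD j ⟨0, hn⟩) q.length),
    measurableSet_region _, ?_, ?_, ?_⟩, expectedTime_pure_le (union_time hst)⟩
  · rw [region_unionSquares]
    exact Set.iUnion₂_mono fun i _ => hI i
  · rw [region_unionSquares]
    exact Set.iUnion₂_mono fun i _ => hO i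
  · rw [volume_region]
    obtain ⟨v, hv, hbad⟩ := union_bad hst hε0 hε1
    refine isEstimator_pure hδ0 hδ1 (hv.trans_le ?_) ENNReal.ofReal_ne_top (union_time hst) hbad
    have hKp : (0 : ℝ) < D.K := by exact_mod_cast hf.K_pos
    rw [div_le_iff₀ (by positivity)] at hK ⊢
    linarith

theorem GridData.Fits.interEstimator {n W : ℕ} {D : GridData n} (hf : D.Fits W) (hn : 0 < n)
    (hdvd : ∀ i j, D.side i ≤ D.side j → D.side i ∣ D.side j)
    {q : List (Fin n)} (hq : q ≠ []) (hnd : q.Nodup) {ε δ : ℝ} (hε0 : 0 < ε)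
    (hδ0 : 0 < δ) (hδ1 : δ < 1) {I O : Fin n → Set Plane}
    (hI : ∀ i, I i ⊆ region (D.squares i)) (hO : ∀ i, region (D.squares i) ⊆ O i) :
    IsFuzzyEstimator W interQuery (PMF.pure D.summary) q ε δ (⋂ i ∈ q, I i) (⋂ i ∈ q, O i) ∧
      expectedTime W interQuery (PMF.pure D.summary) q ≤
        ENNReal.ofReal (80 * (D.B * D.B) * q.length) := by
  have hst := hf.isStart hn hq hnd
  have htime : ∀ t, cost W interQuery 1 (fun _ => 0) t (start W D.summary q) ≤
      ENNReal.ofReal (80 * (D.B * D.B) * q.length) := fun t => by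
    have := inter_cost hst zero_le_one hdvd (f := fun _ => 0) (fun _ _ => rfl) t
    rwa [mul_one, ENNReal.ofReal_one] at this
  refine ⟨⟨region (D.interSquares (fun j => q.getD j ⟨0, hn⟩) q.length),
    measurableSet_region _, ?_, ?_, ?_⟩, expectedTime_pure_le htime⟩
  · rw [region_interSquares hn hq]
    exact Set.iInter₂_mono fun i _ => hI i
  · rw [region_interSquares hn hq]
    exact Set.iInter₂_mono fun i _ => hO i
  · rw [volume_region]
    refine isEstimator_pure (v := 0) hδ0 hδ1 hδ0 ENNReal.ofReal_ne_top htime fun t => ?_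
    have := inter_cost hst le_rfl hdvd (f := {c : Config |
      |c.output - (D.interSquares (fun j => q.getD j ⟨0, hn⟩) q.length).card| ≤
        ε * (D.interSquares (fun j => q.getD j ⟨0, hn⟩) q.length).card}ᶜ.indicator 1)
      (fun c hc => Set.indicator_of_notMem (by
        simp only [Set.mem_compl_iff, not_not]
        show |c.output - _| ≤ _
        rw [hc, sub_self, abs_zero]
        positivity) _) t
    simpa only [mul_zero, ENNReal.ofReal_zero] using this

/-- Applied to the lattice counts, this lets the ratio `N_max / N_min` be inserted into the size
bound for free. -/
theorem one_le_iSup_div_iInf {n : ℕ} (hn : 0 < n) {f : Fin n → ℝ} (hf : ∀ i, 0 < f i) :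
    1 ≤ (⨆ i, f i) / ⨅ i, f i := by
  have : Nonempty (Fin n) := ⟨⟨0, hn⟩⟩
  obtain ⟨i, hi⟩ := exists_eq_ciInf_of_finite (f := f)
  rw [← hi, one_le_div (hf i)]
  exact le_ciSup (Set.finite_range f).bddAbove i

end FuzzyPolygons
open FuzzyPolygons in
theorem mainTheorem7 :
    ∃ (unionProg interProg : List Instr) (c : ℕ) (C : ℝ), 0 < C ∧
      ∀ (n : ℕ) (P : Fin n → Set Plane) (ε δ φ : ℝ) (u W : ℕ),
        0 < n → (∀ i, IsPolygon (P i)) →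
        0 < ε → ε < 1 → 0 < δ → δ < 1 → 0 < φ → φ ≤ 1 →
        (∀ i, Real.sqrt 8 ≤ φ * Metric.diam (P i)) →
        (∀ i, ∀ x ∈ P i, ∀ j, 0 ≤ x j ∧ x j ≤ u) →
        ((n : ℝ) + u + 1 / ε + 1 / δ) ^ c ≤ 2 ^ W →
        ∃ S : PMF (List ℕ),
          (∀ s ∈ S.support, (∀ x ∈ s, x < 2 ^ W) ∧
            (s.length : ℝ) ≤ C * (n / (φ ^ 2 * δ ^ 2 * ε)) *
              ((⨆ i, (latticeCount (outer (P i) (φ * Metric.diam (P i) / 2)) : ℝ)) /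
                (⨅ i, (latticeCount (outer (P i) (φ * Metric.diam (P i) / 2)) : ℝ)))) ∧
          ∀ q : List (Fin n), q ≠ [] → q.Nodup →
            (IsFuzzyEstimator W unionProg S q ε δ
                (⋃ i ∈ q, inner (P i) (φ * Metric.diam (P i)))
                (⋃ i ∈ q, outer (P i) (φ * Metric.diam (P i))) ∧
              expectedTime W unionProg S q ≤
                ENNReal.ofReal (C * (q.length / (δ * ε ^ 2)))) ∧
            (IsFuzzyEstimator W interProg S q ε δ
                (⋂ i ∈ q, inner (P i) (φ * Metric.diam (P i)))
                (⋂ i ∈ q, outer (P i) (φ * Metric.diam (P i))) ∧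
              expectedTime W interProg S q ≤
                ENNReal.ofReal (C * (q.length / (φ ^ 2 * δ * ε ^ 2)))) := by
  -- The exponent is `2 * 11`: the rounded parameter `T` is at most `Z ^ 2`, and `Fits` needs `T ^
  -- 11 ≤ 2 ^ W`. The constant `2000 = 80 * 25` comes from the intersection time with `B ≤ 5 / φ`.
  refine ⟨unionQuery, interQuery, 22, 2000, by norm_num, ?_⟩
  intro n P ε δ φ u W hn hP hε0 hε1 hδ0 hδ1 hφ0 hφ1 hd hu hW
  have h2 : 0 < √2 := by positivity
  -- From `√8 ≤ φ d ≤ φ √2 u`. Thus `1 / φ ≤ u / 2`, which is why the word size need not mention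
  -- `φ`.
  have hφu : 2 ≤ φ * u := by
    have h := hd ⟨0, hn⟩
    rw [sqrt_eight] at h
    have h3 := mul_le_mul_of_nonneg_left (diam_le_of_box (hu ⟨0, hn⟩)) hφ0.le
    refine le_of_mul_le_mul_right ?_ h2
    linarith
  have hu2 : (2 : ℝ) ≤ u := hφu.trans (mul_le_of_le_one_left (Nat.cast_nonneg _) hφ1)
  have hn1 : (1 : ℝ) ≤ n := by exact_mod_cast hn
  have hε1' : 1 < 1 / ε := (one_lt_div hε0).2 hε1
  have hδ1' : 1 < 1 / δ := (one_lt_div hδ0).2 hδ1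
  obtain ⟨Z, hZ⟩ : ∃ Z : ℝ, Z = n + u + 1 / ε + 1 / δ := ⟨_, rfl⟩
  obtain ⟨T, hT⟩ : ∃ T : ℕ, T = ⌈Z⌉₊ := ⟨_, rfl⟩
  rw [← hZ] at hW
  have hZT : Z ≤ T := hT ▸ Nat.le_ceil Z
  have hTZ : (T : ℝ) < Z + 1 := hT ▸ Nat.ceil_lt_add_one (by linarith)
  have hT5 : 5 ≤ T := by
    have : (5 : ℝ) ≤ T := by linarith
    exact_mod_cast this
  have hTW : T ^ 11 ≤ 2 ^ W := by
    have h3 : (T : ℝ) ≤ Z ^ 2 := by nlinarith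
    have h4 : (T : ℝ) ^ 11 ≤ 2 ^ W := by
      refine le_trans ?_ hW
      calc (T : ℝ) ^ 11 ≤ (Z ^ 2) ^ 11 := by gcongr
        _ = Z ^ 22 := by ring
    exact_mod_cast h4
  set K : ℕ := ⌈4 / (ε ^ 2 * δ)⌉₊ with hK
  set B : ℕ := ⌈4 / φ⌉₊ with hB
  have hK1 : 4 / (ε ^ 2 * δ) ≤ K := Nat.le_ceil _
  have hεδ : 1 ≤ 1 / (ε ^ 2 * δ) := by
    rw [le_div_iff₀ (by positivity), one_mul]
    exact mul_le_one₀ (pow_le_one₀ hε0.le hε1.le) hδ0.le hδ1.le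
  have hK2 : (K : ℝ) ≤ 5 / (ε ^ 2 * δ) := by
    have h3 : (K : ℝ) < 4 / (ε ^ 2 * δ) + 1 := Nat.ceil_lt_add_one (by positivity)
    rw [show (5 : ℝ) / (ε ^ 2 * δ) = 4 / (ε ^ 2 * δ) + 1 / (ε ^ 2 * δ) by ring]
    linarith
  have hB1 : 4 / φ ≤ B := Nat.le_ceil _
  have hφ1' : 1 ≤ 1 / φ := by rwa [le_div_iff₀ hφ0, one_mul]
  have hB2 : (B : ℝ) ≤ 5 / φ := by
    have h3 : (B : ℝ) < 4 / φ + 1 := Nat.ceil_lt_add_one (by positivity)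
    rw [show 5 / φ = 4 / φ + 1 / φ by ring]
    linarith
  obtain ⟨D, hDB, hDK, hDκ, hs0, hsu, hax, hay, hne, hlt, hdvd, hin, hout⟩ :=
    exists_gridData P (K := K) hP hφ0 hφ1 hd hu hB1
  have hf : D.Fits W := by
    refine GridData.fits_of_le (u := u) hT5 hn ?_ ?_ ?_ ?_ ?_ ?_ hDκ hs0 hsu hax hay hne hlt hTW
    · exact_mod_cast (by linarith : (n : ℝ) ≤ T)
    · exact_mod_cast (by linarith : (u : ℝ) ≤ T)
    · rw [hDB]; exact Nat.ceil_pos.2 (by positivity)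
    · have h3 : 5 / φ ≤ 5 * (u / 2) := by
        rw [div_le_iff₀ hφ0]
        linarith
      rw [hDB]
      exact_mod_cast (by linarith : (B : ℝ) ≤ 3 * T)
    · rw [hDK]; exact Nat.ceil_pos.2 (by positivity)
    · have h3 : 1 / (ε ^ 2 * δ) ≤ (T : ℝ) ^ 3 := by
        calc 1 / (ε ^ 2 * δ) = (1 / ε) ^ 2 * (1 / δ) := by field_simp
          _ ≤ (T : ℝ) ^ 2 * T := by gcongr <;> linarith
          _ = (T : ℝ) ^ 3 := by ring
      have h4 : (5 : ℝ) / (ε ^ 2 * δ) = 5 * (1 / (ε ^ 2 * δ)) := by ring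
      rw [hDK]
      exact_mod_cast (by linarith : (K : ℝ) ≤ 5 * T ^ 3)
  have hBB : (D.B * D.B : ℝ) ≤ 25 / φ ^ 2 := by
    rw [hDB]
    calc (B * B : ℝ) ≤ 5 / φ * (5 / φ) := by gcongr
      _ = 25 / φ ^ 2 := by ring
  refine ⟨PMF.pure D.summary, ?_, fun q hq hnd => ⟨?_, ?_⟩⟩
  · intro s hs
    rw [PMF.support_pure, Set.mem_singleton_iff] at hs
    subst hs
    constructor
    · intro x hx
      obtain ⟨a, -, rfl⟩ := List.mem_map.1 hx
      exact hf.word_lt hn a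
    · have hlen : (D.summary.length : ℝ) = (n + 1) * (5 + 2 * (D.B * D.B)) := by
        simp [GridData.summary]
      have hratio := one_le_iSup_div_iInf hn
        (f := fun i => (latticeCount (outer (P i) (φ * Metric.diam (P i) / 2)) : ℝ)) fun i => by
          have h := hd i
          rw [sqrt_eight] at h
          exact_mod_cast latticeCount_pos (hP i) (by linarith)
      have h3 : 1 ≤ 1 / φ ^ 2 := by
        rw [le_div_iff₀ (by positivity), one_mul]
        exact pow_le_one₀ hφ0.le hφ1
      have h4 : (n : ℝ) / φ ^ 2 ≤ n / (φ ^ 2 * δ ^ 2 * ε) := by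
        apply div_le_div_of_nonneg_left (by positivity) (by positivity)
        rw [mul_assoc]
        exact mul_le_of_le_one_right (by positivity)
          (mul_le_one₀ (pow_le_one₀ hδ0.le hδ1.le) hε0.le hε1.le)
      rw [hlen]
      calc ((n : ℝ) + 1) * (5 + 2 * (D.B * D.B))
          ≤ (n + n) * (5 * (1 / φ ^ 2) + 2 * (25 / φ ^ 2)) := by
            gcongr
            linarith
        _ = 110 * (n / φ ^ 2) := by ring
        _ ≤ 2000 * (n / (φ ^ 2 * δ ^ 2 * ε)) * 1 := by
            have : 0 ≤ (n : ℝ) / φ ^ 2 := by positivity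
            linarith
        _ ≤ _ := by gcongr
  · obtain ⟨h3, h4⟩ := hf.unionEstimator hn hq hnd hε0 hε1 hδ0 hδ1 (hDK ▸ hK1) hin hout
    refine ⟨h3, h4.trans (ENNReal.ofReal_le_ofReal ?_)⟩
    rw [hDK]
    calc 90 * (K : ℝ) * q.length ≤ 90 * (5 / (ε ^ 2 * δ)) * q.length := by gcongr
      _ = 450 * (q.length / (δ * ε ^ 2)) := by ring
      _ ≤ 2000 * (q.length / (δ * ε ^ 2)) := by gcongr; norm_num
  · obtain ⟨h3, h4⟩ := hf.interEstimator hn hdvd hq hnd hε0 hδ0 hδ1 hin hout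
    refine ⟨h3, h4.trans (ENNReal.ofReal_le_ofReal ?_)⟩
    calc 80 * (D.B * D.B : ℝ) * q.length ≤ 80 * (25 / φ ^ 2) * q.length := by gcongr
      _ = 2000 * (q.length / φ ^ 2) * 1 := by ring
      _ ≤ 2000 * (q.length / φ ^ 2) * (1 / (ε ^ 2 * δ)) := by gcongr
      _ = 2000 * (q.length / (φ ^ 2 * δ * ε ^ 2)) := by
        field_simp
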